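/- Let $(M^n,g)$ be a compact smooth Riemannian manifold without boundary which is Einstein, $\mathrm{ric}^g=E\,g$ with $E\in\mathbb{R}$. Let $\nabla$ be the Levi-Civita connection, let $R(X,Y)=\nabla^2_{Y,X}-\nabla^2_{X,Y}$, and let $\{e_i\}$ denote local orthonormal frames. Symmetric $2$-tensors are identified by $g$ with sections of the bundle $\mathrm{Sym}^2TM$ of $g$-symmetric endomorphisms of $TM$, and $1$-forms with vector fields. For $h\in\Gamma(\mathrm{Sym}^2TM)$ put $$\delta^g h=-\sum_i(\nabla_{e_i}h)e_i,\qquad \mathring{R}h=\sum_i R(e_i,\cdot)he_i,\qquad \Delta_E h=\nabla^*\nabla h-2\mathring{R}h,\qquad \widetilde{\Delta}_E h=\Delta_E h-2\delta^{\star_g}\big(\delta^g h+\tfrac12\,d\,\mathrm{tr}(h)\big),$$ where $\delta^{\star_g}$ is the symmetric part of $\nabla$ on $1$-forms. Let $$\mathscr{E}(M,g)=\{h\in\Gamma(\mathrm{Sym}^2TM):\Delta_E h=0,\ \delta^g h=0,\ \mathrm{tr}(h)=0\}$$ be the space of infinitesimal Einstein deformations. For an endomorphism field $h$ let $d_\nabla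 h(X,Y)=(\nabla_Xh)Y-(\nabla_Yh)X$; for a $TM$-valued $2$-form $\alpha$ let $(h\sharp\alpha)(X,Y)=\alpha(hX,Y)+\alpha(X,hY)$ and $(\delta^g\alpha)(Y)=-\sum_i(\nabla_{e_i}\alpha)(e_i,Y)$. Let $[\cdot,\cdot]^{FN}$ be the symmetric Frölicher-Nijenhuis bracket on $\Gamma(\mathrm{Sym}^2TM)$, $$2[h_1,h_2]^{FN}=-(h_1\sharp d_\nabla h_2+h_2\sharp d_\nabla h_1)+d_\nabla(h_1h_2+h_2h_1),$$ and let $\mathbf{v}:\Gamma(\mathrm{Sym}^2TM)\times\Gamma(\mathrm{Sym}^2TM)\to\Gamma(\mathrm{Sym}^2TM)$ be the operator determined by $$\langle\mathbf{v}(h_1,h_2),h_3\rangle_{L^2}=\langle\delta^g[h_1,h_2]^{FN},h_3\rangle_{L^2}+\langle\delta^g[h_2,h_3]^{FN},h_1\rangle_{L^2}+\langle\delta^g[h_3,h_1]^{FN},h_2\rangle_{L^2}\quad\text{for all }h_3\in\Gamma(\mathrm{Sym}^2TM).$$ Then for every $h\in\mathscr{E}(M,g)$, $$\mathrm{tr}\Big(E\,h^2-\mathbf{v}(h,h)+\tfrac12\widetilde{\Delta}_E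 h^2\Big)=0\quad\text{at every point of }M.$$ -/

import Mathlib

open scoped Manifold ContDiff
open Bundle MeasureTheory

noncomputable section

namespace EinsteinDeformation

section Geometry

variable {n : ℕ} {M : Type*} [TopologicalSpace M] [ChartedSpace (EuclideanSpace ℝ (Fin n)) M]

/-- Finite dimensionality of the tangent spaces. -/
instance instFiniteDimensionalTangentSpace (x : M) : FiniteDimensional ℝ (TangentSpace (𝓡 n) x) :=
  inferInstanceAs (FiniteDimensional ℝ (EuclideanSpace ℝ (Fin n)))

variable [IsManifold (𝓡 n) ∞ M] [RiemannianBundle (fun x : M ↦ TangentSpace (𝓡 n) x)]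

/-! ### Linear algebra in a tangent space -/

/-- A `g`-orthonormal basis `e₁, e₂, …` of the tangent space at `x`. -/
def frame (x : M) :
    OrthonormalBasis (Fin (Module.finrank ℝ (TangentSpace (𝓡 n) x))) ℝ (TangentSpace (𝓡 n) x) :=
  stdOrthonormalBasis ℝ (TangentSpace (𝓡 n) x)

/-- The linear map on `T_x M` that takes the value `φ eᵢ` at `eᵢ`, that is, `φ` itself as soon
as `φ` is linear. -/
def linOf {W : Type*} [NormedAddCommGroup W] [NormedSpace ℝ W] (x : M)
    (φ : TangentSpace (𝓡 n) x → W) :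
    TangentSpace (𝓡 n) x →L[ℝ] W :=
  ∑ i, (innerSL ℝ (E := TangentSpace (𝓡 n) x) (frame x i)).smulRight (φ (frame x i))

/-- The extension of a tangent vector at `x` to a vector field on `M` that is smooth near `x`. -/
def ext {x : M} (v : TangentSpace (𝓡 n) x) : ∀ y : M, TangentSpace (𝓡 n) y :=
  FiberBundle.extend (EuclideanSpace ℝ (Fin n)) v

/-- The trace of an endomorphism of the tangent space. -/
def tr {x : M} (A : TangentSpace (𝓡 n) x →L[ℝ] TangentSpace (𝓡 n) x) : ℝ :=
  LinearMap.trace ℝ (TangentSpace (𝓡 n) x) A.toLinearMap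

/-- The `g`-symmetric part of an endomorphism of the tangent space:
`2 g (symPart A v, w) = g (A v, w) + g (v, A w)`. -/
def symPart {x : M} (A : TangentSpace (𝓡 n) x →L[ℝ] TangentSpace (𝓡 n) x) :
    TangentSpace (𝓡 n) x →L[ℝ] TangentSpace (𝓡 n) x :=
  (1 / 2 : ℝ) • (A + linOf x fun v ↦ ∑ i, inner ℝ v (A (frame x i)) • frame x i)

/-- The inner product of endomorphisms of the tangent space, `∑ᵢ g (A eᵢ, B eᵢ)`. -/
def innerEnd {x : M} (A B : TangentSpace (𝓡 n) x →L[ℝ] TangentSpace (𝓡 n) x) : ℝ :=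
  ∑ i, inner ℝ (A (frame x i)) (B (frame x i))

/-! ### The Levi-Civita connection -/

/-- The right-hand side of the Koszul formula
`2 g (∇_X Y, Z) = X g(Y,Z) + Y g(Z,X) - Z g(X,Y) + g([X,Y],Z) - g([X,Z],Y) - g([Y,Z],X)`,
divided by `2`. -/
def koszul (X Y Z : ∀ y : M, TangentSpace (𝓡 n) y) (x : M) : ℝ :=
  (1 / 2 : ℝ) *
    (mvfderiv (𝓡 n) (fun y ↦ (inner ℝ (Y y) (Z y) : ℝ)) x (X x)
      + mvfderiv (𝓡 n) (fun y ↦ (inner ℝ (Z y) (X y) : ℝ)) x (Y x)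
      - mvfderiv (𝓡 n) (fun y ↦ (inner ℝ (X y) (Y y) : ℝ)) x (Z x)
      + inner ℝ (VectorField.mlieBracket (𝓡 n) X Y x) (Z x)
      - inner ℝ (VectorField.mlieBracket (𝓡 n) X Z x) (Y x)
      - inner ℝ (VectorField.mlieBracket (𝓡 n) Y Z x) (X x))

/-- The Levi-Civita connection on vector fields: `nabla Y x v = (∇_v Y)(x)`. -/
def nabla (Y : ∀ y : M, TangentSpace (𝓡 n) y) (x : M) :
    TangentSpace (𝓡 n) x →L[ℝ] TangentSpace (𝓡 n) x :=
  linOf x fun v ↦ ∑ k, koszul (ext v) Y (ext (frame x k)) x • frame x k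

/-- `(∇_u h) v` for a field of endomorphisms `h`. -/
def nablaEndAt (h : ∀ y : M, TangentSpace (𝓡 n) y →L[ℝ] TangentSpace (𝓡 n) y) (x : M)
    (u v : TangentSpace (𝓡 n) x) :
    TangentSpace (𝓡 n) x :=
  nabla (fun y ↦ h y (ext v y)) x u - h x (nabla (ext v) x u)

/-- The covariant derivative `∇h` of a field of endomorphisms: `nablaEnd h x u v = (∇_u h) v`. -/
def nablaEnd (h : ∀ y : M, TangentSpace (𝓡 n) y →L[ℝ] TangentSpace (𝓡 n) y) (x : M) :
    TangentSpace (𝓡 n) x →L[ℝ] TangentSpace (𝓡 n) x →L[ℝ] TangentSpace (𝓡 n) x :=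
  linOf x fun u ↦ linOf x fun v ↦ nablaEndAt h x u v

/-- `(∇_u A)(v, w)` for a field `A` of bilinear maps with values in the tangent bundle. -/
def nablaBilinAt
    (A : ∀ y : M, TangentSpace (𝓡 n) y →L[ℝ] TangentSpace (𝓡 n) y →L[ℝ] TangentSpace (𝓡 n) y)
    (x : M) (u v w : TangentSpace (𝓡 n) x) :
    TangentSpace (𝓡 n) x :=
  nabla (fun y ↦ A y (ext v y) (ext w y)) x u - A x (nabla (ext v) x u) w
    - A x v (nabla (ext w) x u)

/-! ### Curvature, with the convention `R(X,Y) = ∇²_{Y,X} - ∇²_{X,Y}` -/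

/-- The curvature `R(u,v) w = ∇²_{v,u} w - ∇²_{u,v} w`, where `∇²_{u,v} W = (∇_u (∇ W)) v`. -/
def curv (x : M) (u v w : TangentSpace (𝓡 n) x) : TangentSpace (𝓡 n) x :=
  nablaEndAt (nabla (ext w)) x v u - nablaEndAt (nabla (ext w)) x u v

/-- The Ricci form `ric(v,w) = ∑ᵢ g (R(eᵢ, v) eᵢ, w)`; with the present sign convention for `R`
this is the usual Ricci form, positive on round spheres. -/
def ric (x : M) (v w : TangentSpace (𝓡 n) x) : ℝ :=
  ∑ i, inner ℝ (curv x (frame x i) v (frame x i)) w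

/-- The metric is Einstein with Einstein constant `c`: `ric = c g`. -/
def IsEinstein (n : ℕ) (M : Type*) [TopologicalSpace M]
    [ChartedSpace (EuclideanSpace ℝ (Fin n)) M] [IsManifold (𝓡 n) ∞ M]
    [RiemannianBundle (fun x : M ↦ TangentSpace (𝓡 n) x)] (c : ℝ) : Prop :=
  ∀ (x : M) (v w : TangentSpace (𝓡 n) x), ric x v w = c * inner ℝ v w

/-- The curvature action `(R̊ h) v = ∑ᵢ R(eᵢ, v) (h eᵢ)`. -/
def curvAct (h : ∀ y : M, TangentSpace (𝓡 n) y →L[ℝ] TangentSpace (𝓡 n) y) (x : M) :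
    TangentSpace (𝓡 n) x →L[ℝ] TangentSpace (𝓡 n) x :=
  linOf x fun v ↦ ∑ i, curv x (frame x i) v (h x (frame x i))

/-! ### Differential operators on tensors; `1`-forms are identified with vector fields by `g` -/

/-- The gradient of a function. -/
def grad (f : M → ℝ) (x : M) : TangentSpace (𝓡 n) x :=
  ∑ i, mvfderiv (𝓡 n) f x (frame x i) • frame x i

/-- The divergence `δ h = - ∑ᵢ (∇_{eᵢ} h) eᵢ` of a field of endomorphisms. -/
def div (h : ∀ y : M, TangentSpace (𝓡 n) y →L[ℝ] TangentSpace (𝓡 n) y) (x : M) :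
    TangentSpace (𝓡 n) x :=
  -∑ i, nablaEnd h x (frame x i) (frame x i)

/-- The operator `δ*`: the symmetric part of the covariant derivative. -/
def divStar (X : ∀ y : M, TangentSpace (𝓡 n) y) (x : M) :
    TangentSpace (𝓡 n) x →L[ℝ] TangentSpace (𝓡 n) x :=
  symPart (nabla X x)

/-- The exterior derivative `(d_∇ h)(u,v) = (∇_u h) v - (∇_v h) u`. -/
def extD (h : ∀ y : M, TangentSpace (𝓡 n) y →L[ℝ] TangentSpace (𝓡 n) y) (x : M) :
    TangentSpace (𝓡 n) x →L[ℝ] TangentSpace (𝓡 n) x →L[ℝ] TangentSpace (𝓡 n) x :=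
  linOf x fun u ↦ linOf x fun v ↦ nablaEnd h x u v - nablaEnd h x v u

/-- The divergence of a `TM`-valued `2`-form, `(δ α)(v) = - ∑ᵢ (∇_{eᵢ} α)(eᵢ, v)`. -/
def divForm (α : ∀ y : M, TangentSpace (𝓡 n) y →L[ℝ] TangentSpace (𝓡 n) y →L[ℝ] TangentSpace (𝓡 n) y)
    (x : M) : TangentSpace (𝓡 n) x →L[ℝ] TangentSpace (𝓡 n) x :=
  linOf x fun v ↦ -∑ i, nablaBilinAt α x (frame x i) (frame x i) v

/-- The rough Laplacian `∇*∇ h = - ∑ᵢ ∇²_{eᵢ,eᵢ} h`. -/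
def roughLaplacian (h : ∀ y : M, TangentSpace (𝓡 n) y →L[ℝ] TangentSpace (𝓡 n) y) (x : M) :
    TangentSpace (𝓡 n) x →L[ℝ] TangentSpace (𝓡 n) x :=
  linOf x fun v ↦ -∑ i, nablaBilinAt (nablaEnd h) x (frame x i) (frame x i) v

/-- The Einstein operator `Δ_E = ∇*∇ - 2 R̊`. -/
def einsteinOp (h : ∀ y : M, TangentSpace (𝓡 n) y →L[ℝ] TangentSpace (𝓡 n) y) (x : M) :
    TangentSpace (𝓡 n) x →L[ℝ] TangentSpace (𝓡 n) x :=
  roughLaplacian h x - (2 : ℝ) • curvAct h x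

/-- The perturbed Einstein operator `Δ_E - 2 δ* (δ + ½ d tr)`. -/
def einsteinOpTilde (h : ∀ y : M, TangentSpace (𝓡 n) y →L[ℝ] TangentSpace (𝓡 n) y) (x : M) :
    TangentSpace (𝓡 n) x →L[ℝ] TangentSpace (𝓡 n) x :=
  einsteinOp h x -
    (2 : ℝ) • divStar (fun y : M ↦ div h y + (1 / 2 : ℝ) • grad (n := n) (fun z ↦ tr (h z)) y) x

/-! ### Symmetric tensors and infinitesimal Einstein deformations -/

/-- `h ∈ Γ(Sym² TM)`: `h` is a smooth field of `g`-symmetric endomorphisms. -/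
structure IsSym2 (h : ∀ y : M, TangentSpace (𝓡 n) y →L[ℝ] TangentSpace (𝓡 n) y) : Prop where
  smooth : ContMDiff (𝓡 n)
    ((𝓡 n).prod 𝓘(ℝ, EuclideanSpace ℝ (Fin n) →L[ℝ] EuclideanSpace ℝ (Fin n))) ∞
    (fun y ↦ (⟨y, h y⟩ : Bundle.TotalSpace
      (EuclideanSpace ℝ (Fin n) →L[ℝ] EuclideanSpace ℝ (Fin n)) (fun y : M ↦
        TangentSpace (𝓡 n) y →L[ℝ] TangentSpace (𝓡 n) y)))
  symm : ∀ (y : M) (v w : TangentSpace (𝓡 n) y), inner ℝ (h y v) w = inner ℝ v (h y w)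

/-- The space `𝓔(M,g)` of infinitesimal Einstein deformations. -/
structure IsInfEinsteinDef (h : ∀ y : M, TangentSpace (𝓡 n) y →L[ℝ] TangentSpace (𝓡 n) y) : Prop where
  isSym2 : IsSym2 h
  einsteinOp_eq_zero : ∀ x, einsteinOp h x = 0
  div_eq_zero : ∀ x, div h x = 0
  tr_eq_zero : ∀ x, tr (h x) = 0

/-! ### The Frölicher–Nijenhuis bracket -/

/-- The algebraic action `(h ♯ α)(u,v) = α(h u, v) + α(u, h v)`. -/
def sharp (h : ∀ y : M, TangentSpace (𝓡 n) y →L[ℝ] TangentSpace (𝓡 n) y)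
    (α : ∀ y : M, TangentSpace (𝓡 n) y →L[ℝ] TangentSpace (𝓡 n) y →L[ℝ] TangentSpace (𝓡 n) y) (x : M) :
    TangentSpace (𝓡 n) x →L[ℝ] TangentSpace (𝓡 n) x →L[ℝ] TangentSpace (𝓡 n) x :=
  linOf x fun u ↦ linOf x fun v ↦ α x (h x u) v + α x u (h x v)

/-- The symmetric Frölicher–Nijenhuis bracket,
`2 [h₁,h₂] = - (h₁ ♯ d_∇ h₂ + h₂ ♯ d_∇ h₁) + d_∇ (h₁ ∘ h₂ + h₂ ∘ h₁)`. -/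
def fnBracket (h₁ h₂ : ∀ y : M, TangentSpace (𝓡 n) y →L[ℝ] TangentSpace (𝓡 n) y) (x : M) :
    TangentSpace (𝓡 n) x →L[ℝ] TangentSpace (𝓡 n) x →L[ℝ] TangentSpace (𝓡 n) x :=
  (1 / 2 : ℝ) • (-(sharp h₁ (extD h₂) x + sharp h₂ (extD h₁) x)
    + extD (fun y ↦ h₁ y ∘L h₂ y + h₂ y ∘L h₁ y) x)

/-! ### Riemannian measure, `L²` product and the operator `v` -/

/-- The coordinate vector field `∂ᵢ` of the chart at `x₀`, at the point with coordinates `y`. -/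
def coordVec (x₀ : M) (i : Fin n) (y : EuclideanSpace ℝ (Fin n)) :
    TangentSpace (𝓡 n) ((chartAt (EuclideanSpace ℝ (Fin n)) x₀).symm y) :=
  mfderiv (𝓡 n) (𝓡 n) (chartAt (EuclideanSpace ℝ (Fin n)) x₀).symm y
    (EuclideanSpace.single i (1 : ℝ) : EuclideanSpace ℝ (Fin n))

/-- The measure `√det(g (∂ᵢ, ∂ⱼ)) dy` on the domain of the chart at `x₀`, as a measure on `M`. -/
def chartVolume [MeasurableSpace M] (x₀ : M) : Measure M :=
  ((volume.restrict (chartAt (EuclideanSpace ℝ (Fin n)) x₀).target).withDensity fun y ↦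
      ENNReal.ofReal (Real.sqrt (Matrix.det (Matrix.of fun i j : Fin n ↦
        (inner ℝ (coordVec x₀ i y) (coordVec x₀ j y) : ℝ))))).map
    (chartAt (EuclideanSpace ℝ (Fin n)) x₀).symm

/-- The Riemannian measure: the least measure on `M` that dominates the measures
`√det(g (∂ᵢ, ∂ⱼ)) dy` of all charts. As those agree on overlaps, it restricts to
`√det(g (∂ᵢ, ∂ⱼ)) dy` on each chart domain. -/
def riemannianVolume (n : ℕ) (M : Type*) [TopologicalSpace M]
    [ChartedSpace (EuclideanSpace ℝ (Fin n)) M] [IsManifold (𝓡 n) ∞ M]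
    [RiemannianBundle (fun x : M ↦ TangentSpace (𝓡 n) x)] [MeasurableSpace M] : Measure M :=
  ⨆ x₀ : M, chartVolume (n := n) x₀

variable [MeasurableSpace M]

/-- The `L²` inner product of fields of endomorphisms. -/
def innerL2 (A B : ∀ y : M, TangentSpace (𝓡 n) y →L[ℝ] TangentSpace (𝓡 n) y) : ℝ :=
  ∫ x, innerEnd (A x) (B x) ∂(riemannianVolume n M)

/-- `w ∈ Γ(Sym² TM)` is the tensor `v(h₁,h₂)`: for all `h₃ ∈ Γ(Sym² TM)`, `⟨w, h₃⟩` is the cyclic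
sum of `⟨δ [h_a, h_b], h_c⟩`. -/
structure IsV (h₁ h₂ w : ∀ y : M, TangentSpace (𝓡 n) y →L[ℝ] TangentSpace (𝓡 n) y) : Prop where
  isSym2 : IsSym2 w
  innerL2_eq : ∀ h₃ : ∀ y : M, TangentSpace (𝓡 n) y →L[ℝ] TangentSpace (𝓡 n) y, IsSym2 h₃ →
    innerL2 w h₃ =
      innerL2 (divForm (fnBracket h₁ h₂)) h₃ + innerL2 (divForm (fnBracket h₂ h₃)) h₁
        + innerL2 (divForm (fnBracket h₃ h₁)) h₂

open Classical in
/-- The operator `v : Γ(Sym² TM) × Γ(Sym² TM) → Γ(Sym² TM)` determined by its `L²` products with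
all of `Γ(Sym² TM)` (the value `0` is a default that is not used on a compact manifold). -/
def vOp (h₁ h₂ : ∀ y : M, TangentSpace (𝓡 n) y →L[ℝ] TangentSpace (𝓡 n) y) :
    ∀ y : M, TangentSpace (𝓡 n) y →L[ℝ] TangentSpace (𝓡 n) y :=
  if H : ∃ w, IsV h₁ h₂ w then H.choose else fun _ ↦ 0

end Geometry

end EinsteinDeformation

end

/-! Write div X for tr ∇X. The identity holds because both traces are divergences of the same vector
field, up to a multiple of tr h².

For any smooth k, the trace of Δ̃_E k is explicit. The rough Laplacian contributes −div grad tr k.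
By the skew symmetries of the curvature and ric = E g, the term −2R̊k contributes −2E tr k. The
gauge term contributes −2 div δk − div grad tr k. With k = h² this gives E tr h² + ½ tr Δ̃_E h² =
−div(grad tr h² + δh²) (`tr_einsteinOpTilde`). It remains to see that tr v(h,h) is the same
divergence (`tr_isV`).

The trace of v(h,h) is found by testing against h₃ = f·id for an arbitrary function f. After δ is
moved to the other factor, ⟨v(h,h), f·id⟩ is the integral of ⟨[h,h], ∇(f id)⟩ + 2⟨[h, f id], ∇h⟩,
where only first derivatives occur. Since tr h = 0 and δh = 0, the two terms are ½ df(grad tr h²)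
and ½ df(grad tr h²) + df(δh²) pointwise (`innerBil_fnBracket_self_smul_id`,
`two_mul_innerBil_fnBracket_smul_id`). One more integration by parts frees f.

Two foundations support this. One is the divergence theorem for the measure built from charts
(`integral_tr_nabla`); it rests on the coordinate expression √det G · div X = ∑ ∂ᵢ(√det G Xⁱ) and a
partition of unity. The other is the existence of v(h,h) (`exists_isV`): every term of its defining
functional is brought by adjunction to the form ⟨·, h₃⟩, and the symmetric part of the resulting
tensor is taken.

Orthonormal bases are chosen point by point without any continuity, so smoothness is always
established through a finite global family of smooth fields dual to each other
(`exists_isDualFrame`). -/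

noncomputable section

namespace EinsteinDeformation

open VectorField Filter Topology

set_option linter.unusedSectionVars false

/-! ### The Levi-Civita connection and Lie brackets -/

section LeviCivita

variable {n : ℕ} {M : Type*} [TopologicalSpace M] [ChartedSpace (EuclideanSpace ℝ (Fin n)) M]

/-- Vector fields on `M`. -/
abbrev VecField (n : ℕ) (M : Type*) [TopologicalSpace M]
    [ChartedSpace (EuclideanSpace ℝ (Fin n)) M] :=
  ∀ y : M, TangentSpace (𝓡 n) y

/-- Fields of endomorphisms of the tangent bundle of `M`. -/
abbrev EndField (n : ℕ) (M : Type*) [TopologicalSpace M]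
    [ChartedSpace (EuclideanSpace ℝ (Fin n)) M] :=
  ∀ y : M, TangentSpace (𝓡 n) y →L[ℝ] TangentSpace (𝓡 n) y

/-- Fields of bilinear maps on the tangent bundle of `M` with values in the tangent bundle. -/
abbrev BilField (n : ℕ) (M : Type*) [TopologicalSpace M]
    [ChartedSpace (EuclideanSpace ℝ (Fin n)) M] :=
  ∀ y : M, TangentSpace (𝓡 n) y →L[ℝ] TangentSpace (𝓡 n) y →L[ℝ] TangentSpace (𝓡 n) y

variable [IsManifold (𝓡 n) ∞ M]

/-- Differentiability of a vector field at a point. -/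
abbrev VDiffAt (X : VecField n M) (x : M) : Prop :=
  MDifferentiableAt (𝓡 n) ((𝓡 n).prod 𝓘(ℝ, EuclideanSpace ℝ (Fin n)))
    (fun y ↦ (⟨y, X y⟩ : TotalSpace (EuclideanSpace ℝ (Fin n)) (fun y : M ↦ TangentSpace (𝓡 n) y))) x

/-- Smoothness of a vector field at a point. -/
abbrev VSmoothAt (X : VecField n M) (x : M) : Prop :=
  ContMDiffAt (𝓡 n) ((𝓡 n).prod 𝓘(ℝ, EuclideanSpace ℝ (Fin n))) ∞
    (fun y ↦ (⟨y, X y⟩ : TotalSpace (EuclideanSpace ℝ (Fin n)) (fun y : M ↦ TangentSpace (𝓡 n) y))) x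

-- This is the regularity under which the Jacobi identity for brackets of vector fields is
-- available.
scoped instance instIsManifoldThree : IsManifold (𝓡 n) (minSmoothness ℝ 3) M :=
  IsManifold.of_le (n := ∞) (by simp only [minSmoothness_of_isRCLikeNormedField]; exact ENat.LEInfty.out)

theorem one_le_infty : (1 : WithTop ℕ∞) ≤ ∞ := ENat.LEInfty.out

theorem VSmoothAt.vdiffAt {X : VecField n M} {x : M} (h : VSmoothAt X x) : VDiffAt X x :=
  ContMDiffAt.mdifferentiableAt h (by simp)

theorem mdiffAt_ext {x : M} (v : TangentSpace (𝓡 n) x) : VDiffAt (ext v) x :=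
  FiberBundle.mdifferentiableAt_extend (𝓡 n) (EuclideanSpace ℝ (Fin n)) v

@[simp]
theorem ext_self {x : M} (v : TangentSpace (𝓡 n) x) : ext v x = v :=
  FiberBundle.extend_apply_self _ _

theorem contMDiffAt_ext {x : M} (v : TangentSpace (𝓡 n) x) : VSmoothAt (ext v) x :=
  FiberBundle.contMDiffAt_extend (𝓡 n) (EuclideanSpace ℝ (Fin n)) v

variable [RiemannianBundle (fun x : M ↦ TangentSpace (𝓡 n) x)]

section LinOf

theorem inner_frame_expand {x : M} (v : TangentSpace (𝓡 n) x) :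
    ∑ i, (inner ℝ (frame x i) v : ℝ) • frame x i = v :=
  (frame x).sum_repr' v

variable {W : Type*} [NormedAddCommGroup W] [NormedSpace ℝ W]

theorem linOf_apply {x : M} (φ : TangentSpace (𝓡 n) x → W) (v : TangentSpace (𝓡 n) x) :
    linOf x φ v = ∑ i, (inner ℝ (frame x i) v : ℝ) • φ (frame x i) := by
  simp [linOf]

theorem linOf_frame {x : M} (φ : TangentSpace (𝓡 n) x → W) (i) :
    linOf x φ (frame x i) = φ (frame x i) := by
  classical
  simp [linOf_apply, orthonormal_iff_ite.mp (frame x).orthonormal]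

/-- Every tensor of the statement is built by `linOf` from values on a chosen basis. Once the
underlying expression is shown to be linear, this removes the choice. -/
theorem linOf_eq {x : M} (φ : TangentSpace (𝓡 n) x → W)
    (hadd : ∀ u v, φ (u + v) = φ u + φ v) (hsmul : ∀ (c : ℝ) v, φ (c • v) = c • φ v)
    (v : TangentSpace (𝓡 n) x) : linOf x φ v = φ v := by
  let L : TangentSpace (𝓡 n) x →ₗ[ℝ] W := ⟨⟨φ, hadd⟩, hsmul⟩
  have h : L v = φ v := rfl
  rw [linOf_apply, ← h]
  conv_rhs => rw [← inner_frame_expand v]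
  simp [L]

end LinOf

variable [IsContMDiffRiemannianBundle (𝓡 n) ∞ (EuclideanSpace ℝ (Fin n))
      (fun x : M ↦ TangentSpace (𝓡 n) x)]

scoped instance instIsContMDiffRiemannianBundleOne :
    IsContMDiffRiemannianBundle (𝓡 n) 1 (EuclideanSpace ℝ (Fin n))
      (fun x : M ↦ TangentSpace (𝓡 n) x) :=
  IsContMDiffRiemannianBundle.of_le (n := ∞) (by simp)

theorem mdiffAt_inner {X Y : VecField n M} {x : M} (hX : VDiffAt X x)
    (hY : VDiffAt Y x) : MDifferentiableAt (𝓡 n) 𝓘(ℝ) (fun y ↦ (inner ℝ (X y) (Y y) : ℝ)) x :=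
  hX.inner_bundle hY

theorem contMDiffAt_inner {X Y : VecField n M} {x : M} (hX : VSmoothAt X x)
    (hY : VSmoothAt Y x) : ContMDiffAt (𝓡 n) 𝓘(ℝ) ∞ (fun y ↦ (inner ℝ (X y) (Y y) : ℝ)) x :=
  hX.inner_bundle hY

theorem mvfderiv_smul_apply {f g : M → ℝ} {x : M} (hf : MDifferentiableAt (𝓡 n) 𝓘(ℝ) f x) (hg : MDifferentiableAt (𝓡 n) 𝓘(ℝ) g x)
    (v : TangentSpace (𝓡 n) x) :
    mvfderiv (𝓡 n) (fun y ↦ f y * g y) x v =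
      f x * mvfderiv (𝓡 n) g x v + mvfderiv (𝓡 n) f x v * g x := by
  have := congr($(mvfderiv_mul hf hg) v)
  simp only [Pi.mul_def] at this
  rw [this]
  simp [mul_comm]

/-- The derivatives of f produced by the metric terms cancel against those produced by the brackets.
-/
theorem koszul_tensorial_left {Y Z : VecField n M} {x : M} (hY : VDiffAt Y x)
    (hZ : VDiffAt Z x) :
    TensorialAt (𝓡 n) (EuclideanSpace ℝ (Fin n)) (fun X : VecField n M ↦ koszul X Y Z x) x where
  smul {f X} hf hX := by
    simp only [koszul, Pi.smul_apply', smul_eq_mul, inner_smul_left, inner_smul_right,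
      map_smul, mlieBracket_smul_left hf hX, RCLike.conj_to_real, inner_add_left]
    rw [mvfderiv_smul_apply hf (mdiffAt_inner hZ hX), mvfderiv_smul_apply hf (mdiffAt_inner hX hY)]
    rw [real_inner_comm (Z x) (X x)]
    ring
  add {X X'} hX hX' := by
    simp only [koszul, Pi.add_apply, inner_add_left, inner_add_right,
      map_add, mlieBracket_add_left hX hX']
    have h1 := congr($(mvfderiv_add (mdiffAt_inner hZ hX) (mdiffAt_inner hZ hX')) (Y x))
    have h2 := congr($(mvfderiv_add (mdiffAt_inner hX hY) (mdiffAt_inner hX' hY)) (Z x))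
    simp only [Pi.add_def, _root_.add_apply] at h1 h2
    rw [h1, h2]
    ring

theorem koszul_tensorial_right {X Y : VecField n M} {x : M} (hX : VDiffAt X x)
    (hY : VDiffAt Y x) :
    TensorialAt (𝓡 n) (EuclideanSpace ℝ (Fin n)) (fun Z : VecField n M ↦ koszul X Y Z x) x where
  smul {f Z} hf hZ := by
    simp only [koszul, Pi.smul_apply', smul_eq_mul, inner_smul_left, inner_smul_right,
      map_smul, mlieBracket_smul_right hf hZ, RCLike.conj_to_real, inner_add_left]
    rw [mvfderiv_smul_apply hf (mdiffAt_inner hZ hX), mvfderiv_smul_apply hf (mdiffAt_inner hY hZ)]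
    rw [real_inner_comm (Z x) (Y x)]
    ring
  add {Z Z'} hZ hZ' := by
    simp only [koszul, Pi.add_apply, inner_add_left, inner_add_right,
      map_add, mlieBracket_add_right hZ hZ']
    have h1 := congr($(mvfderiv_add (mdiffAt_inner hZ hX) (mdiffAt_inner hZ' hX)) (Y x))
    have h2 := congr($(mvfderiv_add (mdiffAt_inner hY hZ) (mdiffAt_inner hY hZ')) (X x))
    simp only [Pi.add_def, _root_.add_apply] at h1 h2
    rw [h1, h2]
    ring

theorem koszul_add_mid {X Y Y' Z : VecField n M} {x : M} (hX : VDiffAt X x)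
    (hY : VDiffAt Y x) (hY' : VDiffAt Y' x) (hZ : VDiffAt Z x) :
    koszul X (Y + Y') Z x = koszul X Y Z x + koszul X Y' Z x := by
  simp only [koszul, Pi.add_apply, inner_add_left, inner_add_right,
    map_add, mlieBracket_add_right hY hY', mlieBracket_add_left hY hY']
  have h1 := congr($(mvfderiv_add (mdiffAt_inner hX hY) (mdiffAt_inner hX hY')) (Z x))
  have h2 := congr($(mvfderiv_add (mdiffAt_inner hY hZ) (mdiffAt_inner hY' hZ)) (X x))
  simp only [Pi.add_def, _root_.add_apply] at h1 h2
  rw [h1, h2]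
  ring

/-- The terms X g(Y,Z) and g([X,Y],Z) each produce (Xf) g(Y,Z), which accounts for the factor ½; the
two terms with Zf cancel. This is the source of the Leibniz rule for `nabla`. -/
theorem koszul_smul_mid {X Y Z : VecField n M} {f : M → ℝ} {x : M} (hf : MDifferentiableAt (𝓡 n) 𝓘(ℝ) f x)
    (hX : VDiffAt X x) (hY : VDiffAt Y x) (hZ : VDiffAt Z x) :
    koszul X (f • Y) Z x =
      f x * koszul X Y Z x + mvfderiv (𝓡 n) f x (X x) * inner ℝ (Y x) (Z x) := by
  simp only [koszul, Pi.smul_apply', smul_eq_mul, inner_smul_left, inner_smul_right,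
    map_smul, mlieBracket_smul_right hf hY, mlieBracket_smul_left hf hY, RCLike.conj_to_real,
    inner_add_left]
  rw [mvfderiv_smul_apply hf (mdiffAt_inner hX hY), mvfderiv_smul_apply hf (mdiffAt_inner hY hZ)]
  rw [real_inner_comm (X x) (Y x)]
  ring

/-- The characterisation of the Levi-Civita connection by the Koszul formula. -/
theorem inner_nabla {X Y Z : VecField n M} {x : M} (hX : VDiffAt X x)
    (hY : VDiffAt Y x) (hZ : VDiffAt Z x) :
    inner ℝ (nabla Y x (X x)) (Z x) = koszul X Y Z x := by
  classical
  -- By tensoriality the extensions used in the definition may be replaced by any fields with the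
  -- same values at x. This also yields linearity: a sum of extensions need only agree with the
  -- extension of the sum at x.
  have key (v w : TangentSpace (𝓡 n) x) (X' Z' : VecField n M) (hX' : VDiffAt X' x)
      (hZ' : VDiffAt Z' x) (h1 : X' x = v) (h2 : Z' x = w) :
      koszul (ext v) Y (ext w) x = koszul X' Y Z' x := by
    rw [(koszul_tensorial_left hY (mdiffAt_ext w)).pointwise (mdiffAt_ext v) hX' (by simp [h1]),
      (koszul_tensorial_right hX' hY).pointwise (mdiffAt_ext w) hZ' (by simp [h2])]
  have addl (u v w : TangentSpace (𝓡 n) x) : koszul (ext (u + v)) Y (ext w) x =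
      koszul (ext u) Y (ext w) x + koszul (ext v) Y (ext w) x := by
    rw [← (koszul_tensorial_left hY (mdiffAt_ext w)).add (mdiffAt_ext u) (mdiffAt_ext v)]
    exact key _ _ _ _ (mdifferentiableAt_add_section (mdiffAt_ext u) (mdiffAt_ext v))
      (mdiffAt_ext w) (by simp) (by simp)
  have smull (c : ℝ) (v w : TangentSpace (𝓡 n) x) : koszul (ext (c • v)) Y (ext w) x =
      c • koszul (ext v) Y (ext w) x := by
    rw [← (koszul_tensorial_left hY (mdiffAt_ext w)).smul (f := fun _ ↦ c)
      mdifferentiableAt_const (mdiffAt_ext v)]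
    exact key _ _ _ _ (mdifferentiableAt_const.smul_section (mdiffAt_ext v))
      (mdiffAt_ext w) (by simp) (by simp)
  have addr (u v w : TangentSpace (𝓡 n) x) : koszul (ext u) Y (ext (v + w)) x =
      koszul (ext u) Y (ext v) x + koszul (ext u) Y (ext w) x := by
    rw [← (koszul_tensorial_right (mdiffAt_ext u) hY).add (mdiffAt_ext v) (mdiffAt_ext w)]
    exact key _ _ _ _ (mdiffAt_ext u) (mdifferentiableAt_add_section (mdiffAt_ext v)
      (mdiffAt_ext w)) (by simp) (by simp)
  have smulr (c : ℝ) (v w : TangentSpace (𝓡 n) x) : koszul (ext v) Y (ext (c • w)) x =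
      c • koszul (ext v) Y (ext w) x := by
    rw [← (koszul_tensorial_right (mdiffAt_ext v) hY).smul (f := fun _ ↦ c)
      mdifferentiableAt_const (mdiffAt_ext w)]
    exact key _ _ _ _ (mdiffAt_ext v) (mdifferentiableAt_const.smul_section (mdiffAt_ext w))
      (by simp) (by simp)
  rw [← key (X x) (Z x) X Z hX hZ rfl rfl, nabla, linOf_eq _
    (fun u v ↦ by simp_rw [addl, add_smul, Finset.sum_add_distrib])
    (fun c v ↦ by simp_rw [smull, Finset.smul_sum, smul_smul, smul_eq_mul])]
  let L : TangentSpace (𝓡 n) x →ₗ[ℝ] ℝ :=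
    ⟨⟨fun w ↦ koszul (ext (X x)) Y (ext w) x, addr _⟩, fun c w ↦ smulr c _ w⟩
  have hL : L (Z x) = koszul (ext (X x)) Y (ext (Z x)) x := rfl
  rw [← hL]
  conv_rhs => rw [← inner_frame_expand (Z x)]
  simp [L, sum_inner, inner_smul_left, mul_comm]

theorem nabla_ext_iff {x : M} {a b : TangentSpace (𝓡 n) x} :
    a = b ↔ ∀ w : TangentSpace (𝓡 n) x, (inner ℝ a w : ℝ) = inner ℝ b w :=
  ⟨fun h w ↦ by rw [h], fun h ↦ ext_inner_right ℝ h⟩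

theorem inner_nabla' {Y : VecField n M} {x : M} (hY : VDiffAt Y x)
    (v w : TangentSpace (𝓡 n) x) :
    inner ℝ (nabla Y x v) w = koszul (ext v) Y (ext w) x := by
  simpa using inner_nabla (mdiffAt_ext v) hY (mdiffAt_ext w)

theorem nabla_add {Y Y' : VecField n M} {x : M} (hY : VDiffAt Y x)
    (hY' : VDiffAt Y' x) : nabla (Y + Y') x = nabla Y x + nabla Y' x := by
  ext1 v
  refine nabla_ext_iff.mpr fun w ↦ ?_
  rw [_root_.add_apply, inner_add_left,
    inner_nabla' (mdifferentiableAt_add_section hY hY'), inner_nabla' hY, inner_nabla' hY',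
    koszul_add_mid (mdiffAt_ext v) hY hY' (mdiffAt_ext w)]

theorem nabla_smul {f : M → ℝ} {Y : VecField n M} {x : M} (hf : MDifferentiableAt (𝓡 n) 𝓘(ℝ) f x)
    (hY : VDiffAt Y x) (v : TangentSpace (𝓡 n) x) :
    nabla (f • Y) x v = f x • nabla Y x v + mvfderiv (𝓡 n) f x v • Y x := by
  refine nabla_ext_iff.mpr fun w ↦ ?_
  rw [inner_add_left, inner_smul_left, inner_smul_left,
    inner_nabla' (hf.smul_section hY), inner_nabla' hY,
    koszul_smul_mid hf (mdiffAt_ext v) hY (mdiffAt_ext w)]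
  simp

/-- The Levi-Civita connection is metric. -/
theorem mvfderiv_inner {Y Z : VecField n M} {x : M} (hY : VDiffAt Y x)
    (hZ : VDiffAt Z x) (v : TangentSpace (𝓡 n) x) :
    mvfderiv (𝓡 n) (fun y ↦ (inner ℝ (Y y) (Z y) : ℝ)) x v =
      inner ℝ (nabla Y x v) (Z x) + inner ℝ (Y x) (nabla Z x v) := by
  have h1 := inner_nabla (mdiffAt_ext v) hY hZ
  have h2 := inner_nabla (mdiffAt_ext v) hZ hY
  rw [ext_self] at h1 h2
  rw [real_inner_comm (nabla Z x v), h1, h2]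
  simp only [koszul, ext_self]
  simp only [real_inner_comm]
  rw [mlieBracket_swap_apply (V := Z) (W := Y)]
  simp only [inner_neg_right]
  ring

/-- The Levi-Civita connection is torsion free. -/
theorem nabla_sub_nabla {X Y : VecField n M} {x : M} (hX : VDiffAt X x)
    (hY : VDiffAt Y x) :
    nabla Y x (X x) - nabla X x (Y x) = mlieBracket (𝓡 n) X Y x := by
  refine nabla_ext_iff.mpr fun w ↦ ?_
  have h1 := inner_nabla hX hY (mdiffAt_ext w)
  have h2 := inner_nabla hY hX (mdiffAt_ext w)
  rw [ext_self] at h1 h2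
  rw [inner_sub_left, h1, h2]
  simp only [koszul, ext_self]
  rw [mlieBracket_swap_apply (V := Y) (W := X)]
  simp only [real_inner_comm]
  simp only [inner_neg_right]
  ring

theorem mvfderiv_congr {f g : M → ℝ} {x : M} (h : f =ᶠ[𝓝 x] g) :
    mvfderiv (𝓡 n) f x = mvfderiv (𝓡 n) g x := by
  unfold mvfderiv
  rw [h.mfderiv_eq, h.self_of_nhds]

/-- Locality allows fields that are smooth only near x, such as extensions of vectors and coordinate
fields, to be exchanged for global ones. -/
theorem nabla_congr {Y Y' : VecField n M} {x : M} (h : Y =ᶠ[𝓝 x] Y') :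
    nabla Y x = nabla Y' x := by
  unfold nabla
  congr 1
  ext1 v
  refine Finset.sum_congr rfl fun k _ ↦ ?_
  congr 1
  unfold koszul
  rw [mvfderiv_congr (f := fun y ↦ (inner ℝ (Y y) (ext (frame x k) y) : ℝ))
      (g := fun y ↦ (inner ℝ (Y' y) (ext (frame x k) y) : ℝ))
      (h.mono fun y hy ↦ by simp only [hy]),
    mvfderiv_congr (f := fun y ↦ (inner ℝ (ext v y) (Y y) : ℝ))
      (g := fun y ↦ (inner ℝ (ext v y) (Y' y) : ℝ))
      (h.mono fun y hy ↦ by simp only [hy]), h.self_of_nhds,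
    (EventuallyEq.refl _ (ext v)).mlieBracket_vectorField_eq h,
    h.mlieBracket_vectorField_eq (EventuallyEq.refl _ (ext (frame x k)))]

scoped instance instIsManifoldTwo : IsManifold (𝓡 n) 2 M :=
  IsManifold.of_le (n := ∞) ENat.LEInfty.out

scoped instance instIsManifoldTopAddOne : IsManifold (𝓡 n) (((⊤ : ℕ∞) : WithTop ℕ∞) + 1) M :=
  inferInstanceAs (IsManifold (𝓡 n) ∞ M)

theorem contMDiffAt_mvfderiv {f : M → ℝ} {X : VecField n M} {x : M}
    (hf : ContMDiffAt (𝓡 n) 𝓘(ℝ) ∞ f x) (hX : VSmoothAt X x) :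
    ContMDiffAt (𝓡 n) 𝓘(ℝ) ∞ (fun y ↦ mvfderiv (𝓡 n) f y (X y)) x := by
  have h1 := hf.mfderiv_const (m := ∞) (by simp)
  have h2 := ContMDiffAt.clm_apply_of_inCoordinates (b₁ := id) (b₂ := f)
    (ϕ := fun y ↦ mfderiv (𝓡 n) 𝓘(ℝ) f y) (v := X) h1 hX hf
  exact (contMDiff_snd_tangentBundle_modelSpace ℝ 𝓘(ℝ)).contMDiffAt.comp x h2

theorem VSmoothAt.mlieBracket {X Y : VecField n M} {x : M} (hX : VSmoothAt X x)
    (hY : VSmoothAt Y x) : VSmoothAt (mlieBracket (𝓡 n) X Y) x :=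
  ContMDiffAt.mlieBracket_vectorField (n := ⊤) (m := ⊤) hX hY (by simp)

/-- The bracket of vector fields is the commutator of the derivations they define. -/
theorem mvfderiv_mlieBracket {f : M → ℝ} {X Y : VecField n M} {x : M}
    (hf : ContMDiffAt (𝓡 n) 𝓘(ℝ) ∞ f x) (hX : VSmoothAt X x) (hY : VSmoothAt Y x) :
    mvfderiv (𝓡 n) f x (VectorField.mlieBracket (𝓡 n) X Y x) =
      mvfderiv (𝓡 n) (fun y ↦ mvfderiv (𝓡 n) f y (Y y)) x (X x) -
        mvfderiv (𝓡 n) (fun y ↦ mvfderiv (𝓡 n) f y (X y)) x (Y x) := by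
  -- The formula is read off as the coefficient of a nonzero vector z when the Jacobi identities for
  -- X, Y, fZ and for X, Y, Z are compared, with Z extending z. If the tangent space is zero, both
  -- sides vanish.
  rcases subsingleton_or_nontrivial (TangentSpace (𝓡 n) x) with hs | hs
  · simp [Subsingleton.elim _ (0 : TangentSpace (𝓡 n) x)]
  obtain ⟨z, hz⟩ := exists_ne (0 : TangentSpace (𝓡 n) x)
  have hZ : VSmoothAt (ext z) x := contMDiffAt_ext z
  have hfZ : VSmoothAt (f • ext z) x := hf.smul_section hZ
  have h2 : (minSmoothness ℝ 2) ≤ (∞ : WithTop ℕ∞) := by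
    simp only [minSmoothness_of_isRCLikeNormedField]; exact ENat.LEInfty.out
  have ev {A : VecField n M} (hA : VSmoothAt A x) :
      VectorField.mlieBracket (𝓡 n) A (f • ext z) =ᶠ[𝓝 x]
        (fun y ↦ mvfderiv (𝓡 n) f y (A y)) • ext z +
          f • VectorField.mlieBracket (𝓡 n) A (ext z) := by
    filter_upwards [(contMDiffAt_iff_contMDiffAt_nhds (by simp)).1 (hf.of_le one_le_infty),
      (contMDiffAt_iff_contMDiffAt_nhds (by simp)).1 (ContMDiffAt.of_le hZ one_le_infty)]
      with y hfy hZy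
    exact mlieBracket_smul_right (hfy.mdifferentiableAt (by simp)) (hZy.mdifferentiableAt (by simp))
  have jac := leibniz_identity_mlieBracket_apply (hX.of_le h2) (hY.of_le h2) (hfZ.of_le h2)
  have jacZ := leibniz_identity_mlieBracket_apply (hX.of_le h2) (hY.of_le h2) (hZ.of_le h2)
  have dfX := (contMDiffAt_mvfderiv hf hX).mdifferentiableAt (by simp)
  have dfY := (contMDiffAt_mvfderiv hf hY).mdifferentiableAt (by simp)
  have df := hf.mdifferentiableAt (by simp)
  have expand {A B : VecField n M} (hA : VSmoothAt A x) (hB : VSmoothAt B x) :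
      VectorField.mlieBracket (𝓡 n) A (VectorField.mlieBracket (𝓡 n) B (f • ext z)) x =
        (mvfderiv (𝓡 n) (fun y ↦ mvfderiv (𝓡 n) f y (B y)) x (A x)) • z +
        mvfderiv (𝓡 n) f x (B x) • VectorField.mlieBracket (𝓡 n) A (ext z) x +
        (mvfderiv (𝓡 n) f x (A x) • VectorField.mlieBracket (𝓡 n) B (ext z) x +
        f x • VectorField.mlieBracket (𝓡 n) A (VectorField.mlieBracket (𝓡 n) B (ext z)) x) := by
    have dB := (contMDiffAt_mvfderiv hf hB).mdifferentiableAt (by simp)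
    rw [(EventuallyEq.refl _ A).mlieBracket_vectorField_eq (ev hB),
      mlieBracket_add_right (dB.smul_section hZ.vdiffAt)
        (df.smul_section (hB.mlieBracket hZ).vdiffAt),
      mlieBracket_smul_right dB hZ.vdiffAt,
      mlieBracket_smul_right df (hB.mlieBracket hZ).vdiffAt, ext_self]
  rw [expand hX hY, expand hY hX, jacZ,
    mlieBracket_smul_right df hZ.vdiffAt, ext_self] at jac
  have : (mvfderiv (𝓡 n) f x (VectorField.mlieBracket (𝓡 n) X Y x) -
      (mvfderiv (𝓡 n) (fun y ↦ mvfderiv (𝓡 n) f y (Y y)) x (X x) -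
        mvfderiv (𝓡 n) (fun y ↦ mvfderiv (𝓡 n) f y (X y)) x (Y x))) • z = 0 := by
    rw [sub_smul, sub_smul]
    rw [← sub_eq_zero] at jac
    rw [← neg_eq_zero, ← jac]
    module
  exact sub_eq_zero.mp ((smul_eq_zero.mp this).resolve_right hz)

end LeviCivita

/-! ### Coordinate frames, partitions of unity and global dual frames -/

section Frames

variable {n : ℕ} {M : Type*} [TopologicalSpace M] [ChartedSpace (EuclideanSpace ℝ (Fin n)) M]

/-- Smoothness of a function at a point. -/
abbrev FSmoothAt (n : ℕ) {M : Type*} [TopologicalSpace M]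
    [ChartedSpace (EuclideanSpace ℝ (Fin n)) M] (f : M → ℝ) (x : M) : Prop :=
  ContMDiffAt (𝓡 n) 𝓘(ℝ) ∞ f x

/-- Smoothness of a function. -/
def FSmooth (n : ℕ) {M : Type*} [TopologicalSpace M]
    [ChartedSpace (EuclideanSpace ℝ (Fin n)) M] (f : M → ℝ) : Prop :=
  ∀ x, FSmoothAt n f x

theorem FSmoothAt.sum {ι : Type*} {s : Finset ι} {f : ι → M → ℝ} {x : M}
    (h : ∀ i ∈ s, FSmoothAt n (f i) x) : FSmoothAt n (fun y ↦ ∑ i ∈ s, f i y) x :=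
  ContMDiffAt.sum h

theorem FSmoothAt.mul {f g : M → ℝ} {x : M} (hf : FSmoothAt n f x) (hg : FSmoothAt n g x) :
    FSmoothAt n (fun y ↦ f y * g y) x :=
  ContMDiffAt.mul hf hg

theorem fsmoothAt_const (c : ℝ) (x : M) : FSmoothAt n (fun _ ↦ c) x := contMDiffAt_const

theorem fsmoothAt_det {κ : Type*} [Fintype κ] [DecidableEq κ] {A : M → Matrix κ κ ℝ} {x : M}
    (h : ∀ i j, FSmoothAt n (fun y ↦ A y i j) x) : FSmoothAt n (fun y ↦ (A y).det) x := by
  simp only [Matrix.det_apply']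
  refine FSmoothAt.sum fun σ _ ↦ (fsmoothAt_const _ x).mul ?_
  exact ContMDiffAt.prod fun i _ ↦ h _ _

theorem fsmoothAt_matrix_inv {κ : Type*} [Fintype κ] [DecidableEq κ] {A : M → Matrix κ κ ℝ} {x : M}
    (h : ∀ i j, FSmoothAt n (fun y ↦ A y i j) x) (hx : (A x).det ≠ 0) (i j : κ) :
    FSmoothAt n (fun y ↦ (A y)⁻¹ i j) x := by
  simp only [Matrix.inv_def, Ring.inverse_eq_inv', Matrix.smul_apply, smul_eq_mul]
  refine FSmoothAt.mul ((fsmoothAt_det h).inv₀ hx) ?_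
  simp only [Matrix.adjugate_apply]
  refine fsmoothAt_det fun k l ↦ ?_
  by_cases hk : k = j
  · subst hk
    simpa using fsmoothAt_const _ x
  · simpa [Matrix.updateRow_ne hk] using h k l

variable [IsManifold (𝓡 n) ∞ M]

/-- Smoothness of a vector field. -/
def VSmooth (X : VecField n M) : Prop := ∀ x, VSmoothAt X x

theorem VSmooth.vdiffAt {X : VecField n M} (h : VSmooth X) (x : M) : VDiffAt X x := (h x).vdiffAt

theorem FSmooth.mdiffAt {f : M → ℝ} (h : FSmooth n f) (x : M) :
    MDifferentiableAt (𝓡 n) 𝓘(ℝ) f x :=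
  (h x).mdifferentiableAt (by simp)

theorem FSmooth.smul {f : M → ℝ} {X : VecField n M} (hf : FSmooth n f) (hX : VSmooth X) :
    VSmooth (fun y ↦ f y • X y) := fun x ↦ ContMDiffAt.smul_section (hf x) (hX x)

theorem VSmooth.add {X Y : VecField n M} (hX : VSmooth X) (hY : VSmooth Y) :
    VSmooth (fun y ↦ X y + Y y) := fun x ↦ ContMDiffAt.add_section (hX x) (hY x)

theorem VSmooth.sum {ι : Type*} {s : Finset ι} {X : ι → VecField n M}
    (h : ∀ i ∈ s, VSmooth (X i)) : VSmooth (fun y ↦ ∑ i ∈ s, X i y) :=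
  fun x ↦ ContMDiffAt.sum_section fun i hi ↦ h i hi x

theorem vsmooth_const_smul (c : ℝ) {X : VecField n M} (hX : VSmooth X) :
    VSmooth (fun y ↦ c • X y) := FSmooth.smul (fun x ↦ fsmoothAt_const c x) hX

theorem VSmooth.neg {X : VecField n M} (hX : VSmooth X) : VSmooth (fun y ↦ -X y) := by
  simpa using vsmooth_const_smul (-1) hX

theorem VSmooth.sub {X Y : VecField n M} (hX : VSmooth X) (hY : VSmooth Y) :
    VSmooth (fun y ↦ X y - Y y) := by
  simpa [sub_eq_add_neg] using hX.add hY.neg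

/-- The coordinate vector fields of the chart at `x₀`, extended by zero. -/
def coordFrame (x₀ : M) (i : Fin n) : VecField n M :=
  (trivializationAt (EuclideanSpace ℝ (Fin n)) (fun y : M ↦ TangentSpace (𝓡 n) y) x₀).localFrame
    (EuclideanSpace.basisFun (Fin n) ℝ).toBasis i

/-- The domain of the chart at `x₀`. -/
abbrev chartDom (n : ℕ) {M : Type*} [TopologicalSpace M]
    [ChartedSpace (EuclideanSpace ℝ (Fin n)) M] (x₀ : M) : Set M :=
  (chartAt (EuclideanSpace ℝ (Fin n)) x₀).source

theorem isLocalFrameOn_coordFrame (x₀ : M) :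
    IsLocalFrameOn (𝓡 n) (EuclideanSpace ℝ (Fin n)) ∞ (coordFrame (n := n) x₀) (chartDom n x₀) :=
  (trivializationAt (EuclideanSpace ℝ (Fin n)) (fun y : M ↦ TangentSpace (𝓡 n) y)
    x₀).isLocalFrameOn_localFrame_baseSet (𝓡 n) ∞ _

theorem vsmoothAt_coordFrame {x₀ y : M} (hy : y ∈ chartDom n x₀) (i : Fin n) :
    VSmoothAt (coordFrame x₀ i) y :=
  (isLocalFrameOn_coordFrame x₀).contMDiffAt (chartAt _ x₀).open_source hy i

variable [RiemannianBundle (fun x : M ↦ TangentSpace (𝓡 n) x)]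

/-- The Gram matrix of the coordinate vector fields of the chart at `x₀`. -/
def coordGram (x₀ y : M) : Matrix (Fin n) (Fin n) ℝ :=
  Matrix.gram ℝ (fun i ↦ coordFrame (n := n) x₀ i y)

theorem coordGram_apply (x₀ y : M) (i j : Fin n) :
    coordGram x₀ y i j = inner ℝ (coordFrame x₀ i y) (coordFrame x₀ j y) := rfl

theorem coordGram_det_pos {x₀ y : M} (hy : y ∈ chartDom n x₀) :
    0 < (coordGram (n := n) x₀ y).det := by
  have h : LinearIndependent ℝ (fun i ↦ coordFrame (n := n) x₀ i y) :=
    (isLocalFrameOn_coordFrame x₀).linearIndependent hy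
  have h2 : (coordGram (n := n) x₀ y).PosDef := Matrix.posDef_gram_of_linearIndependent h
  exact h2.det_pos

/-- The vector fields dual to the coordinate vector fields. -/
def coordDual (x₀ : M) (i : Fin n) : VecField n M :=
  fun y ↦ ∑ k, (coordGram x₀ y)⁻¹ i k • coordFrame x₀ k y

theorem inner_coordDual_coordFrame {x₀ y : M} (hy : y ∈ chartDom n x₀) (i j : Fin n) :
    inner ℝ (coordDual x₀ i y) (coordFrame x₀ j y) = if i = j then (1 : ℝ) else 0 := by
  have h := congrFun (congrFun (Matrix.nonsing_inv_mul (coordGram (n := n) x₀ y)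
    (coordGram_det_pos hy).ne'.isUnit) i) j
  rw [Matrix.one_apply] at h
  simp only [coordDual, sum_inner, inner_smul_left, RCLike.conj_to_real, ← h, Matrix.mul_apply,
    coordGram_apply]

theorem coordFrame_expand {x₀ y : M} (hy : y ∈ chartDom n x₀) (v : TangentSpace (𝓡 n) y) :
    ∑ i, (inner ℝ (coordDual x₀ i y) v : ℝ) • coordFrame x₀ i y = v := by
  let b := (isLocalFrameOn_coordFrame (n := n) x₀).toBasisAt hy
  have hb : ∀ i, b i = coordFrame x₀ i y := fun i ↦ by
    simp [b]
  have h2 : ∀ i, (inner ℝ (coordDual x₀ i y) v : ℝ) = b.repr v i := fun i ↦ by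
    conv_lhs => rw [← b.sum_repr v]
    simp [inner_sum, hb, inner_smul_right, inner_coordDual_coordFrame hy]
  simp_rw [h2, ← hb]
  exact b.sum_repr v

variable [IsContMDiffRiemannianBundle (𝓡 n) ∞ (EuclideanSpace ℝ (Fin n))
      (fun x : M ↦ TangentSpace (𝓡 n) x)]

theorem fsmoothAt_coordGram {x₀ y : M} (hy : y ∈ chartDom n x₀) (i j : Fin n) :
    FSmoothAt n (fun z ↦ coordGram (n := n) x₀ z i j) y :=
  contMDiffAt_inner (vsmoothAt_coordFrame hy i) (vsmoothAt_coordFrame hy j)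

theorem vsmoothAt_coordDual {x₀ y : M} (hy : y ∈ chartDom n x₀) (i : Fin n) :
    VSmoothAt (coordDual x₀ i) y :=
  ContMDiffAt.sum_section fun k _ ↦ ContMDiffAt.smul_section
    (fsmoothAt_matrix_inv (fsmoothAt_coordGram hy) (coordGram_det_pos hy).ne' i k)
    (vsmoothAt_coordFrame hy k)

/-- Two finite families of smooth vector fields that are dual to each other:
`v = ∑ g (V'_b, v) V_b` for all tangent vectors `v`. -/
structure IsDualFrame {ι : Type*} [Fintype ι] (V V' : ι → VecField n M) : Prop where
  smooth : ∀ b, VSmooth (V b)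
  smooth' : ∀ b, VSmooth (V' b)
  expand : ∀ (x : M) (v : TangentSpace (𝓡 n) x), ∑ b, (inner ℝ (V' b x) v : ℝ) • V b x = v

variable (n M) in
/-- A finite smooth partition of unity subordinate to chart domains. -/
theorem exists_finite_partition [CompactSpace M] [T2Space M] :
    ∃ (s : Finset M) (ρ : M → M → ℝ), (∀ a, FSmooth n (ρ a)) ∧
      (∀ a, tsupport (ρ a) ⊆ chartDom n a) ∧ ∀ y, ∑ a ∈ s, ρ a y = 1 := by
  obtain ⟨f, hf⟩ := SmoothPartitionOfUnity.exists_isSubordinate_chartAt_source (𝓡 n) M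
  have hfin := f.locallyFinite.finite_nonempty_of_compact
  refine ⟨hfin.toFinset, fun a ↦ f a, fun a x ↦ (f a).contMDiff x, hf, fun y ↦ ?_⟩
  rw [← f.sum_eq_one (Set.mem_univ y)]
  refine (finsum_eq_sum_of_support_subset _ fun a ha ↦ ?_).symm
  simp only [Set.Finite.coe_toFinset, Set.mem_ofPred_eq]
  exact ⟨y, ha⟩

theorem vsmooth_smul_of_tsupport {u : Set M} (hu : IsOpen u) {ρ : M → ℝ} (hρ : FSmooth n ρ)
    (hs : tsupport ρ ⊆ u) {X : VecField n M} (hX : ∀ y ∈ u, VSmoothAt X y) :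
    VSmooth (fun y ↦ ρ y • X y) :=
  ContMDiffOn.smul_section_of_tsupport (fun y _ ↦ (hρ y).contMDiffWithinAt) hu hs
    (fun y hy ↦ (hX y hy).contMDiffWithinAt)

variable (n M) in
-- Cutting off the coordinate frame and its dual by the same function ρ_a makes both globally
-- smooth. The sum over one chart then reproduces ρ_a² v, so dividing by q = ∑ ρ_a² restores v.
theorem exists_isDualFrame [CompactSpace M] [T2Space M] :
    ∃ (s : Finset M) (V V' : s × Fin n → VecField n M), IsDualFrame V V' := by
  obtain ⟨s, ρ, hρ, hsub, hsum⟩ := exists_finite_partition n M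
  let q : M → ℝ := fun y ↦ ∑ a ∈ s, ρ a y * ρ a y
  -- If the squares summed to zero, every ρ_a would vanish at y, against ∑ ρ_a = 1.
  have hq : ∀ y, q y ≠ 0 := fun y h0 ↦ by
    have h1 : ∀ a ∈ s, ρ a y = 0 := fun a ha ↦ mul_self_eq_zero.mp
      ((Finset.sum_eq_zero_iff_of_nonneg fun a _ ↦ mul_self_nonneg _).mp h0 a ha)
    have h2 := hsum y
    rw [Finset.sum_eq_zero h1] at h2
    exact zero_ne_one h2
  have hqs : FSmooth n (fun y ↦ (q y)⁻¹) := fun y ↦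
    ContMDiffAt.inv₀ (FSmoothAt.sum fun a _ ↦ (hρ a y).mul (hρ a y)) (hq y)
  refine ⟨s, fun b y ↦ (q y)⁻¹ • (ρ b.1 y • coordFrame (b.1 : M) b.2 y),
    fun b y ↦ ρ b.1 y • coordDual (b.1 : M) b.2 y, ⟨fun b ↦ ?_, fun b ↦ ?_, fun x v ↦ ?_⟩⟩
  · exact hqs.smul (vsmooth_smul_of_tsupport (chartAt _ _).open_source (hρ _) (hsub _)
      fun y hy ↦ vsmoothAt_coordFrame hy b.2)
  · exact vsmooth_smul_of_tsupport (chartAt _ _).open_source (hρ _) (hsub _)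
      fun y hy ↦ vsmoothAt_coordDual hy b.2
  · have h : ∀ a : M, ∑ i, (inner ℝ (ρ a x • coordDual a i x) v : ℝ) •
        ((q x)⁻¹ • (ρ a x • coordFrame a i x)) = ((q x)⁻¹ * (ρ a x * ρ a x)) • v := fun a ↦ by
      by_cases ha : x ∈ chartDom n a
      · conv_rhs => rw [← coordFrame_expand ha v, Finset.smul_sum]
        refine Finset.sum_congr rfl fun i _ ↦ ?_
        rw [inner_smul_left]
        simp only [smul_smul, RCLike.conj_to_real]
        congr 1
        ring
      · have : ρ a x = 0 := image_eq_zero_of_notMem_tsupport fun h ↦ ha (hsub a h)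
        simp [this]
    rw [Fintype.sum_prod_type]
    simp only [h]
    rw [← Finset.sum_smul, ← Finset.mul_sum, Finset.sum_coe_sort s (fun a ↦ ρ a x * ρ a x)]
    change ((q x)⁻¹ * q x) • v = v
    rw [inv_mul_cancel₀ (hq x), one_smul]

end Frames

/-! ### Covariant calculus of tensor fields -/

section TensorCalculus

variable {n : ℕ} {M : Type*} [TopologicalSpace M] [ChartedSpace (EuclideanSpace ℝ (Fin n)) M]
  [IsManifold (𝓡 n) ∞ M] [RiemannianBundle (fun x : M ↦ TangentSpace (𝓡 n) x)]
  [IsContMDiffRiemannianBundle (𝓡 n) ∞ (EuclideanSpace ℝ (Fin n))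
      (fun x : M ↦ TangentSpace (𝓡 n) x)]

theorem VDiffAt.add {X Y : VecField n M} {x : M} (hX : VDiffAt X x) (hY : VDiffAt Y x) :
    VDiffAt (X + Y) x := mdifferentiableAt_add_section hX hY

theorem VDiffAt.smul {f : M → ℝ} {X : VecField n M} {x : M}
    (hf : MDifferentiableAt (𝓡 n) 𝓘(ℝ) f x) (hX : VDiffAt X x) : VDiffAt (f • X) x :=
  MDifferentiableAt.smul_section hf hX

theorem VDiffAt.sum {ι : Type*} {s : Finset ι} {X : ι → VecField n M} {x : M}
    (h : ∀ i ∈ s, VDiffAt (X i) x) : VDiffAt (fun y ↦ ∑ i ∈ s, X i y) x :=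
  MDifferentiableAt.sum_section h

@[simp]
theorem nabla_zero (x : M) : nabla (0 : VecField n M) x = 0 := by
  have h0 : VDiffAt (0 : VecField n M) x := mdifferentiable_zeroSection _ _ x
  have := nabla_add h0 h0
  simpa using this

theorem nabla_sum {ι : Type*} {s : Finset ι} {X : ι → VecField n M} {x : M}
    (h : ∀ i ∈ s, VDiffAt (X i) x) :
    nabla (fun y ↦ ∑ i ∈ s, X i y) x = ∑ i ∈ s, nabla (X i) x := by
  classical
  induction s using Finset.induction_on with
  | empty =>
    simp only [Finset.sum_empty]
    exact nabla_zero x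
  | insert a s ha ih =>
    simp only [Finset.mem_insert, forall_eq_or_imp] at h
    simp only [Finset.sum_insert ha]
    rw [← ih h.2]
    exact nabla_add h.1 (VDiffAt.sum h.2)

theorem nabla_const_smul (c : ℝ) {Y : VecField n M} {x : M} (hY : VDiffAt Y x)
    (u : TangentSpace (𝓡 n) x) : nabla (fun y ↦ c • Y y) x u = c • nabla Y x u := by
  have := nabla_smul (f := fun _ ↦ c) mdifferentiableAt_const hY u
  simp only [mvfderiv_const] at this
  change nabla (fun y ↦ c • Y y) x u = _ at this
  rw [this]
  simp

theorem mdiffAt_sum {ι : Type*} {s : Finset ι} {f : ι → M → ℝ} {x : M}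
    (h : ∀ i ∈ s, MDifferentiableAt (𝓡 n) 𝓘(ℝ) (f i) x) :
    MDifferentiableAt (𝓡 n) 𝓘(ℝ) (fun y ↦ ∑ i ∈ s, f i y) x := by
  classical
  induction s using Finset.induction_on with
  | empty => simpa using mdifferentiableAt_const
  | insert a s ha ih =>
    simp only [Finset.mem_insert, forall_eq_or_imp] at h
    simp only [Finset.sum_insert ha]
    exact h.1.add (ih h.2)

theorem mvfderiv_sum {ι : Type*} {s : Finset ι} {f : ι → M → ℝ} {x : M}
    (h : ∀ i ∈ s, MDifferentiableAt (𝓡 n) 𝓘(ℝ) (f i) x) (u : TangentSpace (𝓡 n) x) :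
    mvfderiv (𝓡 n) (fun y ↦ ∑ i ∈ s, f i y) x u = ∑ i ∈ s, mvfderiv (𝓡 n) (f i) x u := by
  classical
  induction s using Finset.induction_on with
  | empty => simp [mvfderiv_const]
  | insert a s ha ih =>
    simp only [Finset.mem_insert, forall_eq_or_imp] at h
    simp only [Finset.sum_insert ha]
    rw [← ih h.2]
    have h3 := mvfderiv_add h.1 (mdiffAt_sum h.2)
    exact congr($h3 u)

section Dual

variable {ι : Type*} [Fintype ι] {V V' : ι → VecField n M}

/-- The tensor ∑ V_b ⊗ V'_b is the inverse metric, so traces can be computed with smooth fields in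
place of the pointwise basis `frame`. -/
theorem IsDualFrame.sum_bilin (hV : IsDualFrame V V') (x : M)
    (C : TangentSpace (𝓡 n) x →ₗ[ℝ] TangentSpace (𝓡 n) x →ₗ[ℝ] ℝ) :
    ∑ b, C (V b x) (V' b x) = ∑ i, C (frame x i) (frame x i) := by
  have h1 : ∀ b, C (V b x) (V' b x) =
      ∑ i, (inner ℝ (V' b x) (frame x i) : ℝ) * C (V b x) (frame x i) := fun b ↦ by
    conv_lhs => rw [← inner_frame_expand (V' b x)]
    simp only [map_sum, map_smul, smul_eq_mul]
    exact Finset.sum_congr rfl fun i _ ↦ by rw [real_inner_comm]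
  simp only [h1]
  rw [Finset.sum_comm]
  refine Finset.sum_congr rfl fun i _ ↦ ?_
  conv_rhs => enter [1]; rw [← hV.expand x (frame x i)]
  simp only [map_sum, map_smul, LinearMap.sum_apply, LinearMap.smul_apply, smul_eq_mul]

theorem IsDualFrame.mdiffAt_coeff (hV : IsDualFrame V V') {x : M} {Y : VecField n M}
    (hY : VDiffAt Y x) (b : ι) :
    MDifferentiableAt (𝓡 n) 𝓘(ℝ) (fun y ↦ (inner ℝ (V' b y) (Y y) : ℝ)) x :=
  mdiffAt_inner ((hV.smooth' b).vdiffAt x) hY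

/-- Differentiate the expansion of an extension of v. The terms containing the derivative of that
extension cancel, by the expansion of its derivative. -/
theorem IsDualFrame.nabla_expand (hV : IsDualFrame V V') (x : M) (u v : TangentSpace (𝓡 n) x) :
    ∑ b, ((inner ℝ (nabla (V' b) x u) v : ℝ) • V b x +
      (inner ℝ (V' b x) v : ℝ) • nabla (V b) x u) = 0 := by
  have hY : VDiffAt (ext v) x := mdiffAt_ext v
  have h1 : ext v = fun y ↦ ∑ b, ((fun y ↦ (inner ℝ (V' b y) (ext v y) : ℝ)) • V b) y := by
    ext1 y
    simpa using (hV.expand y (ext v y)).symm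
  have h2 : nabla (ext v) x u = ∑ b, nabla ((fun y ↦ (inner ℝ (V' b y) (ext v y) : ℝ)) • V b) x u := by
    conv_lhs => rw [h1]
    rw [nabla_sum fun b _ ↦ VDiffAt.smul (hV.mdiffAt_coeff hY b) ((hV.smooth b).vdiffAt x)]
    simp
  have h3 : ∀ b, nabla ((fun y ↦ (inner ℝ (V' b y) (ext v y) : ℝ)) • V b) x u =
      ((inner ℝ (nabla (V' b) x u) v : ℝ) • V b x + (inner ℝ (V' b x) v : ℝ) • nabla (V b) x u) +
        (inner ℝ (V' b x) (nabla (ext v) x u) : ℝ) • V b x := fun b ↦ by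
    rw [nabla_smul (hV.mdiffAt_coeff hY b) ((hV.smooth b).vdiffAt x),
      mvfderiv_inner ((hV.smooth' b).vdiffAt x) hY, ext_self]
    module
  simp only [h3] at h2
  rw [Finset.sum_add_distrib, hV.expand] at h2
  simpa using h2

/-- The inverse metric is parallel: differentiating the frames inside a trace contributes nothing in
total. -/
theorem IsDualFrame.sum_bilin_nabla (hV : IsDualFrame V V') (x : M) (u : TangentSpace (𝓡 n) x)
    (C : TangentSpace (𝓡 n) x →ₗ[ℝ] TangentSpace (𝓡 n) x →ₗ[ℝ] ℝ) :
    ∑ b, (C (nabla (V b) x u) (V' b x) + C (V b x) (nabla (V' b) x u)) = 0 := by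
  have h1 : ∀ (p q : TangentSpace (𝓡 n) x), C p q =
      ∑ i, (inner ℝ q (frame x i) : ℝ) * C p (frame x i) := fun p q ↦ by
    conv_lhs => rw [← inner_frame_expand q]
    simp only [map_sum, map_smul, smul_eq_mul]
    exact Finset.sum_congr rfl fun i _ ↦ by rw [real_inner_comm]
  calc _ = ∑ b, ∑ i, ((inner ℝ (V' b x) (frame x i) : ℝ) * C (nabla (V b) x u) (frame x i) +
        (inner ℝ (nabla (V' b) x u) (frame x i) : ℝ) * C (V b x) (frame x i)) := by
        refine Finset.sum_congr rfl fun b _ ↦ ?_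
        rw [h1, h1 (V b x), Finset.sum_add_distrib]
    _ = ∑ i, C (∑ b, ((inner ℝ (nabla (V' b) x u) (frame x i) : ℝ) • V b x +
        (inner ℝ (V' b x) (frame x i) : ℝ) • nabla (V b) x u)) (frame x i) := by
        rw [Finset.sum_comm]
        refine Finset.sum_congr rfl fun i _ ↦ ?_
        simp only [map_sum, map_add, map_smul, LinearMap.sum_apply, LinearMap.smul_apply,
          LinearMap.add_apply, smul_eq_mul]
        exact Finset.sum_congr rfl fun b _ ↦ add_comm _ _
    _ = 0 := by simp only [hV.nabla_expand]; simp

theorem IsDualFrame.vsmooth_of_inner (hV : IsDualFrame V V') {X : VecField n M}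
    (h : ∀ Z, VSmooth Z → FSmooth n (fun y ↦ (inner ℝ (X y) (Z y) : ℝ))) : VSmooth X := by
  have h1 : X = fun y ↦ ∑ b, (inner ℝ (X y) (V' b y) : ℝ) • V b y := by
    ext1 y
    rw [← hV.expand y (X y)]
    refine Finset.sum_congr rfl fun b _ ↦ ?_
    rw [hV.expand, real_inner_comm]
  rw [h1]
  exact VSmooth.sum fun b _ ↦ (h _ (hV.smooth' b)).smul (hV.smooth b)

end Dual

theorem VSmooth.inner {X Y : VecField n M} (hX : VSmooth X) (hY : VSmooth Y) :
    FSmooth n (fun y ↦ (inner ℝ (X y) (Y y) : ℝ)) := fun x ↦ contMDiffAt_inner (hX x) (hY x)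

theorem FSmooth.mvfderiv {f : M → ℝ} {X : VecField n M} (hf : FSmooth n f) (hX : VSmooth X) :
    FSmooth n (fun y ↦ mvfderiv (𝓡 n) f y (X y)) := fun x ↦ contMDiffAt_mvfderiv (hf x) (hX x)

theorem FSmooth.add {f g : M → ℝ} (hf : FSmooth n f) (hg : FSmooth n g) :
    FSmooth n (fun y ↦ f y + g y) := fun x ↦ ContMDiffAt.add (hf x) (hg x)

theorem FSmooth.sub {f g : M → ℝ} (hf : FSmooth n f) (hg : FSmooth n g) :
    FSmooth n (fun y ↦ f y - g y) := fun x ↦ ContMDiffAt.sub (hf x) (hg x)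

theorem FSmooth.mul {f g : M → ℝ} (hf : FSmooth n f) (hg : FSmooth n g) :
    FSmooth n (fun y ↦ f y * g y) := fun x ↦ FSmoothAt.mul (hf x) (hg x)

theorem FSmooth.sum {ι : Type*} {s : Finset ι} {f : ι → M → ℝ}
    (h : ∀ i ∈ s, FSmooth n (f i)) : FSmooth n (fun y ↦ ∑ i ∈ s, f i y) :=
  fun x ↦ FSmoothAt.sum fun i hi ↦ h i hi x

theorem VSmooth.mlieBracket {X Y : VecField n M} (hX : VSmooth X) (hY : VSmooth Y) :
    VSmooth (mlieBracket (𝓡 n) X Y) := fun x ↦ (hX x).mlieBracket (hY x)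

/-- A field of endomorphisms is smooth if it maps smooth vector fields to smooth vector fields. -/
def ESmooth (h : EndField n M) : Prop := ∀ X, VSmooth X → VSmooth (fun y ↦ h y (X y))

/-- A field of bilinear maps is smooth if it maps smooth vector fields to smooth vector fields. -/
def BSmooth (A : BilField n M) : Prop :=
  ∀ X Y, VSmooth X → VSmooth Y → VSmooth (fun y ↦ A y (X y) (Y y))

theorem ESmooth.comp {h k : EndField n M} (hh : ESmooth h) (hk : ESmooth k) :
    ESmooth (fun y ↦ h y ∘L k y) := fun X hX ↦ hh _ (hk X hX)

theorem ESmooth.add {h k : EndField n M} (hh : ESmooth h) (hk : ESmooth k) :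
    ESmooth (fun y ↦ h y + k y) := fun X hX ↦ (hh X hX).add (hk X hX)

theorem ESmooth.sub {h k : EndField n M} (hh : ESmooth h) (hk : ESmooth k) :
    ESmooth (fun y ↦ h y - k y) := fun X hX ↦ (hh X hX).sub (hk X hX)

variable [CompactSpace M] [T2Space M]

theorem vsmooth_of_inner {X : VecField n M}
    (h : ∀ Z, VSmooth Z → FSmooth n (fun y ↦ (inner ℝ (X y) (Z y) : ℝ))) : VSmooth X := by
  obtain ⟨s, V, V', hV⟩ := exists_isDualFrame n M
  exact hV.vsmooth_of_inner h

/-- Every tangent vector is the value of a smooth vector field. -/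
theorem exists_vsmooth_eq {x : M} (v : TangentSpace (𝓡 n) x) :
    ∃ X : VecField n M, VSmooth X ∧ X x = v := by
  obtain ⟨s, V, V', hV⟩ := exists_isDualFrame n M
  exact ⟨fun y ↦ ∑ b, (inner ℝ (V' b x) v : ℝ) • V b y,
    VSmooth.sum fun b _ ↦ vsmooth_const_smul _ (hV.smooth b), hV.expand x v⟩

/-- The Koszul formula shows that the product with any smooth field is smooth, and such products
detect smoothness. -/
theorem VSmooth.nabla {X Y : VecField n M} (hX : VSmooth X) (hY : VSmooth Y) :
    VSmooth (fun y ↦ nabla Y y (X y)) := by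
  refine vsmooth_of_inner fun Z hZ ↦ ?_
  have h : (fun y ↦ (Inner.inner ℝ (EinsteinDeformation.nabla Y y (X y)) (Z y) : ℝ)) =
      fun y ↦ koszul X Y Z y := by
    ext1 y
    exact inner_nabla (hX.vdiffAt y) (hY.vdiffAt y) (hZ.vdiffAt y)
  rw [h]
  unfold koszul
  refine FSmooth.mul (fun x ↦ fsmoothAt_const _ x) ?_
  exact (((((hY.inner hZ).mvfderiv hX).add ((hZ.inner hX).mvfderiv hY)).sub
    ((hX.inner hY).mvfderiv hZ)).add ((hX.mlieBracket hY).inner hZ)).sub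
      ((hX.mlieBracket hZ).inner hY) |>.sub ((hY.mlieBracket hZ).inner hX)

/-- `ESmooth` speaks of global smooth fields only. Expanding Y in a dual frame transfers it to
fields that are merely differentiable at a point. -/
theorem ESmooth.vdiffAt {h : EndField n M} (hh : ESmooth h) {Y : VecField n M} {x : M}
    (hY : VDiffAt Y x) : VDiffAt (fun y ↦ h y (Y y)) x := by
  obtain ⟨s, V, V', hV⟩ := exists_isDualFrame n M
  have h1 : (fun y ↦ h y (Y y)) = fun y ↦ ∑ b, ((fun y ↦ (inner ℝ (V' b y) (Y y) : ℝ)) •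
      fun y ↦ h y (V b y)) y := by
    ext1 y
    conv_lhs => rw [← hV.expand y (Y y)]
    simp
  rw [h1]
  exact VDiffAt.sum fun b _ ↦ VDiffAt.smul (hV.mdiffAt_coeff hY b)
    ((hh _ (hV.smooth b)).vdiffAt x)

theorem BSmooth.vdiffAt {A : BilField n M} (hA : BSmooth A) {Y Z : VecField n M} {x : M}
    (hY : VDiffAt Y x) (hZ : VDiffAt Z x) : VDiffAt (fun y ↦ A y (Y y) (Z y)) x := by
  obtain ⟨s, V, V', hV⟩ := exists_isDualFrame n M
  have h1 : (fun y ↦ A y (Y y) (Z y)) = fun y ↦ ∑ b, ((fun y ↦ (inner ℝ (V' b y) (Y y) : ℝ)) •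
      fun y ↦ ∑ c, ((fun y ↦ (inner ℝ (V' c y) (Z y) : ℝ)) • fun y ↦ A y (V b y) (V c y)) y) y := by
    ext1 y
    conv_lhs => rw [← hV.expand y (Y y), ← hV.expand y (Z y)]
    simp only [map_sum, map_smul, _root_.sum_apply, _root_.smul_apply, Pi.smul_apply',
      Finset.smul_sum]
    rw [Finset.sum_comm]
    exact Finset.sum_congr rfl fun b _ ↦ Finset.sum_congr rfl fun c _ ↦ smul_comm _ _ _
  rw [h1]
  exact VDiffAt.sum fun b _ ↦ VDiffAt.smul (hV.mdiffAt_coeff hY b)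
    (VDiffAt.sum fun c _ ↦ VDiffAt.smul (hV.mdiffAt_coeff hZ c)
      ((hA _ _ (hV.smooth b) (hV.smooth c)).vdiffAt x))

/-- The difference on the right is tensorial in Y, since the derivatives of a factor f cancel; the
extension used in the definition is therefore immaterial. -/
theorem nablaEndAt_eq {h : EndField n M} (hh : ESmooth h) {Y : VecField n M} {x : M}
    (hY : VDiffAt Y x) (u : TangentSpace (𝓡 n) x) :
    nablaEndAt h x u (Y x) = nabla (fun y ↦ h y (Y y)) x u - h x (nabla Y x u) := by
  have ht : TensorialAt (𝓡 n) (EuclideanSpace ℝ (Fin n))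
      (fun Y : VecField n M ↦ nabla (fun y ↦ h y (Y y)) x u - h x (nabla Y x u)) x :=
    { smul := fun {f Y} hf hY ↦ by
        have h1 : (fun y ↦ h y ((f • Y) y)) = f • fun y ↦ h y (Y y) := by ext1 y; simp
        rw [h1, nabla_smul hf (hh.vdiffAt hY), nabla_smul hf hY]
        simp only [map_add, map_smul]
        module
      add := fun {Y Z} hY hZ ↦ by
        have h1 : (fun y ↦ h y ((Y + Z) y)) = (fun y ↦ h y (Y y)) + fun y ↦ h y (Z y) := by
          ext1 y; simp
        rw [h1, nabla_add (hh.vdiffAt hY) (hh.vdiffAt hZ), nabla_add hY hZ]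
        simp only [map_add, _root_.add_apply]
        module }
  exact ht.pointwise (mdiffAt_ext _) hY (by simp)

theorem nablaEnd_eq_nablaEndAt {h : EndField n M} (hh : ESmooth h) (x : M)
    (u v : TangentSpace (𝓡 n) x) : nablaEnd h x u v = nablaEndAt h x u v := by
  have hv : ∀ u v, (linOf x fun v ↦ nablaEndAt h x u v) v = nablaEndAt h x u v := fun u v ↦ by
    refine linOf_eq _ (fun v w ↦ ?_) (fun c v ↦ ?_) v
    · have h2 := nablaEndAt_eq hh ((mdiffAt_ext v).add (mdiffAt_ext w)) u
      simp only [Pi.add_apply, ext_self] at h2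
      rw [h2, nabla_add (mdiffAt_ext v) (mdiffAt_ext w)]
      simp only [map_add, _root_.add_apply]
      have := nabla_add (hh.vdiffAt (mdiffAt_ext v)) (hh.vdiffAt (mdiffAt_ext w))
      have h3 := congr($this u)
      simp only [Pi.add_def, _root_.add_apply] at h3
      rw [h3]
      unfold nablaEndAt
      module
    · have h2 := nablaEndAt_eq hh (VDiffAt.smul (f := fun _ ↦ c) mdifferentiableAt_const
        (mdiffAt_ext v)) u
      simp only [Pi.smul_apply', ext_self, map_smul] at h2
      rw [h2, nabla_const_smul c (hh.vdiffAt (mdiffAt_ext v))]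
      change _ - h x (nabla (fun y ↦ c • ext v y) x u) = _
      rw [nabla_const_smul c (mdiffAt_ext v), map_smul]
      unfold nablaEndAt
      module
  rw [nablaEnd, linOf_eq _ (fun u w ↦ ?_) (fun c u ↦ ?_), hv]
  · ext1 v
    rw [_root_.add_apply, hv, hv, hv]
    simp only [nablaEndAt, map_add]
    module
  · ext1 v
    rw [_root_.smul_apply, hv, hv]
    simp only [nablaEndAt, map_smul]
    module

/-- The covariant derivative of an endomorphism field, computed with any extension `Y`. -/
theorem nablaEnd_apply {h : EndField n M} (hh : ESmooth h) {Y : VecField n M} {x : M}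
    (hY : VDiffAt Y x) (u : TangentSpace (𝓡 n) x) :
    nablaEnd h x u (Y x) = nabla (fun y ↦ h y (Y y)) x u - h x (nabla Y x u) := by
  rw [nablaEnd_eq_nablaEndAt hh, nablaEndAt_eq hh hY]

theorem BSmooth.esmooth {A : BilField n M} (hA : BSmooth A) {Y : VecField n M} (hY : VSmooth Y) :
    ESmooth (fun y ↦ A y (Y y)) := fun Z hZ ↦ hA Y Z hY hZ

theorem nablaBilinAt_eq {A : BilField n M} (hA : BSmooth A) {Y Z : VecField n M} {x : M}
    (hY : VDiffAt Y x) (hZ : VDiffAt Z x) (u : TangentSpace (𝓡 n) x) :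
    nablaBilinAt A x u (Y x) (Z x) = nabla (fun y ↦ A y (Y y) (Z y)) x u -
      A x (nabla Y x u) (Z x) - A x (Y x) (nabla Z x u) := by
  have ht1 (Z : VecField n M) (hZ : VDiffAt Z x) : TensorialAt (𝓡 n) (EuclideanSpace ℝ (Fin n))
      (fun Y : VecField n M ↦ nabla (fun y ↦ A y (Y y) (Z y)) x u -
      A x (nabla Y x u) (Z x) - A x (Y x) (nabla Z x u)) x :=
    { smul := fun {f Y} hf hY ↦ by
        have h1 : (fun y ↦ A y ((f • Y) y) (Z y)) = f • fun y ↦ A y (Y y) (Z y) := by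
          ext1 y; simp
        rw [h1, nabla_smul hf (hA.vdiffAt hY hZ), nabla_smul hf hY]
        simp only [map_add, map_smul, _root_.add_apply, _root_.smul_apply, Pi.smul_apply']
        module
      add := fun {Y W} hY hW ↦ by
        have h1 : (fun y ↦ A y ((Y + W) y) (Z y)) =
            (fun y ↦ A y (Y y) (Z y)) + fun y ↦ A y (W y) (Z y) := by ext1 y; simp
        rw [h1, nabla_add (hA.vdiffAt hY hZ) (hA.vdiffAt hW hZ), nabla_add hY hW]
        simp only [map_add, _root_.add_apply, Pi.add_apply]
        module }
  have ht2 (Y : VecField n M) (hY : VDiffAt Y x) : TensorialAt (𝓡 n) (EuclideanSpace ℝ (Fin n))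
      (fun Z : VecField n M ↦ nabla (fun y ↦ A y (Y y) (Z y)) x u -
      A x (nabla Y x u) (Z x) - A x (Y x) (nabla Z x u)) x :=
    { smul := fun {f Z} hf hZ ↦ by
        have h1 : (fun y ↦ A y (Y y) ((f • Z) y)) = f • fun y ↦ A y (Y y) (Z y) := by
          ext1 y; simp
        rw [h1, nabla_smul hf (hA.vdiffAt hY hZ), nabla_smul hf hZ]
        simp only [map_add, map_smul, Pi.smul_apply']
        module
      add := fun {Z W} hZ hW ↦ by
        have h1 : (fun y ↦ A y (Y y) ((Z + W) y)) =
            (fun y ↦ A y (Y y) (Z y)) + fun y ↦ A y (Y y) (W y) := by ext1 y; simp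
        rw [h1, nabla_add (hA.vdiffAt hY hZ) (hA.vdiffAt hY hW), nabla_add hZ hW]
        simp only [map_add, _root_.add_apply, Pi.add_apply]
        module }
  have h1 := (ht1 _ (mdiffAt_ext (Z x))).pointwise (mdiffAt_ext (Y x)) hY (by simp)
  have h2 := (ht2 _ hY).pointwise (mdiffAt_ext (Z x)) hZ (by simp)
  rw [← h2, ← h1]
  simp [nablaBilinAt]

theorem nablaBilinAt_eq_nablaEnd {A : BilField n M} (hA : BSmooth A) {Y : VecField n M}
    (hY : VSmooth Y) {x : M} (u v : TangentSpace (𝓡 n) x) :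
    nablaBilinAt A x u (Y x) v = nablaEnd (fun y ↦ A y (Y y)) x u v - A x (nabla Y x u) v := by
  have h1 := nablaBilinAt_eq hA (hY.vdiffAt x) (mdiffAt_ext v) u
  have h2 := nablaEnd_apply (hA.esmooth hY) (mdiffAt_ext v) u
  rw [ext_self] at h1 h2
  rw [h1, h2]
  module

/-- The covariant derivative of a field of bilinear maps as a trilinear map. -/
theorem exists_nablaBilin {A : BilField n M} (hA : BSmooth A) (x : M) :
    ∃ T : TangentSpace (𝓡 n) x →ₗ[ℝ] TangentSpace (𝓡 n) x →ₗ[ℝ]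
      TangentSpace (𝓡 n) x →ₗ[ℝ] TangentSpace (𝓡 n) x,
      ∀ u v w, T u v w = nablaBilinAt A x u v w := by
  have e (u v w : TangentSpace (𝓡 n) x) (Y Z : VecField n M) (hY : VDiffAt Y x)
      (hZ : VDiffAt Z x) (h1 : Y x = v) (h2 : Z x = w) := by
    have h3 := nablaBilinAt_eq hA hY hZ u
    rw [h1, h2] at h3
    exact h3
  have ew (u v w w' : TangentSpace (𝓡 n) x) :
      nablaBilinAt A x u v (w + w') = nablaBilinAt A x u v w + nablaBilinAt A x u v w' := by
    have h1 : (fun y ↦ A y (ext v y) ((ext w + ext w') y)) =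
        (fun y ↦ A y (ext v y) (ext w y)) + fun y ↦ A y (ext v y) (ext w' y) := by ext1 y; simp
    rw [e u v (w + w') (ext v) (ext w + ext w') (mdiffAt_ext v)
      ((mdiffAt_ext w).add (mdiffAt_ext w')) (by simp) (by simp), h1,
      nabla_add (hA.vdiffAt (mdiffAt_ext v) (mdiffAt_ext w))
        (hA.vdiffAt (mdiffAt_ext v) (mdiffAt_ext w')), nabla_add (mdiffAt_ext w) (mdiffAt_ext w')]
    simp only [nablaBilinAt, map_add, _root_.add_apply]
    module
  have sw (c : ℝ) (u v w : TangentSpace (𝓡 n) x) :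
      nablaBilinAt A x u v (c • w) = c • nablaBilinAt A x u v w := by
    have h1 : (fun y ↦ A y (ext v y) (c • ext w y)) =
        (fun y ↦ c • A y (ext v y) (ext w y)) := by ext1 y; simp
    rw [e u v (c • w) (ext v) (fun y ↦ c • ext w y) (mdiffAt_ext v)
      (VDiffAt.smul (f := fun _ ↦ c) mdifferentiableAt_const (mdiffAt_ext w)) (by simp) (by simp),
      h1, nabla_const_smul c (hA.vdiffAt (mdiffAt_ext v) (mdiffAt_ext w)),
      nabla_const_smul c (mdiffAt_ext w)]
    simp only [nablaBilinAt, map_smul]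
    module
  have ev (u v v' w : TangentSpace (𝓡 n) x) :
      nablaBilinAt A x u (v + v') w = nablaBilinAt A x u v w + nablaBilinAt A x u v' w := by
    have h1 : (fun y ↦ A y ((ext v + ext v') y) (ext w y)) =
        (fun y ↦ A y (ext v y) (ext w y)) + fun y ↦ A y (ext v' y) (ext w y) := by ext1 y; simp
    rw [e u (v + v') w (ext v + ext v') (ext w)
      ((mdiffAt_ext v).add (mdiffAt_ext v')) (mdiffAt_ext w) (by simp) (by simp), h1,
      nabla_add (hA.vdiffAt (mdiffAt_ext v) (mdiffAt_ext w))
        (hA.vdiffAt (mdiffAt_ext v') (mdiffAt_ext w)), nabla_add (mdiffAt_ext v) (mdiffAt_ext v')]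
    simp only [nablaBilinAt, map_add, _root_.add_apply]
    module
  have sv (c : ℝ) (u v w : TangentSpace (𝓡 n) x) :
      nablaBilinAt A x u (c • v) w = c • nablaBilinAt A x u v w := by
    have h1 : (fun y ↦ A y (c • ext v y) (ext w y)) =
        (fun y ↦ c • A y (ext v y) (ext w y)) := by ext1 y; simp
    rw [e u (c • v) w (fun y ↦ c • ext v y) (ext w)
      (VDiffAt.smul (f := fun _ ↦ c) mdifferentiableAt_const (mdiffAt_ext v)) (mdiffAt_ext w)
      (by simp) (by simp),
      h1, nabla_const_smul c (hA.vdiffAt (mdiffAt_ext v) (mdiffAt_ext w)),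
      nabla_const_smul c (mdiffAt_ext v)]
    simp only [nablaBilinAt, map_smul, _root_.smul_apply]
    module
  refine ⟨LinearMap.mk₂ ℝ (fun u v ↦ (⟨⟨fun w ↦ nablaBilinAt A x u v w, ew u v⟩,
    fun c w ↦ sw c u v w⟩ : TangentSpace (𝓡 n) x →ₗ[ℝ] TangentSpace (𝓡 n) x))
    (fun u u' v ↦ ?_) (fun c u v ↦ ?_) (fun u v v' ↦ ?_) (fun c u v ↦ ?_), fun u v w ↦ rfl⟩
  all_goals
    refine LinearMap.ext fun w ↦ ?_
  · change nablaBilinAt A x (u + u') v w = nablaBilinAt A x u v w + nablaBilinAt A x u' v w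
    simp only [nablaBilinAt, map_add, _root_.add_apply]
    module
  · change nablaBilinAt A x (c • u) v w = c • nablaBilinAt A x u v w
    simp only [nablaBilinAt, map_smul, _root_.smul_apply]
    module
  · exact ev u v v' w
  · exact sv c u v w

theorem divForm_apply {A : BilField n M} (hA : BSmooth A) (x : M) (v : TangentSpace (𝓡 n) x) :
    divForm A x v = -∑ i, nablaBilinAt A x (frame x i) (frame x i) v := by
  obtain ⟨T, hT⟩ := exists_nablaBilin hA x
  refine linOf_eq _ (fun v w ↦ ?_) (fun c v ↦ ?_) v
  · simp only [← hT, map_add, Finset.sum_add_distrib, neg_add]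
  · simp only [← hT, map_smul, ← Finset.smul_sum, smul_neg]

theorem ESmooth.nablaEnd {h : EndField n M} (hh : ESmooth h) : BSmooth (nablaEnd h) := by
  intro X Y hX hY
  have h1 : (fun y ↦ EinsteinDeformation.nablaEnd h y (X y) (Y y)) =
      fun y ↦ EinsteinDeformation.nabla (fun y ↦ h y (Y y)) y (X y) -
        h y (EinsteinDeformation.nabla Y y (X y)) := by
    ext1 y
    exact nablaEnd_apply hh (hY.vdiffAt y) _
  rw [h1]
  exact (hX.nabla (hh Y hY)).sub (hh _ (hX.nabla hY))

/-- The trace is rewritten in a dual frame, because the bases in the definition need not vary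
smoothly. -/
theorem BSmooth.divForm {A : BilField n M} (hA : BSmooth A) : ESmooth (divForm A) := by
  intro Y hY
  obtain ⟨s, V, V', hV⟩ := exists_isDualFrame n M
  have h1 : (fun y ↦ EinsteinDeformation.divForm A y (Y y)) = fun y ↦
      -∑ b, (EinsteinDeformation.nabla (fun y ↦ A y (V' b y) (Y y)) y (V b y) -
        A y (EinsteinDeformation.nabla (V' b) y (V b y)) (Y y) -
        A y (V' b y) (EinsteinDeformation.nabla Y y (V b y))) := by
    ext1 y
    rw [divForm_apply hA]
    congr 1
    obtain ⟨T, hT⟩ := exists_nablaBilin hA y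
    refine nabla_ext_iff.mpr fun w ↦ ?_
    have h2 := hV.sum_bilin y (LinearMap.mk₂ ℝ (fun p q ↦ (inner ℝ (T p q (Y y)) w : ℝ))
      (by intros; simp [inner_add_left]) (by intros; simp [inner_smul_left])
      (by intros; simp [inner_add_left]) (by intros; simp [inner_smul_left]))
    simp only [LinearMap.mk₂_apply, hT] at h2
    rw [sum_inner, sum_inner, ← h2]
    refine Finset.sum_congr rfl fun b _ ↦ ?_
    rw [nablaBilinAt_eq hA ((hV.smooth' b).vdiffAt y) (hY.vdiffAt y)]
  rw [h1]
  exact (VSmooth.sum fun b _ ↦ ((((hV.smooth b).nabla (hA _ _ (hV.smooth' b) hY)).sub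
    (hA _ _ ((hV.smooth b).nabla (hV.smooth' b)) hY)).sub
      (hA _ _ (hV.smooth' b) ((hV.smooth b).nabla hY)))).neg

theorem extD_apply (h : EndField n M) (x : M) (u v : TangentSpace (𝓡 n) x) :
    extD h x u v = nablaEnd h x u v - nablaEnd h x v u := by
  have hv : ∀ u v, (linOf x fun v ↦ nablaEnd h x u v - nablaEnd h x v u) v =
      nablaEnd h x u v - nablaEnd h x v u := fun u v ↦
    linOf_eq _ (fun v w ↦ by simp only [map_add, _root_.add_apply]; module)
      (fun c v ↦ by simp only [map_smul, _root_.smul_apply]; module) v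
  rw [extD, linOf_eq _ (fun u w ↦ ?_) (fun c u ↦ ?_), hv]
  · ext1 v
    rw [_root_.add_apply, hv, hv, hv]
    simp only [map_add, _root_.add_apply]
    module
  · ext1 v
    rw [_root_.smul_apply, hv, hv]
    simp only [map_smul, _root_.smul_apply]
    module

theorem sharp_apply (h : EndField n M) (α : BilField n M) (x : M) (u v : TangentSpace (𝓡 n) x) :
    sharp h α x u v = α x (h x u) v + α x u (h x v) := by
  have hv : ∀ u v, (linOf x fun v ↦ α x (h x u) v + α x u (h x v)) v =
      α x (h x u) v + α x u (h x v) := fun u v ↦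
    linOf_eq _ (fun v w ↦ by simp only [map_add]; module)
      (fun c v ↦ by simp only [map_smul]; module) v
  rw [sharp, linOf_eq _ (fun u w ↦ ?_) (fun c u ↦ ?_), hv]
  · ext1 v
    rw [_root_.add_apply, hv, hv, hv]
    simp only [map_add, _root_.add_apply]
    module
  · ext1 v
    rw [_root_.smul_apply, hv, hv]
    simp only [map_smul, _root_.smul_apply]
    module

theorem ESmooth.extD {h : EndField n M} (hh : ESmooth h) : BSmooth (extD h) := by
  intro X Y hX hY
  simp only [extD_apply]
  exact (hh.nablaEnd X Y hX hY).sub (hh.nablaEnd Y X hY hX)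

theorem ESmooth.sharp {h : EndField n M} (hh : ESmooth h) {α : BilField n M} (hα : BSmooth α) :
    BSmooth (sharp h α) := by
  intro X Y hX hY
  simp only [sharp_apply]
  exact (hα _ Y (hh X hX) hY).add (hα X _ hX (hh Y hY))

theorem fnBracket_apply (h k : EndField n M) (x : M) (u v : TangentSpace (𝓡 n) x) :
    fnBracket h k x u v = (1 / 2 : ℝ) • (-(sharp h (extD k) x u v + sharp k (extD h) x u v) +
      extD (fun y ↦ h y ∘L k y + k y ∘L h y) x u v) := rfl

theorem bsmooth_fnBracket {h k : EndField n M} (hh : ESmooth h) (hk : ESmooth k) :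
    BSmooth (fnBracket h k) := by
  intro X Y hX hY
  simp only [fnBracket_apply]
  exact vsmooth_const_smul _ (((hh.sharp hk.extD X Y hX hY).add
    (hk.sharp hh.extD X Y hX hY)).neg.add (((hh.comp hk).add (hk.comp hh)).extD X Y hX hY))

end TensorCalculus

/-! ### Traces, divergences and the pointwise integration by parts -/

section Divergence

variable {n : ℕ} {M : Type*} [TopologicalSpace M] [ChartedSpace (EuclideanSpace ℝ (Fin n)) M]
  [IsManifold (𝓡 n) ∞ M] [RiemannianBundle (fun x : M ↦ TangentSpace (𝓡 n) x)]

theorem tr_eq_sum {x : M} (A : TangentSpace (𝓡 n) x →L[ℝ] TangentSpace (𝓡 n) x) :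
    tr A = ∑ i, (inner ℝ (A (frame x i)) (frame x i) : ℝ) := by
  rw [tr, LinearMap.trace_eq_sum_inner _ (frame x)]
  exact Finset.sum_congr rfl fun i _ ↦ real_inner_comm _ _

theorem tr_add {x : M} (A B : TangentSpace (𝓡 n) x →L[ℝ] TangentSpace (𝓡 n) x) :
    tr (A + B) = tr A + tr B := by
  simp [tr_eq_sum, inner_add_left, Finset.sum_add_distrib]

theorem tr_smul {x : M} (c : ℝ) (A : TangentSpace (𝓡 n) x →L[ℝ] TangentSpace (𝓡 n) x) :
    tr (c • A) = c * tr A := by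
  simp [tr_eq_sum, inner_smul_left, Finset.mul_sum]

theorem tr_sub {x : M} (A B : TangentSpace (𝓡 n) x →L[ℝ] TangentSpace (𝓡 n) x) :
    tr (A - B) = tr A - tr B := by
  simp [tr_eq_sum, inner_sub_left, Finset.sum_sub_distrib]

theorem innerEnd_id {x : M} (A : TangentSpace (𝓡 n) x →L[ℝ] TangentSpace (𝓡 n) x) :
    innerEnd A (ContinuousLinearMap.id ℝ _) = tr A := by
  simp [innerEnd, tr_eq_sum]

/-- The inner product of bilinear maps with values in the tangent space. -/
def innerBil {x : M}
    (A C : TangentSpace (𝓡 n) x →L[ℝ] TangentSpace (𝓡 n) x →L[ℝ] TangentSpace (𝓡 n) x) : ℝ :=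
  ∑ i, innerEnd (A (frame x i)) (C (frame x i))

/-- The vector field `X` with `g (X, u) = ⟨A u, B⟩`. -/
def contr (A : BilField n M) (B : EndField n M) : VecField n M :=
  fun y ↦ ∑ i, innerEnd (A y (frame y i)) (B y) • frame y i

theorem innerEnd_linear {x : M}
    (A : TangentSpace (𝓡 n) x →L[ℝ] TangentSpace (𝓡 n) x →L[ℝ] TangentSpace (𝓡 n) x)
    (B : TangentSpace (𝓡 n) x →L[ℝ] TangentSpace (𝓡 n) x) (u : TangentSpace (𝓡 n) x) :
    innerEnd (A u) B = ∑ i, (inner ℝ (frame x i) u : ℝ) * innerEnd (A (frame x i)) B := by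
  conv_lhs => rw [← inner_frame_expand u]
  simp only [innerEnd, map_sum, map_smul, _root_.sum_apply, _root_.smul_apply, sum_inner,
    inner_smul_left, RCLike.conj_to_real, Finset.mul_sum]
  rw [Finset.sum_comm]

theorem inner_contr (A : BilField n M) (B : EndField n M) (y : M) (u : TangentSpace (𝓡 n) y) :
    inner ℝ (contr A B y) u = innerEnd (A y u) (B y) := by
  rw [innerEnd_linear, contr, sum_inner]
  refine Finset.sum_congr rfl fun i _ ↦ ?_
  rw [inner_smul_left, RCLike.conj_to_real, mul_comm]

theorem tr_symPart {x : M} (A : TangentSpace (𝓡 n) x →L[ℝ] TangentSpace (𝓡 n) x) :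
    tr (symPart A) = tr A := by
  classical
  have h : ∀ j, (inner ℝ (∑ i, (inner ℝ (frame x j) (A (frame x i)) : ℝ) • frame x i)
      (frame x j) : ℝ) = inner ℝ (A (frame x j)) (frame x j) := fun j ↦ by
    simp [sum_inner, inner_smul_left, orthonormal_iff_ite.mp (frame x).orthonormal]
    exact real_inner_comm _ _
  rw [symPart, tr_smul, tr_add]
  conv_lhs => enter [2, 2]; rw [tr_eq_sum]
  simp only [linOf_frame, h, ← tr_eq_sum]
  ring

theorem tr_divStar (X : VecField n M) (x : M) : tr (divStar X x) = tr (nabla X x) := tr_symPart _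

variable [IsContMDiffRiemannianBundle (𝓡 n) ∞ (EuclideanSpace ℝ (Fin n))
      (fun x : M ↦ TangentSpace (𝓡 n) x)]

theorem esmooth_id : ESmooth (fun y : M ↦ ContinuousLinearMap.id ℝ (TangentSpace (𝓡 n) y)) :=
  fun _ hX ↦ hX

theorem FSmooth.smul_id {f : M → ℝ} (hf : FSmooth n f) :
    ESmooth (fun y : M ↦ f y • ContinuousLinearMap.id ℝ (TangentSpace (𝓡 n) y)) :=
  fun _ hX ↦ hf.smul hX

section Dual

variable {ι : Type*} [Fintype ι] {V V' : ι → VecField n M}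

theorem IsDualFrame.innerEnd_eq (hV : IsDualFrame V V') {x : M}
    (A B : TangentSpace (𝓡 n) x →L[ℝ] TangentSpace (𝓡 n) x) :
    innerEnd A B = ∑ b, (inner ℝ (A (V b x)) (B (V' b x)) : ℝ) := by
  have h2 := hV.sum_bilin x (LinearMap.mk₂ ℝ (fun p q ↦ (inner ℝ (A p) (B q) : ℝ))
      (by intros; simp [inner_add_left]) (by intros; simp [inner_smul_left])
      (by intros; simp [inner_add_right]) (by intros; simp [inner_smul_right]))
  simp only [LinearMap.mk₂_apply] at h2
  rw [h2, innerEnd]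

theorem IsDualFrame.sum_inner_nabla (hV : IsDualFrame V V') {x : M} (u : TangentSpace (𝓡 n) x)
    (A B : TangentSpace (𝓡 n) x →L[ℝ] TangentSpace (𝓡 n) x) :
    ∑ b, ((inner ℝ (A (nabla (V b) x u)) (B (V' b x)) : ℝ) +
      inner ℝ (A (V b x)) (B (nabla (V' b) x u))) = 0 := by
  have h2 := hV.sum_bilin_nabla x u (LinearMap.mk₂ ℝ (fun p q ↦ (inner ℝ (A p) (B q) : ℝ))
      (by intros; simp [inner_add_left]) (by intros; simp [inner_smul_left])
      (by intros; simp [inner_add_right]) (by intros; simp [inner_smul_right]))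
  simpa only [LinearMap.mk₂_apply] using h2

end Dual

variable [CompactSpace M] [T2Space M]

theorem ESmooth.innerEnd {h k : EndField n M} (hh : ESmooth h) (hk : ESmooth k) :
    FSmooth n (fun y ↦ innerEnd (h y) (k y)) := by
  obtain ⟨s, V, V', hV⟩ := exists_isDualFrame n M
  simp only [hV.innerEnd_eq]
  exact FSmooth.sum fun b _ ↦ (hh _ (hV.smooth b)).inner (hk _ (hV.smooth' b))

theorem ESmooth.tr {h : EndField n M} (hh : ESmooth h) : FSmooth n (fun y ↦ tr (h y)) := by
  simp only [← innerEnd_id]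
  exact hh.innerEnd esmooth_id

theorem vsmooth_contr {A : BilField n M} {B : EndField n M} (hA : BSmooth A) (hB : ESmooth B) :
    VSmooth (contr A B) := by
  refine vsmooth_of_inner fun Z hZ ↦ ?_
  simp only [inner_contr]
  exact (hA.esmooth hZ).innerEnd hB

/-- The derivative of the inner product of two fields of endomorphisms. -/
theorem mvfderiv_innerEnd {h k : EndField n M} (hh : ESmooth h) (hk : ESmooth k) (x : M)
    (u : TangentSpace (𝓡 n) x) :
    mvfderiv (𝓡 n) (fun y ↦ innerEnd (h y) (k y)) x u =
      innerEnd (nablaEnd h x u) (k x) + innerEnd (h x) (nablaEnd k x u) := by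
  obtain ⟨s, V, V', hV⟩ := exists_isDualFrame n M
  simp only [hV.innerEnd_eq]
  rw [mvfderiv_sum fun b _ ↦ ((hh _ (hV.smooth b)).inner (hk _ (hV.smooth' b))).mdiffAt x]
  rw [← Finset.sum_add_distrib]
  -- The derivatives of the frame fields appear on one side only. They are supplied on the other
  -- side as the zero of `sum_inner_nabla`.
  conv_rhs => rw [← add_zero (∑ b, _), ← hV.sum_inner_nabla u (h x) (k x), ← Finset.sum_add_distrib]
  refine Finset.sum_congr rfl fun b _ ↦ ?_
  rw [mvfderiv_inner ((hh _ (hV.smooth b)).vdiffAt x) ((hk _ (hV.smooth' b)).vdiffAt x),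
    nablaEnd_apply hh ((hV.smooth b).vdiffAt x), nablaEnd_apply hk ((hV.smooth' b).vdiffAt x),
    inner_sub_left, inner_sub_right]
  ring

theorem nablaEnd_smul_id {f : M → ℝ} (hf : FSmooth n f) (x : M) (u v : TangentSpace (𝓡 n) x) :
    nablaEnd (fun y : M ↦ f y • ContinuousLinearMap.id ℝ (TangentSpace (𝓡 n) y)) x u v =
      mvfderiv (𝓡 n) f x u • v := by
  have h1 := nablaEnd_apply hf.smul_id (mdiffAt_ext v) u
  have h2 := nabla_smul (hf.mdiffAt x) (mdiffAt_ext v) u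
  rw [ext_self] at h1 h2
  rw [h1]
  change nabla (f • ext v) x u - f x • nabla (ext v) x u = _
  rw [h2]
  module

theorem nablaEnd_id (x : M) (u v : TangentSpace (𝓡 n) x) :
    nablaEnd (fun y : M ↦ ContinuousLinearMap.id ℝ (TangentSpace (𝓡 n) y)) x u v = 0 := by
  have h1 := nablaEnd_apply esmooth_id (mdiffAt_ext v) u
  rw [ext_self] at h1
  rw [h1]
  simp

/-- The trace is the inner product with the identity, which is parallel. -/
theorem mvfderiv_tr {h : EndField n M} (hh : ESmooth h) (x : M) (u : TangentSpace (𝓡 n) x) :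
    mvfderiv (𝓡 n) (fun y ↦ tr (h y)) x u = tr (nablaEnd h x u) := by
  have h1 := mvfderiv_innerEnd hh esmooth_id x u
  simp only [innerEnd_id] at h1
  rw [h1]
  simp [innerEnd, nablaEnd_id]

/-- Differentiate g(contr A B, W) = ⟨A(W), B⟩ for a field W extending w; the terms with ∇W cancel.
-/
theorem inner_nabla_contr {A : BilField n M} {B : EndField n M} (hA : BSmooth A) (hB : ESmooth B)
    (x : M) (u w : TangentSpace (𝓡 n) x) :
    inner ℝ (nabla (contr A B) x u) w =
      ∑ j, (inner ℝ (nablaBilinAt A x u w (frame x j)) (B x (frame x j)) : ℝ) +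
        innerEnd (A x w) (nablaEnd B x u) := by
  obtain ⟨W, hW, hWx⟩ := exists_vsmooth_eq w
  have h1 := mvfderiv_inner ((vsmooth_contr hA hB).vdiffAt x) (hW.vdiffAt x) u
  simp only [inner_contr] at h1
  rw [mvfderiv_innerEnd (hA.esmooth hW) hB, hWx] at h1
  have h2 : innerEnd (nablaEnd (fun y ↦ A y (W y)) x u) (B x) =
      ∑ j, (inner ℝ (nablaBilinAt A x u w (frame x j)) (B x (frame x j)) : ℝ) +
        innerEnd (A x (nabla W x u)) (B x) := by
    rw [innerEnd, innerEnd, ← Finset.sum_add_distrib]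
    refine Finset.sum_congr rfl fun j _ ↦ ?_
    rw [← hWx, nablaBilinAt_eq_nablaEnd hA hW, ← inner_add_left, sub_add_cancel]
  rw [h2] at h1
  linarith

/-- The pointwise form of the integration by parts formula for the divergence. -/
theorem tr_nabla_contr {A : BilField n M} {B : EndField n M} (hA : BSmooth A) (hB : ESmooth B)
    (x : M) : tr (nabla (contr A B) x) =
      innerBil (A x) (nablaEnd B x) - innerEnd (divForm A x) (B x) := by
  rw [tr_eq_sum]
  simp only [inner_nabla_contr hA hB]
  rw [Finset.sum_add_distrib, Finset.sum_comm]
  have h : ∀ j, ∑ i, (inner ℝ (nablaBilinAt A x (frame x i) (frame x i) (frame x j))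
      (B x (frame x j)) : ℝ) = -inner ℝ (divForm A x (frame x j)) (B x (frame x j)) := fun j ↦ by
    rw [divForm_apply hA, inner_neg_left, sum_inner, neg_neg]
  simp only [h, Finset.sum_neg_distrib]
  rw [innerBil, innerEnd]
  ring

theorem grad_tr_eq_contr {k : EndField n M} (hk : ESmooth k) :
    grad (n := n) (fun y ↦ tr (k y)) =
      contr (nablaEnd k) (fun y : M ↦ ContinuousLinearMap.id ℝ (TangentSpace (𝓡 n) y)) := by
  ext1 y
  simp only [grad, contr, innerEnd_id, mvfderiv_tr hk]

/-- The rough Laplacian is `divForm (nablaEnd k)` by definition, and the gradient of tr k is the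
contraction of ∇k with the identity. The pointwise integration by parts formula therefore applies
with B the identity, where ∇B = 0. -/
theorem tr_roughLaplacian {k : EndField n M} (hk : ESmooth k) (x : M) :
    tr (roughLaplacian k x) = -tr (nabla (grad (n := n) (fun y ↦ tr (k y))) x) := by
  rw [grad_tr_eq_contr hk, tr_nabla_contr hk.nablaEnd esmooth_id, innerEnd_id]
  have h : innerBil (nablaEnd k x)
      (nablaEnd (fun y : M ↦ ContinuousLinearMap.id ℝ (TangentSpace (𝓡 n) y)) x) = 0 := by
    simp [innerBil, innerEnd, nablaEnd_id]
  rw [h, zero_sub, neg_neg]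
  rfl

theorem vsmooth_grad {f : M → ℝ} (hf : FSmooth n f) : VSmooth (grad (n := n) f) := by
  refine vsmooth_of_inner fun Z hZ ↦ ?_
  have h : (fun y ↦ (inner ℝ (grad f y) (Z y) : ℝ)) = fun y ↦ mvfderiv (𝓡 n) f y (Z y) := by
    ext1 y
    conv_rhs => rw [← inner_frame_expand (Z y)]
    simp only [grad, sum_inner, inner_smul_left, RCLike.conj_to_real, map_sum, map_smul, smul_eq_mul]
    exact Finset.sum_congr rfl fun i _ ↦ mul_comm _ _
  rw [h]
  exact hf.mvfderiv hZ

theorem inner_grad (f : M → ℝ) (x : M) (u : TangentSpace (𝓡 n) x) :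
    inner ℝ (grad f x) u = mvfderiv (𝓡 n) f x u := by
  conv_rhs => rw [← inner_frame_expand u]
  simp only [grad, sum_inner, inner_smul_left, RCLike.conj_to_real, map_sum, map_smul, smul_eq_mul]
  exact Finset.sum_congr rfl fun i _ ↦ mul_comm _ _

theorem ESmooth.div {k : EndField n M} (hk : ESmooth k) : VSmooth (div k) := by
  obtain ⟨s, V, V', hV⟩ := exists_isDualFrame n M
  have h : EinsteinDeformation.div k =
      fun y ↦ -∑ b, EinsteinDeformation.nablaEnd k y (V b y) (V' b y) := by
    ext1 y
    rw [EinsteinDeformation.div]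
    congr 1
    refine nabla_ext_iff.mpr fun w ↦ ?_
    have h2 := hV.sum_bilin y (LinearMap.mk₂ ℝ (fun p q ↦ (inner ℝ (EinsteinDeformation.nablaEnd k y p q) w : ℝ))
      (by intros; simp [inner_add_left]) (by intros; simp [inner_smul_left])
      (by intros; simp [inner_add_left]) (by intros; simp [inner_smul_left]))
    simp only [LinearMap.mk₂_apply] at h2
    rw [sum_inner, sum_inner, h2]
  rw [h]
  exact (VSmooth.sum fun b _ ↦ hk.nablaEnd _ _ (hV.smooth b) (hV.smooth' b)).neg

/-- The Leibniz rule for the composition of fields of endomorphisms. -/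
theorem nablaEnd_comp {h k : EndField n M} (hh : ESmooth h) (hk : ESmooth k) (x : M)
    (u v : TangentSpace (𝓡 n) x) :
    nablaEnd (fun y ↦ h y ∘L k y) x u v = nablaEnd h x u (k x v) + h x (nablaEnd k x u v) := by
  obtain ⟨Y, hY, rfl⟩ := exists_vsmooth_eq v
  rw [nablaEnd_apply (hh.comp hk) (hY.vdiffAt x), nablaEnd_apply hk (hY.vdiffAt x),
    nablaEnd_apply hh ((hk Y hY).vdiffAt x)]
  simp

theorem nablaEnd_add {h k : EndField n M} (hh : ESmooth h) (hk : ESmooth k) (x : M)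
    (u v : TangentSpace (𝓡 n) x) :
    nablaEnd (fun y ↦ h y + k y) x u v = nablaEnd h x u v + nablaEnd k x u v := by
  obtain ⟨Y, hY, rfl⟩ := exists_vsmooth_eq v
  rw [nablaEnd_apply (hh.add hk) (hY.vdiffAt x), nablaEnd_apply hk (hY.vdiffAt x),
    nablaEnd_apply hh (hY.vdiffAt x)]
  have h1 := congr($(nabla_add (hh.vdiffAt (hY.vdiffAt x)) (hk.vdiffAt (hY.vdiffAt x))) u)
  simp only [Pi.add_def, _root_.add_apply] at h1 ⊢
  rw [h1]
  module

/-- The covariant derivative of a field of symmetric endomorphisms is symmetric. -/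
theorem inner_nablaEnd_symm {h : EndField n M} (hh : ESmooth h)
    (hs : ∀ (y : M) (v w : TangentSpace (𝓡 n) y), (inner ℝ (h y v) w : ℝ) = inner ℝ v (h y w))
    (x : M) (u v w : TangentSpace (𝓡 n) x) :
    (inner ℝ (nablaEnd h x u v) w : ℝ) = inner ℝ v (nablaEnd h x u w) := by
  obtain ⟨Y, hY, rfl⟩ := exists_vsmooth_eq v
  obtain ⟨Z, hZ, rfl⟩ := exists_vsmooth_eq w
  have h1 := mvfderiv_inner ((hh Y hY).vdiffAt x) (hZ.vdiffAt x) u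
  have h2 := mvfderiv_inner (hY.vdiffAt x) ((hh Z hZ).vdiffAt x) u
  simp only [hs] at h1
  rw [h1] at h2
  rw [nablaEnd_apply hh (hY.vdiffAt x), nablaEnd_apply hh (hZ.vdiffAt x), inner_sub_left,
    inner_sub_right, hs]
  linarith

end Divergence

/-! ### Curvature symmetries and the Einstein condition -/

section Curvature

variable {n : ℕ} {M : Type*} [TopologicalSpace M] [ChartedSpace (EuclideanSpace ℝ (Fin n)) M]
  [IsManifold (𝓡 n) ∞ M] [RiemannianBundle (fun x : M ↦ TangentSpace (𝓡 n) x)]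
  [IsContMDiffRiemannianBundle (𝓡 n) ∞ (EuclideanSpace ℝ (Fin n))
      (fun x : M ↦ TangentSpace (𝓡 n) x)] [CompactSpace M] [T2Space M]

/-- A vector field that is smooth near `x` agrees near `x` with one that is smooth everywhere. -/
theorem exists_vsmooth_eventuallyEq {x : M} {X : VecField n M} {s : Set M} (hs : s ∈ 𝓝 x)
    (hX : ∀ y ∈ s, VSmoothAt X y) : ∃ Y : VecField n M, VSmooth Y ∧ Y =ᶠ[𝓝 x] X := by
  obtain ⟨f, -, hf⟩ := ((SmoothBumpFunction.nhds_basis_tsupport (I := 𝓡 n) x).mem_iff).mp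
    (interior_mem_nhds.mpr hs)
  refine ⟨fun y ↦ f y • X y, vsmooth_smul_of_tsupport isOpen_interior
    (fun y ↦ f.contMDiff y) hf fun y hy ↦ hX y (interior_subset hy), ?_⟩
  filter_upwards [f.eventuallyEq_one] with y hy
  rw [hy]
  exact one_smul ℝ _

/-- The curvature is defined by second derivatives of `ext w`, so a global replacement must share
its germ and not only its value at x. -/
theorem exists_vsmooth_eventuallyEq_ext {x : M} (w : TangentSpace (𝓡 n) x) :
    ∃ W : VecField n M, VSmooth W ∧ W =ᶠ[𝓝 x] ext w := by
  obtain ⟨s, hs, h⟩ := FiberBundle.exists_contMDiffOn_extend (k := ∞) (𝓡 n)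
    (EuclideanSpace ℝ (Fin n)) w
  exact exists_vsmooth_eventuallyEq (interior_mem_nhds.mpr hs) fun y hy ↦
    (h y (interior_subset hy)).contMDiffAt (mem_interior_iff_mem_nhds.mp hy)

theorem esmooth_nabla {W : VecField n M} (hW : VSmooth W) : ESmooth (nabla W) :=
  fun _ hX ↦ hX.nabla hW

theorem fsmooth_tr_nabla {X : VecField n M} (hX : VSmooth X) :
    FSmooth n (fun y ↦ tr (nabla X y)) := (esmooth_nabla hX).tr

theorem curv_eq {x : M} {U V W : VecField n M} (hU : VSmooth U) (hV : VSmooth V) (hW : VSmooth W)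
    {w : TangentSpace (𝓡 n) x} (hw : W =ᶠ[𝓝 x] ext w) :
    curv x (U x) (V x) w =
      nabla (fun y ↦ nabla W y (U y)) x (V x) - nabla W x (nabla U x (V x)) -
        (nabla (fun y ↦ nabla W y (V y)) x (U x) - nabla W x (nabla V x (U x))) := by
  have h1 : ∀ u v : TangentSpace (𝓡 n) x,
      nablaEndAt (nabla (ext w)) x u v = nablaEndAt (nabla W) x u v := fun u v ↦ by
    have h2 : (fun y ↦ nabla (ext w) y (ext v y)) =ᶠ[𝓝 x] fun y ↦ nabla W y (ext v y) := by
      filter_upwards [eventually_eventually_nhds.mpr hw] with y hy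
      rw [nabla_congr hy]
    rw [nablaEndAt, nablaEndAt, nabla_congr h2, nabla_congr hw]
  rw [curv, h1, h1, nablaEndAt_eq (esmooth_nabla hW) (hU.vdiffAt x),
    nablaEndAt_eq (esmooth_nabla hW) (hV.vdiffAt x)]

/-- The Hessian of a function is symmetric. -/
theorem hessian_symm {f : M → ℝ} (hf : FSmooth n f) {U V : VecField n M} (hU : VSmooth U)
    (hV : VSmooth V) (x : M) :
    mvfderiv (𝓡 n) (fun y ↦ mvfderiv (𝓡 n) f y (U y)) x (V x) -
        mvfderiv (𝓡 n) f x (nabla U x (V x)) =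
      mvfderiv (𝓡 n) (fun y ↦ mvfderiv (𝓡 n) f y (V y)) x (U x) -
        mvfderiv (𝓡 n) f x (nabla V x (U x)) := by
  have h1 := mvfderiv_mlieBracket (hf x) (hU x) (hV x)
  rw [← nabla_sub_nabla (hU.vdiffAt x) (hV.vdiffAt x), map_sub] at h1
  linarith

/-- The Hessian of the function g(W,Z) is symmetric. Expanding it by metric compatibility, the
products of first derivatives are symmetric by themselves, and what remains is g(R(u,v)w,z) +
g(w,R(u,v)z) = 0. -/
theorem inner_curv_antisymm {x : M} (u v w z : TangentSpace (𝓡 n) x) :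
    (inner ℝ (curv x u v w) z : ℝ) = -inner ℝ w (curv x u v z) := by
  obtain ⟨U, hU, rfl⟩ := exists_vsmooth_eq u
  obtain ⟨V, hV, rfl⟩ := exists_vsmooth_eq v
  obtain ⟨W, hW, hw⟩ := exists_vsmooth_eventuallyEq_ext w
  obtain ⟨Z, hZ, hz⟩ := exists_vsmooth_eventuallyEq_ext z
  have hwx : W x = w := by rw [hw.self_of_nhds, ext_self]
  have hzx : Z x = z := by rw [hz.self_of_nhds, ext_self]
  have key : ∀ {A B : VecField n M}, VSmooth A → VSmooth B →
      mvfderiv (𝓡 n) (fun y ↦ mvfderiv (𝓡 n) (fun y ↦ (inner ℝ (W y) (Z y) : ℝ)) y (A y)) x (B x) =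
      inner ℝ (nabla (fun y ↦ nabla W y (A y)) x (B x)) (Z x) +
        inner ℝ (nabla W x (A x)) (nabla Z x (B x)) +
      (inner ℝ (nabla W x (B x)) (nabla Z x (A x)) +
        inner ℝ (W x) (nabla (fun y ↦ nabla Z y (A y)) x (B x))) := fun {A B} hA hB ↦ by
    have h1 : (fun y ↦ mvfderiv (𝓡 n) (fun y ↦ (inner ℝ (W y) (Z y) : ℝ)) y (A y)) =
        (fun y ↦ (inner ℝ (nabla W y (A y)) (Z y) : ℝ)) + fun y ↦
          (inner ℝ (W y) (nabla Z y (A y)) : ℝ) := by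
      ext1 y
      exact mvfderiv_inner (hW.vdiffAt y) (hZ.vdiffAt y) _
    rw [h1, mvfderiv_add (((hA.nabla hW).inner hZ).mdiffAt x) ((hW.inner (hA.nabla hZ)).mdiffAt x),
      _root_.add_apply, mvfderiv_inner ((hA.nabla hW).vdiffAt x) (hZ.vdiffAt x),
      mvfderiv_inner (hW.vdiffAt x) ((hA.nabla hZ).vdiffAt x)]
  have hs := hessian_symm (hW.inner hZ) hU hV x
  rw [key hU hV, key hV hU, mvfderiv_inner (hW.vdiffAt x) (hZ.vdiffAt x),
    mvfderiv_inner (hW.vdiffAt x) (hZ.vdiffAt x)] at hs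
  rw [curv_eq hU hV hW hw, curv_eq hU hV hZ hz, ← hwx, ← hzx]
  simp only [inner_sub_left, inner_sub_right]
  linarith

/-- The trace of the curvature action of an Einstein metric. -/
theorem tr_curvAct {c : ℝ} (hc : IsEinstein n M c) (k : EndField n M) (x : M) :
    tr (curvAct k x) = c * tr (k x) := by
  rw [tr_eq_sum, tr_eq_sum, Finset.mul_sum]
  simp only [curvAct, linOf_frame, sum_inner]
  rw [Finset.sum_comm]
  refine Finset.sum_congr rfl fun j _ ↦ ?_
  -- The two skew symmetries turn ∑ᵢ g(R(eⱼ,eᵢ) k eⱼ, eᵢ) into ∑ᵢ g(R(eᵢ,eⱼ) eᵢ, k eⱼ) = ric(eⱼ, k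
  -- eⱼ). No symmetry of k is needed.
  rw [real_inner_comm, ← hc, ric, ← Finset.sum_congr rfl]
  intro i _
  rw [inner_curv_antisymm, real_inner_comm]
  have h : curv x (frame x j) (frame x i) (k x (frame x j)) =
      -curv x (frame x i) (frame x j) (k x (frame x j)) := by
    rw [curv, curv, neg_sub]
  rw [h, inner_neg_left]

end Curvature

/-! ### Coordinate vector fields and Jacobi's formula -/

section Coordinates

variable {n : ℕ} {M : Type*} [TopologicalSpace M] [ChartedSpace (EuclideanSpace ℝ (Fin n)) M]
  [IsManifold (𝓡 n) ∞ M]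

theorem mdifferentiableAt_chart_symm {x₀ : M} {y : EuclideanSpace ℝ (Fin n)}
    (hy : y ∈ (chartAt (EuclideanSpace ℝ (Fin n)) x₀).target) :
    MDifferentiableAt (𝓡 n) (𝓡 n) (chartAt (EuclideanSpace ℝ (Fin n)) x₀).symm y :=
  (mdifferentiable_chart x₀).mdifferentiableAt_symm hy

/-- This links the vectors in the definition of the measure, given by the derivative of the inverse
chart, with the local frame from the trivialization, whose smoothness is known. -/
theorem coordVec_eq {x₀ : M} {y : EuclideanSpace ℝ (Fin n)}
    (hy : y ∈ (chartAt (EuclideanSpace ℝ (Fin n)) x₀).target) (i : Fin n) :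
    coordVec x₀ i y = coordFrame x₀ i ((chartAt (EuclideanSpace ℝ (Fin n)) x₀).symm y) := by
  have h1 := (chartAt (EuclideanSpace ℝ (Fin n)) x₀).map_target hy
  have h2 := TangentBundle.symmL_trivializationAt (I := 𝓡 n) h1
  rw [coordFrame, Trivialization.localFrame_apply_of_mem_baseSet _ _ h1]
  have h3 : extChartAt (𝓡 n) x₀ ((chartAt (EuclideanSpace ℝ (Fin n)) x₀).symm y) = y :=
    (chartAt (EuclideanSpace ℝ (Fin n)) x₀).right_inv hy
  rw [h3] at h2
  simp only [modelWithCornersSelf_coe, Set.range_id, mfderivWithin_univ] at h2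
  have h4 := congr($h2 (EuclideanSpace.single i (1 : ℝ)))
  have h5 : (EuclideanSpace.basisFun (Fin n) ℝ).toBasis i = EuclideanSpace.single i (1 : ℝ) := by
    simp
  rw [← h5] at h4
  rw [coordVec, ← h5]
  refine h4.symm.trans ?_
  rw [Trivialization.symmL_apply _ h1]
  exact (Trivialization.linearEquivAt_symm_apply (R := ℝ) _ _ h1 _).symm

theorem fderiv_comp_chart_symm {x₀ : M} {y : EuclideanSpace ℝ (Fin n)}
    (hy : y ∈ (chartAt (EuclideanSpace ℝ (Fin n)) x₀).target) {g : M → ℝ}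
    (hg : MDifferentiableAt (𝓡 n) 𝓘(ℝ) g ((chartAt (EuclideanSpace ℝ (Fin n)) x₀).symm y))
    (i : Fin n) :
    fderiv ℝ (g ∘ (chartAt (EuclideanSpace ℝ (Fin n)) x₀).symm) y (EuclideanSpace.single i 1) =
      mvfderiv (𝓡 n) g ((chartAt (EuclideanSpace ℝ (Fin n)) x₀).symm y)
        (coordFrame x₀ i ((chartAt (EuclideanSpace ℝ (Fin n)) x₀).symm y)) := by
  rw [← coordVec_eq hy, coordVec, ← mfderiv_eq_fderiv,
    mfderiv_comp y hg (mdifferentiableAt_chart_symm hy)]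
  rfl

/-- The `k`-th coordinate function of the chart at `x₀`. -/
def coordFun (x₀ : M) (k : Fin n) (p : M) : ℝ := chartAt (EuclideanSpace ℝ (Fin n)) x₀ p k

theorem fsmoothAt_coordFun {x₀ p : M} (hp : p ∈ chartDom n x₀) (k : Fin n) :
    FSmoothAt n (coordFun x₀ k) p :=
  ((EuclideanSpace.proj k : EuclideanSpace ℝ (Fin n) →L[ℝ] ℝ).contDiff.contMDiff.contMDiffAt).comp p
    (contMDiffAt_of_mem_maximalAtlas (IsManifold.chart_mem_maximalAtlas x₀) hp)

theorem mvfderiv_coordFun {x₀ p : M} (hp : p ∈ chartDom n x₀) (k i : Fin n) :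
    mvfderiv (𝓡 n) (coordFun x₀ k) p (coordFrame x₀ i p) = if k = i then 1 else 0 := by
  have hy := (chartAt (EuclideanSpace ℝ (Fin n)) x₀).map_source hp
  have hl := (chartAt (EuclideanSpace ℝ (Fin n)) x₀).left_inv hp
  have h1 := fderiv_comp_chart_symm (g := coordFun x₀ k) hy
    (by rw [hl]; exact (fsmoothAt_coordFun hp k).mdifferentiableAt (by simp)) i
  rw [hl] at h1
  rw [← h1]
  have h2 : coordFun x₀ k ∘ (chartAt (EuclideanSpace ℝ (Fin n)) x₀).symm =ᶠ[𝓝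
      (chartAt (EuclideanSpace ℝ (Fin n)) x₀ p)]
      (EuclideanSpace.proj k : EuclideanSpace ℝ (Fin n) →L[ℝ] ℝ) := by
    filter_upwards [(chartAt (EuclideanSpace ℝ (Fin n)) x₀).open_target.mem_nhds hy] with z hz
    simp [coordFun, (chartAt (EuclideanSpace ℝ (Fin n)) x₀).right_inv hz]
  rw [h2.fderiv_eq, ContinuousLinearMap.fderiv]
  simp

variable [RiemannianBundle (fun x : M ↦ TangentSpace (𝓡 n) x)]
  [IsContMDiffRiemannianBundle (𝓡 n) ∞ (EuclideanSpace ℝ (Fin n))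
      (fun x : M ↦ TangentSpace (𝓡 n) x)]

theorem eq_zero_of_mvfderiv_coordFun {x₀ p : M} (hp : p ∈ chartDom n x₀)
    {w : TangentSpace (𝓡 n) p} (hw : ∀ k, mvfderiv (𝓡 n) (coordFun (n := n) x₀ k) p w = 0) : w = 0 := by
  have h1 := coordFrame_expand hp w
  have h2 : ∀ k, (inner ℝ (coordDual x₀ k p) w : ℝ) = 0 := fun k ↦ by
    rw [← hw k]
    conv_rhs => rw [← h1]
    simp [mvfderiv_coordFun hp]
  rw [← h1]
  simp [h2]

/-- Coordinate vector fields commute. -/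
theorem mlieBracket_coordFrame {x₀ p : M} (hp : p ∈ chartDom n x₀) (i j : Fin n) :
    VectorField.mlieBracket (𝓡 n) (coordFrame x₀ i) (coordFrame x₀ j) p = 0 := by
  refine eq_zero_of_mvfderiv_coordFun hp fun k ↦ ?_
  -- The coordinate functions have locally constant derivatives along coordinate fields, so the
  -- commutator of the two derivations kills each of them.
  have h1 : ∀ i, (fun y ↦ mvfderiv (𝓡 n) (coordFun x₀ k) y (coordFrame x₀ i y)) =ᶠ[𝓝 p]
      fun _ ↦ if k = i then 1 else 0 := fun i ↦ by
    filter_upwards [(chartAt (EuclideanSpace ℝ (Fin n)) x₀).open_source.mem_nhds hp] with y hy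
    exact mvfderiv_coordFun hy k i
  rw [mvfderiv_mlieBracket (fsmoothAt_coordFun hp k) (vsmoothAt_coordFrame hp i)
    (vsmoothAt_coordFrame hp j), mvfderiv_congr (h1 i), mvfderiv_congr (h1 j)]
  have h2 : ∀ c : ℝ, mvfderiv (𝓡 n) (fun _ : M ↦ c) p = 0 := fun c ↦ mvfderiv_const c
  rw [h2, h2]
  simp

theorem mvfderiv_hasFDerivAt_comp {F : Type*} [NormedAddCommGroup F] [NormedSpace ℝ F] {g : M → F}
    {f : F → ℝ} {x : M} {f' : F →L[ℝ] ℝ} (hf : HasFDerivAt f f' (g x))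
    (hg : MDifferentiableAt (𝓡 n) 𝓘(ℝ, F) g x) (u : TangentSpace (𝓡 n) x) :
    mvfderiv (𝓡 n) (fun y ↦ f (g y)) x u = f' (mvfderiv (𝓡 n) g x u) := by
  have h1 := HasMFDerivAt.comp x hf.hasMFDerivAt hg.hasMFDerivAt
  unfold mvfderiv
  change _ = f' (mfderiv (𝓡 n) 𝓘(ℝ, F) g x u)
  change mfderiv (𝓡 n) 𝓘(ℝ) (f ∘ g) x u = _
  rw [h1.mfderiv]
  rfl

theorem det_updateRow_eq_sum {κ : Type*} [Fintype κ] [DecidableEq κ] (A : Matrix κ κ ℝ) (i : κ)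
    (v : κ → ℝ) : (A.updateRow i v).det = ∑ j, v j * A.adjugate j i := by
  rw [Matrix.det_eq_sum_mul_adjugate_row _ i]
  refine Finset.sum_congr rfl fun j _ ↦ ?_
  rw [Matrix.updateRow_self, Matrix.adjugate_apply, Matrix.adjugate_apply]
  simp

/-- Jacobi's formula for the derivative of a determinant. -/
theorem mvfderiv_det {κ : Type*} [Fintype κ] [DecidableEq κ] {A : M → κ → κ → ℝ} {x : M}
    (hA : ∀ i j, FSmoothAt n (fun y ↦ A y i j) x) (u : TangentSpace (𝓡 n) x) :
    mvfderiv (𝓡 n) (fun y ↦ (Matrix.of (A y)).det) x u =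
      ∑ i, ∑ j, mvfderiv (𝓡 n) (fun y ↦ A y i j) x u * (Matrix.of (A x)).adjugate j i := by
  -- The determinant is regarded as a multilinear function of the rows; its derivative is the sum
  -- over rows of the determinants with one row replaced.
  let D : ContinuousMultilinearMap ℝ (fun _ : κ ↦ κ → ℝ) ℝ :=
    { toMultilinearMap := (Matrix.detRowAlternating (n := κ) (R := ℝ)).toMultilinearMap
      cont := Continuous.matrix_det (A := fun B : κ → κ → ℝ ↦ Matrix.of B) continuous_id }
  have hg : MDifferentiableAt (𝓡 n) 𝓘(ℝ, κ → κ → ℝ) A x := by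
    refine ContMDiffAt.mdifferentiableAt (n := ∞) ?_ (by simp)
    exact contMDiffAt_pi_space.mpr fun i ↦ contMDiffAt_pi_space.mpr fun j ↦ hA i j
  have h1 := mvfderiv_hasFDerivAt_comp (D.hasFDerivAt (A x)) hg u
  have h2 : ∀ i j, mvfderiv (𝓡 n) (fun y ↦ A y i j) x u =
      mvfderiv (𝓡 n) A x u i j := fun i j ↦
    mvfderiv_hasFDerivAt_comp (ContinuousLinearMap.hasFDerivAt (x := A x)
      ((ContinuousLinearMap.proj (R := ℝ) (φ := fun _ : κ ↦ ℝ) j) ∘L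
        (ContinuousLinearMap.proj (R := ℝ) (φ := fun _ : κ ↦ κ → ℝ) i))) hg u
  change mvfderiv (𝓡 n) (fun y ↦ D (A y)) x u = _
  rw [h1, ContinuousMultilinearMap.linearDeriv_apply]
  refine Finset.sum_congr rfl fun i _ ↦ ?_
  change (Matrix.updateRow (Matrix.of (A x)) i _).det = _
  rw [det_updateRow_eq_sum]
  simp only [h2]

end Coordinates

/-! ### The divergence in local coordinates -/

section LocalDivergence

variable {n : ℕ} {M : Type*} [TopologicalSpace M] [ChartedSpace (EuclideanSpace ℝ (Fin n)) M]
  [IsManifold (𝓡 n) ∞ M] [RiemannianBundle (fun x : M ↦ TangentSpace (𝓡 n) x)]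

theorem tr_eq_sum_coordFrame {x₀ p : M} (hp : p ∈ chartDom n x₀)
    (A : TangentSpace (𝓡 n) p →L[ℝ] TangentSpace (𝓡 n) p) :
    tr A = ∑ i, (inner ℝ (A (coordFrame x₀ i p)) (coordDual x₀ i p) : ℝ) := by
  rw [tr_eq_sum]
  have h1 : ∀ a, (inner ℝ (A (frame p a)) (frame p a) : ℝ) =
      ∑ i, (inner ℝ (A (coordFrame x₀ i p)) (frame p a) : ℝ) *
        inner ℝ (frame p a) (coordDual x₀ i p) := fun a ↦ by
    conv_lhs => enter [2]; rw [← coordFrame_expand hp (frame p a)]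
    simp only [map_sum, map_smul, sum_inner, inner_smul_left, RCLike.conj_to_real]
    exact Finset.sum_congr rfl fun i _ ↦ by
      rw [mul_comm, real_inner_comm (coordDual x₀ i p)]
  simp only [h1]
  rw [Finset.sum_comm]
  exact Finset.sum_congr rfl fun i _ ↦ (frame p).sum_inner_mul_inner _ _

variable [IsContMDiffRiemannianBundle (𝓡 n) ∞ (EuclideanSpace ℝ (Fin n))
      (fun x : M ↦ TangentSpace (𝓡 n) x)]

theorem tr_nabla_smul {f : M → ℝ} {Y : VecField n M} {x : M}
    (hf : MDifferentiableAt (𝓡 n) 𝓘(ℝ) f x) (hY : VDiffAt Y x) :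
    tr (nabla (f • Y) x) = f x * tr (nabla Y x) + mvfderiv (𝓡 n) f x (Y x) := by
  rw [tr_eq_sum, tr_eq_sum]
  simp only [nabla_smul hf hY, inner_add_left, inner_smul_left, RCLike.conj_to_real,
    Finset.sum_add_distrib, ← Finset.mul_sum]
  congr 1
  conv_rhs => rw [← inner_frame_expand (Y x)]
  simp [real_inner_comm, mul_comm]

/-- By Jacobi's formula, ∂ᵢ det G = det G ∑ Gᵏˡ ∂ᵢGₖₗ. Metric compatibility splits ∂ᵢGₖₗ into two
terms that contribute equally, whence the factor 2. As coordinate fields commute, ∇_{∂ᵢ}∂ₖ =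
∇_{∂ₖ}∂ᵢ, and each contribution is the divergence of ∂ᵢ. -/
theorem tr_nabla_coordFrame {x₀ p : M} (hp : p ∈ chartDom n x₀) (i : Fin n) :
    2 * (coordGram (n := n) x₀ p).det * tr (nabla (coordFrame x₀ i) p) =
      mvfderiv (𝓡 n) (fun y ↦ (coordGram (n := n) x₀ y).det) p (coordFrame x₀ i p) := by
  have hd : ∀ k, VDiffAt (coordFrame (n := n) x₀ k) p := fun k ↦ (vsmoothAt_coordFrame hp k).vdiffAt
  have hdet := (coordGram_det_pos (n := n) hp).ne'
  have h1 := mvfderiv_det (A := fun y ↦ coordGram (n := n) x₀ y) (x := p)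
    (fun k l ↦ fsmoothAt_coordGram hp k l) (coordFrame x₀ i p)
  change mvfderiv (𝓡 n) (fun y ↦ (coordGram (n := n) x₀ y).det) p _ =
    ∑ k, ∑ l, _ * (coordGram (n := n) x₀ p).adjugate l k at h1
  rw [h1, tr_eq_sum_coordFrame hp]
  have hadj : ∀ l k, (coordGram (n := n) x₀ p).adjugate l k =
      (coordGram (n := n) x₀ p).det * (coordGram (n := n) x₀ p)⁻¹ l k := fun l k ↦ by
    rw [Matrix.inv_def, Matrix.smul_apply, Ring.inverse_eq_inv', smul_eq_mul, ← mul_assoc,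
      mul_inv_cancel₀ hdet, one_mul]
  have hsymm : ∀ l k, (coordGram (n := n) x₀ p)⁻¹ l k = (coordGram (n := n) x₀ p)⁻¹ k l := fun l k ↦ by
    have h2 : (coordGram (n := n) x₀ p).IsHermitian := Matrix.isHermitian_gram ℝ _
    simpa using h2.inv.apply k l
  have hG : ∀ k l, mvfderiv (𝓡 n) (fun y ↦ coordGram (n := n) x₀ y k l) p (coordFrame x₀ i p) =
      inner ℝ (nabla (coordFrame x₀ k) p (coordFrame x₀ i p)) (coordFrame x₀ l p) +
        inner ℝ (nabla (coordFrame x₀ l) p (coordFrame x₀ i p)) (coordFrame x₀ k p) := fun k l ↦ by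
    have h2 := mvfderiv_inner (hd k) (hd l) (coordFrame x₀ i p)
    rw [real_inner_comm (nabla (coordFrame x₀ l) p _)] at h2
    exact h2
  have htor : ∀ k, nabla (coordFrame x₀ i) p (coordFrame x₀ k p) =
      nabla (coordFrame x₀ k) p (coordFrame x₀ i p) := fun k ↦ by
    have h2 := nabla_sub_nabla (hd k) (hd i)
    rw [mlieBracket_coordFrame hp] at h2
    exact sub_eq_zero.mp h2
  simp only [hG, hadj, htor, coordDual, inner_sum, inner_smul_right]
  have h3 : ∑ k, ∑ l, inner ℝ (nabla (coordFrame x₀ l) p (coordFrame x₀ i p)) (coordFrame x₀ k p) *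
      (coordGram (n := n) x₀ p)⁻¹ l k = ∑ k, ∑ l, (coordGram (n := n) x₀ p)⁻¹ k l *
      (inner ℝ (nabla (coordFrame x₀ k) p (coordFrame x₀ i p)) (coordFrame x₀ l p) : ℝ) := by
    rw [Finset.sum_comm]
    exact Finset.sum_congr rfl fun k _ ↦ Finset.sum_congr rfl fun l _ ↦ mul_comm _ _
  have h4 : ∑ k, ∑ l, inner ℝ (nabla (coordFrame x₀ k) p (coordFrame x₀ i p)) (coordFrame x₀ l p) *
      (coordGram (n := n) x₀ p)⁻¹ l k = ∑ k, ∑ l, (coordGram (n := n) x₀ p)⁻¹ k l *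
      (inner ℝ (nabla (coordFrame x₀ k) p (coordFrame x₀ i p)) (coordFrame x₀ l p) : ℝ) :=
    Finset.sum_congr rfl fun k _ ↦ Finset.sum_congr rfl fun l _ ↦ by rw [hsymm, mul_comm]
  have h5 : ∀ a b D g : ℝ, (a + b) * (D * g) = D * (a * g) + D * (b * g) := by intros; ring
  simp only [h5, Finset.sum_add_distrib, ← Finset.mul_sum, h3, h4]
  ring

/-- The density of the Riemannian measure in the chart at `x₀`, as a function on `M`. -/
def coordDensity (n : ℕ) {M : Type*} [TopologicalSpace M]
    [ChartedSpace (EuclideanSpace ℝ (Fin n)) M] [IsManifold (𝓡 n) ∞ M]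
    [RiemannianBundle (fun x : M ↦ TangentSpace (𝓡 n) x)] (x₀ p : M) : ℝ :=
  √(coordGram (n := n) x₀ p).det

theorem coordDensity_pos {x₀ p : M} (hp : p ∈ chartDom n x₀) : 0 < coordDensity n x₀ p :=
  Real.sqrt_pos.mpr (coordGram_det_pos hp)

theorem fsmoothAt_coordGram_det {x₀ p : M} (hp : p ∈ chartDom n x₀) :
    FSmoothAt n (fun y ↦ (coordGram (n := n) x₀ y).det) p :=
  fsmoothAt_det (fsmoothAt_coordGram hp)

theorem fsmoothAt_coordDensity {x₀ p : M} (hp : p ∈ chartDom n x₀) :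
    FSmoothAt n (coordDensity n x₀) p :=
  ContMDiffAt.comp (f := fun y ↦ (coordGram (n := n) x₀ y).det) (g := Real.sqrt) p
    (Real.contDiffAt_sqrt (coordGram_det_pos hp).ne').contMDiffAt (fsmoothAt_coordGram_det hp)

theorem mvfderiv_coordDensity {x₀ p : M} (hp : p ∈ chartDom n x₀) (i : Fin n) :
    mvfderiv (𝓡 n) (coordDensity n x₀) p (coordFrame x₀ i p) =
      coordDensity n x₀ p * tr (nabla (coordFrame x₀ i) p) := by
  have h0 := coordDensity_pos hp
  have h1 := mvfderiv_hasFDerivAt_comp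
    (g := fun y ↦ (coordGram (n := n) x₀ y).det) ((Real.hasDerivAt_sqrt (coordGram_det_pos hp).ne').hasFDerivAt)
    ((fsmoothAt_coordGram_det hp).mdifferentiableAt (by simp)) (coordFrame x₀ i p)
  change mvfderiv (𝓡 n) (coordDensity n x₀) p _ = _ at h1
  rw [h1, ← tr_nabla_coordFrame hp]
  have h2 : (coordGram (n := n) x₀ p).det = coordDensity n x₀ p * coordDensity n x₀ p :=
    (Real.mul_self_sqrt (coordGram_det_pos hp).le).symm
  change (2 * (coordGram (n := n) x₀ p).det * tr (nabla (coordFrame x₀ i) p)) *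
    (1 / (2 * coordDensity n x₀ p)) = _
  rw [h2]
  field_simp

/-- The divergence of a vector field in local coordinates. -/
theorem coordDensity_mul_tr_nabla {x₀ p : M} (hp : p ∈ chartDom n x₀) {X : VecField n M}
    (hX : VSmooth X) : coordDensity n x₀ p * tr (nabla X p) =
      ∑ i, mvfderiv (𝓡 n) (fun y ↦ coordDensity n x₀ y * inner ℝ (coordDual x₀ i y) (X y)) p
        (coordFrame x₀ i p) := by
  have hd : ∀ k, VDiffAt (coordFrame (n := n) x₀ k) p := fun k ↦ (vsmoothAt_coordFrame hp k).vdiffAt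
  let c : Fin n → M → ℝ := fun i y ↦ inner ℝ (coordDual x₀ i y) (X y)
  have hc : ∀ i, MDifferentiableAt (𝓡 n) 𝓘(ℝ) (c i) p := fun i ↦
    (contMDiffAt_inner (vsmoothAt_coordDual hp i) (hX p)).mdifferentiableAt (by simp)
  have h1 : X =ᶠ[𝓝 p] fun y ↦ ∑ i, (c i • coordFrame x₀ i) y := by
    filter_upwards [(chartAt (EuclideanSpace ℝ (Fin n)) x₀).open_source.mem_nhds hp] with y hy
    exact (coordFrame_expand hy (X y)).symm
  have h2 : tr (nabla X p) = ∑ i, tr (nabla (c i • coordFrame x₀ i) p) := by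
    have h3 := nabla_sum (s := Finset.univ) (X := fun i ↦ c i • coordFrame x₀ i)
      fun i _ ↦ VDiffAt.smul (hc i) (hd i)
    rw [nabla_congr h1]
    refine (congrArg tr h3).trans ?_
    simp [tr]
  have h3 : ∀ i, mvfderiv (𝓡 n) (fun y ↦ coordDensity n x₀ y * c i y) p (coordFrame x₀ i p) =
      coordDensity n x₀ p * mvfderiv (𝓡 n) (c i) p (coordFrame x₀ i p) +
        c i p * mvfderiv (𝓡 n) (coordDensity n x₀) p (coordFrame x₀ i p) := fun i ↦ by
    rw [mvfderiv_smul_apply ((fsmoothAt_coordDensity hp).mdifferentiableAt (by simp)) (hc i)]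
    ring
  change _ = ∑ i, mvfderiv (𝓡 n) (fun y ↦ coordDensity n x₀ y * c i y) p (coordFrame x₀ i p)
  rw [h2, Finset.mul_sum]
  refine Finset.sum_congr rfl fun i _ ↦ ?_
  rw [tr_nabla_smul (hc i) (hd i), h3, mvfderiv_coordDensity hp]
  ring

end LocalDivergence

/-! ### The Riemannian measure in charts -/

section ChartVolume

variable {n : ℕ} {M : Type*} [TopologicalSpace M] [ChartedSpace (EuclideanSpace ℝ (Fin n)) M]
  [IsManifold (𝓡 n) ∞ M] [RiemannianBundle (fun x : M ↦ TangentSpace (𝓡 n) x)]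

/-- The inverse of the chart at `x₀`. -/
abbrev chartSymm (n : ℕ) {M : Type*} [TopologicalSpace M]
    [ChartedSpace (EuclideanSpace ℝ (Fin n)) M] (x₀ : M) : EuclideanSpace ℝ (Fin n) → M :=
  (chartAt (EuclideanSpace ℝ (Fin n)) x₀).symm

/-- The range of the chart at `x₀`. -/
abbrev chartRange (n : ℕ) {M : Type*} [TopologicalSpace M]
    [ChartedSpace (EuclideanSpace ℝ (Fin n)) M] (x₀ : M) : Set (EuclideanSpace ℝ (Fin n)) :=
  (chartAt (EuclideanSpace ℝ (Fin n)) x₀).target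

theorem isOpen_chartRange (x₀ : M) : IsOpen (chartRange n x₀) := (chartAt _ x₀).open_target

theorem measurableSet_chartRange (x₀ : M) : MeasurableSet (chartRange n x₀) :=
  (isOpen_chartRange x₀).measurableSet

theorem chartSymm_left_inv {x₀ p : M} (hp : p ∈ chartDom n x₀) :
    chartSymm n x₀ (chartAt (EuclideanSpace ℝ (Fin n)) x₀ p) = p := (chartAt _ x₀).left_inv hp

theorem coordGram_transform {x₀ x₁ p : M} {J : Matrix (Fin n) (Fin n) ℝ}
    (h : ∀ i, coordFrame (n := n) x₁ i p = ∑ k, J k i • coordFrame x₀ k p) :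
    coordGram (n := n) x₁ p = J.transpose * coordGram (n := n) x₀ p * J := by
  ext i j
  rw [coordGram_apply, h i, h j]
  simp only [sum_inner, inner_sum, inner_smul_left, inner_smul_right, Matrix.mul_apply,
    Matrix.transpose_apply, Finset.sum_mul, Finset.mul_sum, coordGram_apply, RCLike.conj_to_real]
  exact Finset.sum_congr rfl fun k _ ↦ Finset.sum_congr rfl fun l _ ↦ by ring

variable [IsContMDiffRiemannianBundle (𝓡 n) ∞ (EuclideanSpace ℝ (Fin n))
      (fun x : M ↦ TangentSpace (𝓡 n) x)]

/-- The transformation rule for the density under a change of coordinates. -/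
theorem coordDensity_transform {x₀ x₁ : M} {y : EuclideanSpace ℝ (Fin n)}
    (hy : y ∈ chartRange n x₁) (h₀ : chartSymm n x₁ y ∈ chartDom n x₀) :
    ∃ J : EuclideanSpace ℝ (Fin n) →L[ℝ] EuclideanSpace ℝ (Fin n),
      HasFDerivAt (fun z ↦ chartAt (EuclideanSpace ℝ (Fin n)) x₀ (chartSymm n x₁ z)) J y ∧
      coordDensity n x₁ (chartSymm n x₁ y) = |J.det| * coordDensity n x₀ (chartSymm n x₁ y) := by
  have h₁ : chartSymm n x₁ y ∈ chartDom n x₁ := (chartAt _ x₁).map_target hy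
  have hdiff : MDifferentiableAt (𝓡 n) (𝓡 n)
      (fun z ↦ chartAt (EuclideanSpace ℝ (Fin n)) x₀ (chartSymm n x₁ z)) y :=
    ((mdifferentiable_chart (I := 𝓡 n) x₀).mdifferentiableAt h₀).comp y
      (mdifferentiableAt_chart_symm hy)
  rw [mdifferentiableAt_iff_differentiableAt] at hdiff
  refine ⟨_, hdiff.hasFDerivAt, ?_⟩
  set J := fderiv ℝ (fun z ↦ chartAt (EuclideanSpace ℝ (Fin n)) x₀ (chartSymm n x₁ z)) y with hJ
  -- The entries of the Jacobian of the transition map are the coefficients dxᵏ(∂'ᵢ) that express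
  -- one coordinate frame in the other. The two Gram matrices are thus related by J, and the square
  -- root of det J² is |det J|.
  have hJe : ∀ k i, J (EuclideanSpace.single i 1) k =
      mvfderiv (𝓡 n) (coordFun (n := n) x₀ k) (chartSymm n x₁ y)
        (coordFrame x₁ i (chartSymm n x₁ y)) := fun k i ↦ by
    rw [← fderiv_comp_chart_symm hy ((fsmoothAt_coordFun h₀ k).mdifferentiableAt (by simp))]
    have h2 := ((EuclideanSpace.proj k : EuclideanSpace ℝ (Fin n) →L[ℝ] ℝ).hasFDerivAt.comp y
      hdiff.hasFDerivAt).fderiv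
    change _ = fderiv ℝ ((EuclideanSpace.proj k : EuclideanSpace ℝ (Fin n) →L[ℝ] ℝ) ∘
      fun z ↦ chartAt (EuclideanSpace ℝ (Fin n)) x₀ (chartSymm n x₁ z)) y _
    rw [h2]
    rfl
  have hdet : J.det = (Matrix.of fun k i ↦ mvfderiv (𝓡 n) (coordFun (n := n) x₀ k)
      (chartSymm n x₁ y) (coordFrame x₁ i (chartSymm n x₁ y))).det := by
    rw [ContinuousLinearMap.det, ← LinearMap.det_toMatrix (EuclideanSpace.basisFun (Fin n) ℝ).toBasis]
    congr 1
    ext k i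
    rw [LinearMap.toMatrix_apply, Matrix.of_apply, ← hJe]
    simp
  have h : ∀ i, coordFrame (n := n) x₁ i (chartSymm n x₁ y) = ∑ k,
      (Matrix.of fun k i ↦ mvfderiv (𝓡 n) (coordFun (n := n) x₀ k) (chartSymm n x₁ y)
        (coordFrame x₁ i (chartSymm n x₁ y))) k i • coordFrame x₀ k (chartSymm n x₁ y) := fun i ↦ by
    conv_lhs => rw [← coordFrame_expand h₀ (coordFrame x₁ i (chartSymm n x₁ y))]
    refine Finset.sum_congr rfl fun k _ ↦ ?_
    congr 1
    rw [Matrix.of_apply]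
    conv_rhs => rw [← coordFrame_expand h₀ (coordFrame x₁ i (chartSymm n x₁ y))]
    simp [mvfderiv_coordFun h₀]
  rw [coordDensity, coordDensity, coordGram_transform h, Matrix.det_mul, Matrix.det_mul,
    Matrix.det_transpose, ← hdet, mul_right_comm, Real.sqrt_mul (mul_self_nonneg _),
    Real.sqrt_mul_self_eq_abs]

variable [MeasurableSpace M] [BorelSpace M]

/-- The inverse chart is controlled only on the range of the chart, so only the part of a preimage
in that range is known to be measurable. -/
theorem measurableSet_chartRange_inter_preimage (x₀ : M) {s : Set M} (hs : MeasurableSet s) :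
    MeasurableSet (chartSymm n x₀ ⁻¹' s ∩ chartRange n x₀) := by
  have h1 : ContinuousOn (chartSymm n x₀) (chartRange n x₀) := (chartAt _ x₀).continuousOn_symm
  have h2 := (measurableSet_chartRange (n := n) x₀).subtype_image
    ((continuousOn_iff_continuous_domRestrict.mp h1).measurable hs)
  convert h2 using 1
  ext y
  simp [and_comm]

theorem aemeasurable_chartSymm (x₀ : M) :
    AEMeasurable (chartSymm n x₀) (volume.restrict (chartRange n x₀)) :=
  (chartAt (EuclideanSpace ℝ (Fin n)) x₀).continuousOn_symm.aemeasurable (measurableSet_chartRange x₀)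

theorem continuousOn_coordDensity_comp (x₀ : M) :
    ContinuousOn (fun y ↦ coordDensity n x₀ (chartSymm n x₀ y)) (chartRange n x₀) := fun y hy ↦ by
  have h1 := (fsmoothAt_coordDensity (n := n) ((chartAt _ x₀).map_target hy)).continuousAt
  exact (ContinuousAt.comp (f := chartSymm n x₀) h1
    ((chartAt _ x₀).continuousAt_symm hy)).continuousWithinAt

theorem aemeasurable_coordDensity_comp (x₀ : M) :
    AEMeasurable (fun y ↦ coordDensity n x₀ (chartSymm n x₀ y))
      (volume.restrict (chartRange n x₀)) :=
  (continuousOn_coordDensity_comp x₀).aemeasurable (measurableSet_chartRange x₀)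

theorem chartVolume_eq (x₀ : M) :
    chartVolume (n := n) x₀ = ((volume.restrict (chartRange n x₀)).withDensity fun y ↦
      ENNReal.ofReal (coordDensity n x₀ (chartSymm n x₀ y))).map (chartSymm n x₀) := by
  rw [chartVolume]
  congr 1
  refine withDensity_congr_ae ?_
  filter_upwards [ae_restrict_mem (measurableSet_chartRange x₀)] with y hy
  rw [coordDensity]
  congr 3
  ext i j
  simp only [Matrix.of_apply, coordGram_apply, coordVec_eq hy]

theorem chartVolume_apply (x₀ : M) {s : Set M} (hs : MeasurableSet s) :
    chartVolume (n := n) x₀ s = ∫⁻ y in chartSymm n x₀ ⁻¹' s ∩ chartRange n x₀,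
      ENNReal.ofReal (coordDensity n x₀ (chartSymm n x₀ y)) := by
  rw [chartVolume_eq, Measure.map_apply_of_aemeasurable
    ((aemeasurable_chartSymm x₀).mono_ac (withDensity_absolutelyContinuous _ _)) hs,
    withDensity_apply', Measure.restrict_restrict' (measurableSet_chartRange x₀)]

theorem chartVolume_inter_chartDom (x₀ : M) {s : Set M} (hs : MeasurableSet s) :
    chartVolume (n := n) x₀ (s ∩ chartDom n x₀) = chartVolume (n := n) x₀ s := by
  rw [chartVolume_apply x₀ hs,
    chartVolume_apply x₀ (hs.inter (chartAt _ x₀).open_source.measurableSet)]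
  congr 2
  ext y
  simp only [Set.preimage_inter, Set.mem_inter_iff, Set.mem_preimage]
  exact ⟨fun h ↦ ⟨h.1.1, h.2⟩, fun h ↦ ⟨⟨h.1, (chartAt _ x₀).map_target h.2⟩, h.2⟩⟩

/-- The measures of two charts agree on the intersection of their domains. -/
theorem chartVolume_eq_of_subset {x₀ x₁ : M} {s : Set M} (hs : MeasurableSet s)
    (h₀ : s ⊆ chartDom n x₀) (h₁ : s ⊆ chartDom n x₁) :
    chartVolume (n := n) x₀ s = chartVolume (n := n) x₁ s := by
  rw [chartVolume_apply x₀ hs, chartVolume_apply x₁ hs]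
  set τ : EuclideanSpace ℝ (Fin n) → EuclideanSpace ℝ (Fin n) :=
    fun z ↦ chartAt (EuclideanSpace ℝ (Fin n)) x₀ (chartSymm n x₁ z) with hτ
  set A := chartSymm n x₁ ⁻¹' s ∩ chartRange n x₁ with hA
  have himg : chartSymm n x₀ ⁻¹' s ∩ chartRange n x₀ = τ '' A := by
    ext z
    constructor
    · rintro ⟨hz, hz2⟩
      refine ⟨chartAt (EuclideanSpace ℝ (Fin n)) x₁ (chartSymm n x₀ z), ⟨?_, ?_⟩, ?_⟩
      · rw [Set.mem_preimage, chartSymm_left_inv (h₁ hz)]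
        exact hz
      · exact (chartAt _ x₁).map_source (h₁ hz)
      · simp only [hτ]
        rw [chartSymm_left_inv (h₁ hz), (chartAt _ x₀).right_inv hz2]
    · rintro ⟨y, ⟨hy, hy2⟩, rfl⟩
      refine ⟨?_, (chartAt _ x₀).map_source (h₀ hy)⟩
      rw [Set.mem_preimage, hτ, chartSymm_left_inv (h₀ hy)]
      exact hy
  choose! J hJ using fun y (hy : y ∈ A) ↦ coordDensity_transform (n := n) hy.2 (h₀ hy.1)
  have hinj : Set.InjOn τ A := by
    intro y hy z hz h
    have h2 := (chartAt _ x₀).injOn (h₀ hy.1) (h₀ hz.1) h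
    exact (chartAt _ x₁).symm.injOn hy.2 hz.2 h2
  -- Change of variables along the transition map τ, whose Jacobian factor is exactly the one in the
  -- transformation rule of the density.
  rw [himg, lintegral_image_eq_lintegral_abs_det_fderiv_mul volume
    (measurableSet_chartRange_inter_preimage x₁ hs)
    (fun y hy ↦ (hJ y hy).1.hasFDerivWithinAt) hinj]
  refine setLIntegral_congr_fun (measurableSet_chartRange_inter_preimage x₁ hs) fun y hy ↦ ?_
  rw [(hJ y hy).2, ENNReal.ofReal_mul (abs_nonneg _), chartSymm_left_inv (h₀ hy.1)]

theorem chartVolume_le (x₀ : M) : chartVolume (n := n) x₀ ≤ riemannianVolume n M :=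
  le_iSup (fun x₀ : M ↦ chartVolume (n := n) x₀) x₀

/-- On the domain of the chart at `x₀`, the Riemannian measure is the measure of the chart. -/
theorem riemannianVolume_restrict (x₀ : M) :
    (riemannianVolume n M).restrict (chartDom n x₀) = chartVolume (n := n) x₀ := by
  have hU : MeasurableSet (chartDom n x₀) := (chartAt _ x₀).open_source.measurableSet
  -- The right-hand side dominates every chart measure, hence their supremum: off the chart domain
  -- it is the Riemannian measure itself, and on the domain all charts agree where they overlap.
  have hle : riemannianVolume n M ≤
      (riemannianVolume n M).restrict (chartDom n x₀)ᶜ + chartVolume (n := n) x₀ := by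
    refine iSup_le fun x₁ ↦ Measure.le_iff.mpr fun s hs ↦ ?_
    rw [← measure_inter_add_sdiff s hU, add_comm, Measure.add_apply]
    refine add_le_add ?_ ?_
    · rw [Measure.restrict_apply hs, Set.sdiff_eq]
      exact chartVolume_le x₁ _
    · rw [← chartVolume_inter_chartDom x₁ (hs.inter hU), ← chartVolume_eq_of_subset (x₀ := x₀)
        ((hs.inter hU).inter (chartAt _ x₁).open_source.measurableSet)
        (fun y hy ↦ hy.1.2) (fun y hy ↦ hy.2)]
      exact measure_mono fun y hy ↦ hy.1.1
  refine Measure.ext fun s hs ↦ ?_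
  rw [Measure.restrict_apply hs]
  refine le_antisymm ?_ ?_
  · refine (hle _).trans ?_
    rw [Measure.add_apply, Measure.restrict_apply (hs.inter hU), Set.inter_assoc,
      Set.inter_compl_self, Set.inter_empty, measure_empty, zero_add]
    exact measure_mono Set.inter_subset_left
  · rw [← chartVolume_inter_chartDom x₀ hs]
    exact chartVolume_le x₀ _

-- With compactness this makes every smooth function integrable.
scoped instance instIsLocallyFiniteMeasure : IsLocallyFiniteMeasure (riemannianVolume n M) where
  finiteAtNhds x := by
    have hp : chartAt (EuclideanSpace ℝ (Fin n)) x x ∈ chartRange n x := mem_chart_target _ x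
    have hcont := (continuousOn_coordDensity_comp (n := n) x).continuousAt
      ((isOpen_chartRange x).mem_nhds hp)
    -- Near the image of x the density stays below its value plus 1; intersecting with a unit ball
    -- keeps the Lebesgue measure finite as well.
    have hev := hcont.eventually_lt continuousAt_const (lt_add_one _)
    obtain ⟨V, hV, hVo, hVp⟩ := mem_nhds_iff.mp (inter_mem hev
      (Metric.ball_mem_nhds (chartAt (EuclideanSpace ℝ (Fin n)) x x) one_pos))
    have hW : IsOpen (chartDom n x ∩ chartAt (EuclideanSpace ℝ (Fin n)) x ⁻¹' V) :=
      (chartAt _ x).isOpen_inter_preimage hVo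
    refine ⟨_, hW.mem_nhds ⟨mem_chart_source _ x, hVp⟩, ?_⟩
    rw [← Set.inter_eq_left.mpr (Set.inter_subset_left :
        chartDom n x ∩ chartAt (EuclideanSpace ℝ (Fin n)) x ⁻¹' V ⊆ chartDom n x),
      ← Measure.restrict_apply' (chartAt _ x).open_source.measurableSet, riemannianVolume_restrict,
      chartVolume_apply x hW.measurableSet]
    have hsub : chartSymm n x ⁻¹' (chartDom n x ∩ chartAt (EuclideanSpace ℝ (Fin n)) x ⁻¹' V) ∩
        chartRange n x ⊆ V := fun y hy ↦ by
      have h1 := hy.1.2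
      rwa [Set.mem_preimage, (chartAt _ x).right_inv hy.2] at h1
    calc _ ≤ ∫⁻ y in V, ENNReal.ofReal (coordDensity n x (chartSymm n x y)) :=
          lintegral_mono_set hsub
      _ ≤ ∫⁻ _ in V, ENNReal.ofReal (coordDensity n x
            (chartSymm n x (chartAt (EuclideanSpace ℝ (Fin n)) x x)) + 1) :=
          setLIntegral_mono measurable_const fun y hy ↦ ENNReal.ofReal_le_ofReal (hV hy).1.le
      _ < ⊤ := by
          rw [setLIntegral_const]
          exact ENNReal.mul_lt_top ENNReal.ofReal_lt_top
            ((measure_mono fun y hy ↦ (hV hy).2).trans_lt measure_ball_lt_top)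

-- The density is strictly positive on the range of a chart. This is what later turns an almost
-- everywhere identity of continuous functions into an identity at every point.
scoped instance instIsOpenPosMeasure : (riemannianVolume n M).IsOpenPosMeasure where
  open_pos U hU hne := by
    obtain ⟨x, hx⟩ := hne
    intro h0
    have h1 : chartVolume (n := n) x U = 0 := le_antisymm ((chartVolume_le x U).trans h0.le) bot_le
    have hA : IsOpen (chartSymm n x ⁻¹' U ∩ chartRange n x) := by
      rw [Set.inter_comm]
      exact (chartAt _ x).isOpen_inter_preimage_symm hU
    rw [chartVolume_apply x hU.measurableSet, lintegral_eq_zero_iff'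
      (((aemeasurable_coordDensity_comp x).mono_measure
        (Measure.restrict_mono Set.inter_subset_right le_rfl)).ennreal_ofReal),
      EventuallyEq, ae_restrict_iff' hA.measurableSet] at h1
    have h2 : volume (chartSymm n x ⁻¹' U ∩ chartRange n x) = 0 := by
      refine measure_mono_null (fun y hy ↦ ?_) (ae_iff.mp h1)
      simp only [Set.mem_ofPred_eq, Classical.not_imp]
      refine ⟨hy, ?_⟩
      simpa using coordDensity_pos ((chartAt _ x).map_target hy.2)
    refine (hA.measure_pos volume ⟨chartAt (EuclideanSpace ℝ (Fin n)) x x, ?_, mem_chart_target _ x⟩).ne' h2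
    rw [Set.mem_preimage, chartSymm_left_inv (mem_chart_source _ x)]
    exact hx

end ChartVolume

/-! ### The divergence theorem -/

section DivergenceTheorem

variable {n : ℕ} {M : Type*} [TopologicalSpace M] [ChartedSpace (EuclideanSpace ℝ (Fin n)) M]
  [IsManifold (𝓡 n) ∞ M] [RiemannianBundle (fun x : M ↦ TangentSpace (𝓡 n) x)]
  [IsContMDiffRiemannianBundle (𝓡 n) ∞ (EuclideanSpace ℝ (Fin n))
      (fun x : M ↦ TangentSpace (𝓡 n) x)]

theorem FSmooth.continuous {f : M → ℝ} (hf : FSmooth n f) : Continuous f :=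
  continuous_iff_continuousAt.mpr fun x ↦ (hf x).continuousAt

/-- Integration by parts against the constant function 1. -/
theorem integral_fderiv_eq_zero {E : Type*} [NormedAddCommGroup E] [NormedSpace ℝ E]
    [FiniteDimensional ℝ E] [MeasurableSpace E] [BorelSpace E] (μ : Measure E)
    [μ.IsAddHaarMeasure] {u : E → ℝ} (hu : ContDiff ℝ 1 u) (hc : HasCompactSupport u) (v : E) :
    ∫ y, fderiv ℝ u y v ∂μ = 0 := by
  have hint : Integrable (fun y ↦ fderiv ℝ u y v) μ :=
    ((hu.continuous_fderiv (by simp)).clm_apply continuous_const).integrable_of_hasCompactSupport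
      (hc.fderiv_apply ℝ v)
  have hint2 : Integrable u μ := hu.continuous.integrable_of_hasCompactSupport hc
  have h1 := integral_mul_fderiv_eq_neg_fderiv_mul_of_integrable (μ := μ) (f := fun _ : E ↦ (1 : ℝ))
    (g := u) (v := v) (by simp) (by simpa using hint) (by simpa using hint2)
    (fun x _ ↦ differentiableAt_const _) (fun x _ ↦ hu.differentiable (by simp) x)
  simpa using h1

theorem contDiffAt_comp_chartSymm {x₀ : M} {y : EuclideanSpace ℝ (Fin n)}
    (hy : y ∈ chartRange n x₀) {w : M → ℝ} (hw : FSmoothAt n w (chartSymm n x₀ y)) :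
    ContDiffAt ℝ ∞ (fun z ↦ w (chartSymm n x₀ z)) y := by
  rw [← contMDiffAt_iff_contDiffAt]
  exact ContMDiffAt.comp (g := w) (f := chartSymm n x₀) y hw
    (contMDiffAt_symm_of_mem_maximalAtlas (IsManifold.chart_mem_maximalAtlas x₀) hy)

/-- The integral of the coordinate derivatives of a function that is supported in the domain of the
chart at `x₀`. -/
theorem setIntegral_mvfderiv_coordFrame {x₀ : M} {w : M → ℝ} {K : Set M} (hK : IsCompact K)
    (hKs : K ⊆ chartDom n x₀) (hw : ∀ p ∈ chartDom n x₀, FSmoothAt n w p)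
    (hw0 : ∀ p ∉ K, w p = 0) (i : Fin n) :
    IntegrableOn (fun y ↦ mvfderiv (𝓡 n) w (chartSymm n x₀ y) (coordFrame x₀ i (chartSymm n x₀ y)))
        (chartRange n x₀) ∧
      ∫ y in chartRange n x₀, mvfderiv (𝓡 n) w (chartSymm n x₀ y)
        (coordFrame x₀ i (chartSymm n x₀ y)) = 0 := by
  classical
  -- Extension by zero is C¹ on the whole space because w vanishes off a compact subset of the chart
  -- domain, whose image stays inside the range.
  set u : EuclideanSpace ℝ (Fin n) → ℝ :=
    (chartRange n x₀).indicator fun y ↦ w (chartSymm n x₀ y) with hu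
  have hL : IsCompact (chartAt (EuclideanSpace ℝ (Fin n)) x₀ '' K) :=
    hK.image_of_continuousOn ((chartAt _ x₀).continuousOn.mono hKs)
  have hu0 : ∀ y ∉ chartAt (EuclideanSpace ℝ (Fin n)) x₀ '' K, u y = 0 := fun y hy ↦ by
    rw [hu, Set.indicator_apply_eq_zero]
    intro hy2
    refine hw0 _ fun h ↦ hy ⟨_, h, (chartAt _ x₀).right_inv hy2⟩
  have hsub : chartAt (EuclideanSpace ℝ (Fin n)) x₀ '' K ⊆ chartRange n x₀ := by
    rintro _ ⟨p, hp, rfl⟩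
    exact (chartAt _ x₀).map_source (hKs hp)
  have hin : ∀ y ∈ chartRange n x₀, u =ᶠ[𝓝 y] fun z ↦ w (chartSymm n x₀ z) := fun y hy ↦ by
    filter_upwards [(isOpen_chartRange x₀).mem_nhds hy] with z hz
    rw [hu, Set.indicator_of_mem hz]
  have hout : ∀ y ∉ chartRange n x₀, u =ᶠ[𝓝 y] fun _ ↦ 0 := fun y hy ↦ by
    filter_upwards [hL.isClosed.isOpen_compl.mem_nhds fun h ↦ hy (hsub h)] with z hz
    exact hu0 z hz
  have hsm : ContDiff ℝ 1 u := contDiff_iff_contDiffAt.mpr fun y ↦ by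
    by_cases hy : y ∈ chartRange n x₀
    · exact ((contDiffAt_comp_chartSymm hy (hw _ ((chartAt _ x₀).map_target hy))).of_le
        one_le_infty).congr_of_eventuallyEq (hin y hy)
    · exact contDiffAt_const.congr_of_eventuallyEq (hout y hy)
  have hcs : HasCompactSupport u := HasCompactSupport.intro hL hu0
  have hd : ∀ y ∈ chartRange n x₀, fderiv ℝ u y (EuclideanSpace.single i 1) =
      mvfderiv (𝓡 n) w (chartSymm n x₀ y) (coordFrame x₀ i (chartSymm n x₀ y)) := fun y hy ↦ by
    rw [(hin y hy).fderiv_eq]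
    exact fderiv_comp_chart_symm hy
      ((hw _ ((chartAt _ x₀).map_target hy)).mdifferentiableAt (by simp)) i
  have hint : Integrable (fun y ↦ fderiv ℝ u y (EuclideanSpace.single i 1)) :=
    ((hsm.continuous_fderiv (by simp)).clm_apply continuous_const).integrable_of_hasCompactSupport
      (hcs.fderiv_apply ℝ _)
  refine ⟨hint.integrableOn.congr_fun hd (measurableSet_chartRange x₀), ?_⟩
  rw [← setIntegral_congr_fun (measurableSet_chartRange x₀) hd,
    setIntegral_eq_integral_of_forall_compl_eq_zero fun y hy ↦ ?_,
    integral_fderiv_eq_zero volume hsm hcs]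
  rw [(hout y hy).fderiv_eq]
  simp

variable [MeasurableSpace M] [BorelSpace M]

theorem integral_riemannianVolume {x₀ : M} {F : M → ℝ} (hF : Continuous F)
    (h0 : ∀ p ∉ chartDom n x₀, F p = 0) :
    ∫ p, F p ∂(riemannianVolume n M) =
      ∫ y in chartRange n x₀, coordDensity n x₀ (chartSymm n x₀ y) * F (chartSymm n x₀ y) := by
  rw [← setIntegral_eq_integral_of_forall_compl_eq_zero h0, riemannianVolume_restrict,
    chartVolume_eq, integral_map ((aemeasurable_chartSymm x₀).mono_ac
      (withDensity_absolutelyContinuous _ _)) hF.aestronglyMeasurable,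
    integral_withDensity_eq_integral_toReal_smul₀ (aemeasurable_coordDensity_comp x₀).ennreal_ofReal
      (Eventually.of_forall fun y ↦ ENNReal.ofReal_lt_top)]
  refine setIntegral_congr_fun (measurableSet_chartRange x₀) fun y hy ↦ ?_
  simp only [smul_eq_mul]
  rw [ENNReal.toReal_ofReal (coordDensity_pos ((chartAt _ x₀).map_target hy)).le]

variable [CompactSpace M]

theorem FSmooth.integrable {f : M → ℝ} (hf : FSmooth n f) :
    Integrable f (riemannianVolume n M) :=
  hf.continuous.integrable_of_hasCompactSupport (HasCompactSupport.of_compactSpace f)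

variable [T2Space M]

/-- With ρ supported in one chart, the density times the divergence of ρX is a sum of coordinate
derivatives of compactly supported functions. -/
theorem integral_tr_nabla_smul {x₀ : M} {ρ : M → ℝ} (hρ : FSmooth n ρ)
    (hs : tsupport ρ ⊆ chartDom n x₀) {X : VecField n M} (hX : VSmooth X) :
    ∫ p, tr (nabla (ρ • X) p) ∂(riemannianVolume n M) = 0 := by
  have hρX : VSmooth (ρ • X) := hρ.smul hX
  have h0 : ∀ p ∉ tsupport ρ, tr (nabla (ρ • X) p) = 0 := fun p hp ↦ by
    have h1 : ρ • X =ᶠ[𝓝 p] (0 : VecField n M) := by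
      filter_upwards [(isClosed_tsupport ρ).isOpen_compl.mem_nhds hp] with q hq
      rw [Pi.smul_apply', image_eq_zero_of_notMem_tsupport hq, zero_smul]
      rfl
    rw [nabla_congr h1, nabla_zero]
    simp [tr]
  rw [integral_riemannianVolume (x₀ := x₀) (fsmooth_tr_nabla hρX).continuous
    fun p hp ↦ h0 p fun h ↦ hp (hs h)]
  have h1 : ∀ i, _ := fun i : Fin n ↦ setIntegral_mvfderiv_coordFrame (x₀ := x₀)
    (w := fun y ↦ coordDensity n x₀ y * inner ℝ (coordDual x₀ i y) ((ρ • X) y))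
    (isClosed_tsupport ρ).isCompact hs (fun p hp ↦ (fsmoothAt_coordDensity hp).mul
      (contMDiffAt_inner (vsmoothAt_coordDual hp i) (hρX p)))
    (fun p hp ↦ by simp [image_eq_zero_of_notMem_tsupport hp]) i
  rw [setIntegral_congr_fun (measurableSet_chartRange x₀) fun y hy ↦
    coordDensity_mul_tr_nabla ((chartAt _ x₀).map_target hy) hρX,
    integral_finsetSum _ fun i _ ↦ (h1 i).1]
  exact Finset.sum_eq_zero fun i _ ↦ (h1 i).2

/-- The **divergence theorem** on a compact Riemannian manifold. -/
theorem integral_tr_nabla {X : VecField n M} (hX : VSmooth X) :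
    ∫ p, tr (nabla X p) ∂(riemannianVolume n M) = 0 := by
  obtain ⟨s, ρ, hρ, hsub, hsum⟩ := exists_finite_partition n M
  have h1 : ∀ p, tr (nabla X p) = ∑ a ∈ s, tr (nabla (ρ a • X) p) := fun p ↦ by
    have h2 : X = fun y ↦ ∑ a ∈ s, (ρ a • X) y := by
      ext1 y
      simp only [Pi.smul_apply']
      rw [← Finset.sum_smul, hsum, one_smul]
    have h3 := nabla_sum (s := s) (X := fun a ↦ ρ a • X) (x := p)
      fun a _ ↦ VDiffAt.smul ((hρ a).mdiffAt p) (hX.vdiffAt p)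
    conv_lhs => rw [h2]
    refine (congrArg tr h3).trans ?_
    simp [tr]
  simp only [h1]
  have h2 : ∀ a ∈ s, Integrable (fun p ↦ tr (nabla (ρ a • X) p)) (riemannianVolume n M) :=
    fun a _ ↦ (fsmooth_tr_nabla ((hρ a).smul hX)).integrable
  rw [integral_finsetSum _ h2]
  exact Finset.sum_eq_zero fun a _ ↦ integral_tr_nabla_smul (hρ a) (hsub a) hX

end DivergenceTheorem

/-! ### Smoothness of endomorphism fields -/

section SymmetricTensors

variable {n : ℕ} {M : Type*} [TopologicalSpace M] [ChartedSpace (EuclideanSpace ℝ (Fin n)) M]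
  [IsManifold (𝓡 n) ∞ M] [RiemannianBundle (fun x : M ↦ TangentSpace (𝓡 n) x)]

theorem IsSym2.esmooth {h : EndField n M} (hh : IsSym2 h) : ESmooth h :=
  fun _ hX x ↦ ContMDiffAt.clm_bundle_apply (b := fun y : M ↦ y) (hh.smooth x) (hX x)

theorem contMDiffAt_clm_of_apply {f : M → EuclideanSpace ℝ (Fin n) →L[ℝ] EuclideanSpace ℝ (Fin n)}
    {x : M} (hf : ∀ i, ContMDiffAt (𝓡 n) 𝓘(ℝ, EuclideanSpace ℝ (Fin n)) ∞
      (fun y ↦ f y (EuclideanSpace.single i 1)) x) :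
    ContMDiffAt (𝓡 n) 𝓘(ℝ, EuclideanSpace ℝ (Fin n) →L[ℝ] EuclideanSpace ℝ (Fin n)) ∞ f x := by
  let L : Fin n → EuclideanSpace ℝ (Fin n) →L[ℝ]
      (EuclideanSpace ℝ (Fin n) →L[ℝ] EuclideanSpace ℝ (Fin n)) := fun i ↦
    ContinuousLinearMap.smulRightL ℝ _ _ (EuclideanSpace.proj i : EuclideanSpace ℝ (Fin n) →L[ℝ] ℝ)
  have h1 : f = fun y ↦ ∑ i, L i (f y (EuclideanSpace.single i 1)) := by
    ext1 y
    refine ContinuousLinearMap.coe_injective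
      ((EuclideanSpace.basisFun (Fin n) ℝ).toBasis.ext fun j ↦ ?_)
    simp [L]
  rw [h1]
  exact contMDiffAt_finsetSum fun i _ ↦ (L i).contDiff.contMDiff.contMDiffAt.comp x (hf i)

variable [IsContMDiffRiemannianBundle (𝓡 n) ∞ (EuclideanSpace ℝ (Fin n))
      (fun x : M ↦ TangentSpace (𝓡 n) x)] [CompactSpace M] [T2Space M]

/-- This is the way back from the action on vector fields to smoothness as a bundle section. It
admits f·id as a test tensor and the constructed v(h,h) as a symmetric tensor field. -/
theorem isSym2_of_esmooth {h : EndField n M} (hh : ESmooth h)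
    (hs : ∀ (y : M) (v w : TangentSpace (𝓡 n) y), (inner ℝ (h y v) w : ℝ) = inner ℝ v (h y w)) :
    IsSym2 h where
  symm := hs
  smooth x := by
    refine (contMDiffAt_hom_bundle (IB := 𝓡 n) _).mpr ⟨contMDiffAt_id, ?_⟩
    refine contMDiffAt_clm_of_apply fun i ↦ ?_
    have hx : x ∈ chartDom n x := mem_chart_source _ x
    -- A coordinate field is smooth only on its chart, so it is exchanged for a global smooth field
    -- with the same germ before h is applied.
    obtain ⟨Y, hY, hYe⟩ := exists_vsmooth_eventuallyEq ((chartAt _ x).open_source.mem_nhds hx)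
      (fun y hy ↦ vsmoothAt_coordFrame (n := n) (x₀ := x) hy i)
    have h1 := (contMDiffAt_section (E := fun y : M ↦ TangentSpace (𝓡 n) y) x).mp (hh Y hY x)
    refine h1.congr_of_eventuallyEq ?_
    filter_upwards [hYe, (chartAt (EuclideanSpace ℝ (Fin n)) x).open_source.mem_nhds hx] with y hy hyx
    have h2 : coordFrame (n := n) x i y =
        (trivializationAt (EuclideanSpace ℝ (Fin n)) (fun y : M ↦ TangentSpace (𝓡 n) y) x).symmL ℝ y
          (EuclideanSpace.single i 1) := by
      rw [coordFrame, Trivialization.localFrame_apply_of_mem_baseSet _ _ hyx,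
        Trivialization.symmL_apply _ hyx]
      refine (Trivialization.linearEquivAt_symm_apply (R := ℝ) _ _ hyx _).trans ?_
      simp
    rw [hy, h2]
    exact Trivialization.continuousLinearMapAt_apply_of_mem (R := ℝ) _ hyx _

end SymmetricTensors

/-! ### Algebraic adjoints of d_∇ and of the ♯-action -/

section BilinearAlgebra

variable {n : ℕ} {M : Type*} [TopologicalSpace M] [ChartedSpace (EuclideanSpace ℝ (Fin n)) M]
  [IsManifold (𝓡 n) ∞ M] [RiemannianBundle (fun x : M ↦ TangentSpace (𝓡 n) x)]

section Pointwise

variable {x : M} {A B C : TangentSpace (𝓡 n) x →L[ℝ] TangentSpace (𝓡 n) x →L[ℝ] TangentSpace (𝓡 n) x}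
  {a b c h : TangentSpace (𝓡 n) x →L[ℝ] TangentSpace (𝓡 n) x}

theorem innerEnd_comm : innerEnd a b = innerEnd b a :=
  Finset.sum_congr rfl fun _ _ ↦ real_inner_comm _ _

theorem innerEnd_add_left : innerEnd (a + b) c = innerEnd a c + innerEnd b c := by
  simp [innerEnd, inner_add_left, Finset.sum_add_distrib]

theorem innerEnd_sub_left : innerEnd (a - b) c = innerEnd a c - innerEnd b c := by
  simp [innerEnd, inner_sub_left, Finset.sum_sub_distrib]

theorem innerEnd_smul_left (r : ℝ) : innerEnd (r • a) b = r * innerEnd a b := by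
  simp [innerEnd, inner_smul_left, Finset.mul_sum]

theorem innerEnd_add_right : innerEnd a (b + c) = innerEnd a b + innerEnd a c := by
  simp [innerEnd, inner_add_right, Finset.sum_add_distrib]

theorem innerEnd_sub_right : innerEnd a (b - c) = innerEnd a b - innerEnd a c := by
  simp [innerEnd, inner_sub_right, Finset.sum_sub_distrib]

theorem innerEnd_smul_right (r : ℝ) : innerEnd a (r • b) = r * innerEnd a b := by
  simp [innerEnd, inner_smul_right, Finset.mul_sum]

theorem innerBil_comm : innerBil A B = innerBil B A :=
  Finset.sum_congr rfl fun _ _ ↦ innerEnd_comm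

theorem innerBil_sub_left : innerBil (A - B) C = innerBil A C - innerBil B C := by
  simp [innerBil, innerEnd_sub_left, Finset.sum_sub_distrib]

theorem innerBil_sub_right : innerBil A (B - C) = innerBil A B - innerBil A C := by
  simp [innerBil, innerEnd_sub_right, Finset.sum_sub_distrib]

theorem innerBil_smul_left (r : ℝ) : innerBil (r • A) B = r * innerBil A B := by
  simp [innerBil, innerEnd_smul_left, Finset.mul_sum]

theorem innerBil_flip : innerBil A.flip B.flip = innerBil A B := by
  simp only [innerBil, innerEnd, ContinuousLinearMap.flip_apply]
  exact Finset.sum_comm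

theorem innerBil_flip_left : innerBil A.flip B = innerBil A B.flip := by
  rw [← innerBil_flip, ContinuousLinearMap.flip_flip]

/-- A symmetric endomorphism can be moved between the slots of a trace. -/
theorem sum_bilin_symm (hs : ∀ v w : TangentSpace (𝓡 n) x, (inner ℝ (h v) w : ℝ) = inner ℝ v (h w))
    (β : TangentSpace (𝓡 n) x →ₗ[ℝ] TangentSpace (𝓡 n) x →ₗ[ℝ] ℝ) :
    ∑ i, β (h (frame x i)) (frame x i) = ∑ i, β (frame x i) (h (frame x i)) := by
  have h1 : ∀ i, β (h (frame x i)) (frame x i) =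
      ∑ l, (inner ℝ (frame x l) (h (frame x i)) : ℝ) * β (frame x l) (frame x i) := fun i ↦ by
    conv_lhs => rw [← inner_frame_expand (h (frame x i))]
    simp
  have h2 : ∀ i, β (frame x i) (h (frame x i)) =
      ∑ l, (inner ℝ (frame x l) (h (frame x i)) : ℝ) * β (frame x i) (frame x l) := fun i ↦ by
    conv_lhs => rw [← inner_frame_expand (h (frame x i))]
    simp
  simp only [h1, h2]
  rw [Finset.sum_comm]
  refine Finset.sum_congr rfl fun i _ ↦ Finset.sum_congr rfl fun l _ ↦ ?_
  rw [← hs, real_inner_comm]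

theorem innerEnd_comp_right
    (hs : ∀ v w : TangentSpace (𝓡 n) x, (inner ℝ (h v) w : ℝ) = inner ℝ v (h w)) :
    innerEnd (a ∘L h) b = innerEnd a (b ∘L h) :=
  sum_bilin_symm hs (LinearMap.mk₂ ℝ (fun p q ↦ (inner ℝ (a p) (b q) : ℝ))
    (by intros; simp [inner_add_left]) (by intros; simp [inner_smul_left])
    (by intros; simp [inner_add_right]) (by intros; simp [inner_smul_right]))

theorem innerEnd_comp_left
    (hs : ∀ v w : TangentSpace (𝓡 n) x, (inner ℝ (h v) w : ℝ) = inner ℝ v (h w)) :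
    innerEnd (h ∘L a) b = innerEnd a (h ∘L b) :=
  Finset.sum_congr rfl fun _ _ ↦ hs _ _

theorem sum_innerEnd_symm
    (hs : ∀ v w : TangentSpace (𝓡 n) x, (inner ℝ (h v) w : ℝ) = inner ℝ v (h w)) :
    ∑ i, innerEnd (A (h (frame x i))) (B (frame x i)) =
      ∑ i, innerEnd (A (frame x i)) (B (h (frame x i))) :=
  sum_bilin_symm hs (LinearMap.mk₂ ℝ (fun p q ↦ innerEnd (A p) (B q))
    (by intros; simp [innerEnd_add_left]) (by intros; simp [innerEnd_smul_left])
    (by intros; simp [innerEnd_add_right]) (by intros; simp [innerEnd_smul_right]))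

theorem inner_symPart (v w : TangentSpace (𝓡 n) x) :
    (inner ℝ (symPart a v) w : ℝ) = 1 / 2 * (inner ℝ (a v) w + inner ℝ v (a w)) := by
  have h1 : (linOf x fun v ↦ ∑ i, (inner ℝ v (a (frame x i)) : ℝ) • frame x i) v =
      ∑ i, (inner ℝ v (a (frame x i)) : ℝ) • frame x i :=
    linOf_eq _ (fun v w ↦ by simp [inner_add_left, add_smul, Finset.sum_add_distrib])
      (fun r v ↦ by simp [inner_smul_left, mul_smul, Finset.smul_sum]) v
  rw [symPart, _root_.smul_apply, inner_smul_left, _root_.add_apply, inner_add_left, h1]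
  conv_rhs => enter [2, 2, 3]; rw [← inner_frame_expand w]
  simp [sum_inner, inner_sum, inner_smul_left, inner_smul_right, mul_comm]

/-- The skew part is orthogonal to symmetric endomorphisms, so symmetrizing does not change products
with symmetric test tensors. -/
theorem innerEnd_symPart
    (hs : ∀ v w : TangentSpace (𝓡 n) x, (inner ℝ (h v) w : ℝ) = inner ℝ v (h w)) :
    innerEnd (symPart a) h = innerEnd a h := by
  have h1 : ∑ i, (inner ℝ (frame x i) (a (h (frame x i))) : ℝ) =
      ∑ i, inner ℝ (h (frame x i)) (a (frame x i)) :=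
    (sum_bilin_symm hs (LinearMap.mk₂ ℝ (fun p q ↦ (inner ℝ p (a q) : ℝ))
      (by intros; simp [inner_add_left]) (by intros; simp [inner_smul_left])
      (by intros; simp [inner_add_right]) (by intros; simp [inner_smul_right]))).symm
  simp only [innerEnd, inner_symPart]
  rw [← Finset.mul_sum, Finset.sum_add_distrib, h1]
  simp only [real_inner_comm (a _)]
  ring

end Pointwise

/-- The field of endomorphisms with `⟨contrEnd A B z, u⟩ = ⟨A u, B z⟩`. -/
def contrEnd (A B : BilField n M) : EndField n M :=
  fun y ↦ linOf y fun z ↦ ∑ i, innerEnd (A y (frame y i)) (B y z) • frame y i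

theorem inner_contrEnd (A B : BilField n M) (y : M) (z u : TangentSpace (𝓡 n) y) :
    (inner ℝ (contrEnd A B y z) u : ℝ) = innerEnd (A y u) (B y z) := by
  rw [contrEnd, linOf_eq _ (fun v w ↦ by simp [innerEnd_add_right, add_smul, Finset.sum_add_distrib])
    (fun r v ↦ by simp [innerEnd_smul_right, mul_smul, Finset.smul_sum])]
  rw [innerEnd_linear, sum_inner]
  exact Finset.sum_congr rfl fun i _ ↦ by rw [inner_smul_left, RCLike.conj_to_real, mul_comm]

/-- The field of bilinear maps with the slots exchanged. -/
def flipField (A : BilField n M) : BilField n M := fun y ↦ (A y).flip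

theorem innerEnd_contrEnd (A B : BilField n M) (k : EndField n M) (y : M) :
    innerEnd (contrEnd A B y) (k y) = ∑ i, innerEnd (A y (k y (frame y i))) (B y (frame y i)) :=
  Finset.sum_congr rfl fun _ _ ↦ inner_contrEnd A B y _ _

variable [IsContMDiffRiemannianBundle (𝓡 n) ∞ (EuclideanSpace ℝ (Fin n))
      (fun x : M ↦ TangentSpace (𝓡 n) x)] [CompactSpace M] [T2Space M]

theorem extD_eq (k : EndField n M) (x : M) :
    extD k x = nablaEnd k x - flipField (nablaEnd k) x := by
  ext1 u
  ext1 v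
  exact extD_apply k x u v

theorem innerBil_extD (k : EndField n M) (P : BilField n M) (x : M) :
    innerBil (extD k x) (P x) = innerBil (nablaEnd k x) (P x - flipField P x) := by
  rw [extD_eq, innerBil_sub_left, innerBil_sub_right, flipField, innerBil_flip_left, flipField]

theorem innerBil_sharp (h : EndField n M) (α P : BilField n M) (x : M) :
    innerBil (sharp h α x) (P x) = ∑ i, innerEnd (α x (h x (frame x i))) (P x (frame x i)) +
      ∑ i, innerEnd (flipField α x (h x (frame x i))) (flipField P x (frame x i)) := by
  have h1 : ∑ i, innerEnd (flipField α x (h x (frame x i))) (flipField P x (frame x i)) =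
      ∑ i, ∑ j, (inner ℝ (α x (frame x i) (h x (frame x j))) (P x (frame x i) (frame x j)) : ℝ) := by
    rw [Finset.sum_comm]
    rfl
  rw [h1, ← Finset.sum_add_distrib]
  refine Finset.sum_congr rfl fun i _ ↦ ?_
  rw [innerEnd, innerEnd, ← Finset.sum_add_distrib]
  exact Finset.sum_congr rfl fun j _ ↦ by rw [sharp_apply, inner_add_left]

/-- The expression is linear in k without derivatives; here the tensor representing it is exhibited,
one summand for each slot on which k acts. -/
theorem innerBil_sharp_eq_contrEnd (k : EndField n M) (α P : BilField n M) (x : M) :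
    innerBil (sharp k α x) (P x) =
      innerEnd (contrEnd α P x + contrEnd (flipField α) (flipField P) x) (k x) := by
  rw [innerBil_sharp, innerEnd_add_left, innerEnd_contrEnd, innerEnd_contrEnd]

/-- The action of a symmetric endomorphism is self-adjoint in each slot. -/
theorem innerBil_sharp_symm {h : EndField n M} {x : M}
    (hs : ∀ v w : TangentSpace (𝓡 n) x, (inner ℝ (h x v) w : ℝ) = inner ℝ v (h x w))
    (α P : BilField n M) : innerBil (sharp h α x) (P x) = innerBil (α x) (sharp h P x) := by
  rw [innerBil_sharp, innerBil_comm, innerBil_sharp, sum_innerEnd_symm hs, sum_innerEnd_symm hs]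
  simp only [innerEnd_comm]

theorem fnBracket_comm (h k : EndField n M) : fnBracket h k = fnBracket k h := by
  ext1 x
  rw [fnBracket, fnBracket, add_comm (sharp h _ x)]
  simp only [add_comm (h _ ∘L k _)]

end BilinearAlgebra

/-! ### Existence of the tensor v(h,h) -/

section OperatorV

variable {n : ℕ} {M : Type*} [TopologicalSpace M] [ChartedSpace (EuclideanSpace ℝ (Fin n)) M]
  [IsManifold (𝓡 n) ∞ M] [RiemannianBundle (fun x : M ↦ TangentSpace (𝓡 n) x)]
  [IsContMDiffRiemannianBundle (𝓡 n) ∞ (EuclideanSpace ℝ (Fin n))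
      (fun x : M ↦ TangentSpace (𝓡 n) x)] [CompactSpace M] [T2Space M]

theorem BSmooth.flipField {A : BilField n M} (hA : BSmooth A) : BSmooth (flipField A) :=
  fun X Y hX hY ↦ hA Y X hY hX

theorem BSmooth.sub {A B : BilField n M} (hA : BSmooth A) (hB : BSmooth B) :
    BSmooth (fun y ↦ A y - B y) :=
  fun X Y hX hY ↦ (hA X Y hX hY).sub (hB X Y hX hY)

theorem esmooth_contrEnd {A B : BilField n M} (hA : BSmooth A) (hB : BSmooth B) :
    ESmooth (contrEnd A B) := by
  refine fun X hX ↦ vsmooth_of_inner fun Z hZ ↦ ?_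
  simp only [inner_contrEnd]
  exact (hA.esmooth hZ).innerEnd (hB.esmooth hX)

theorem ESmooth.symPart {w : EndField n M} (hw : ESmooth w) : ESmooth (fun y ↦ symPart (w y)) := by
  refine fun X hX ↦ vsmooth_of_inner fun Z hZ ↦ ?_
  simp only [inner_symPart]
  exact FSmooth.mul (fun x ↦ fsmoothAt_const _ x)
    (((hw X hX).inner hZ).add (hX.inner (hw Z hZ)))

/-- Smoothness comes from the pointwise integration by parts formula, which expresses the function
through a divergence and an inner product of endomorphisms. -/
theorem fsmooth_innerBil_nablaEnd {A : BilField n M} {B : EndField n M} (hA : BSmooth A)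
    (hB : ESmooth B) : FSmooth n (fun y ↦ innerBil (A y) (nablaEnd B y)) := by
  have h1 : (fun y ↦ innerBil (A y) (nablaEnd B y)) = fun y ↦
      tr (nabla (contr A B) y) + innerEnd (divForm A y) (B y) := by
    ext1 y
    rw [tr_nabla_contr hA hB]
    ring
  rw [h1]
  exact (fsmooth_tr_nabla (vsmooth_contr hA hB)).add (hA.divForm.innerEnd hB)

/-- The skew part `A(u,v) - A(v,u)` of a field of bilinear maps. -/
def skewField (A : BilField n M) : BilField n M := fun y ↦ A y - flipField A y

/-- The tensor that represents `k ↦ ⟨k ♯ d_∇ h, ∇h⟩`. -/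
def sharpAdjoint (h : EndField n M) : EndField n M := fun y ↦
  contrEnd (extD h) (nablaEnd h) y + contrEnd (flipField (extD h)) (flipField (nablaEnd h)) y

/-- Each term is moved to a position where k occurs undifferentiated, or only through ∇k or ∇(hk +
kh): h♯ is self-adjoint, the adjoint of antisymmetrization is antisymmetrization, and k♯d_∇h is
represented by `sharpAdjoint`. One integration by parts then isolates k. -/
theorem two_mul_innerBil_fnBracket {h k : EndField n M}
    (hs : ∀ (y : M) (v w : TangentSpace (𝓡 n) y), (inner ℝ (h y v) w : ℝ) = inner ℝ v (h y w))
    (x : M) :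
    2 * innerBil (fnBracket h k x) (nablaEnd h x) =
      innerBil (skewField (nablaEnd h) x) (nablaEnd (fun y ↦ h y ∘L k y + k y ∘L h y) x) -
      innerBil (skewField (sharp h (nablaEnd h)) x) (nablaEnd k x) -
      innerEnd (sharpAdjoint h x) (k x) := by
  have h1 : fnBracket h k x = (1 / 2 : ℝ) • (extD (fun y ↦ h y ∘L k y + k y ∘L h y) x -
      sharp h (extD k) x - sharp k (extD h) x) := by
    rw [fnBracket]
    congr 1
    abel
  rw [h1, innerBil_smul_left, innerBil_sub_left, innerBil_sub_left, innerBil_extD,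
    innerBil_sharp_symm (hs x), innerBil_extD, innerBil_sharp_eq_contrEnd,
    innerBil_comm (A := nablaEnd _ x), innerBil_comm (A := nablaEnd k x)]
  simp only [skewField, sharpAdjoint]
  ring

variable [MeasurableSpace M] [BorelSpace M]

/-- Integration by parts for the divergence of a `TM`-valued bilinear form. -/
theorem integral_innerBil_nablaEnd {A : BilField n M} {B : EndField n M} (hA : BSmooth A)
    (hB : ESmooth B) :
    ∫ y, innerBil (A y) (nablaEnd B y) ∂(riemannianVolume n M) = innerL2 (divForm A) B := by
  have h1 : ∀ y, innerBil (A y) (nablaEnd B y) =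
      tr (nabla (contr A B) y) + innerEnd (divForm A y) (B y) := fun y ↦ by
    rw [tr_nabla_contr hA hB]
    ring
  simp only [h1]
  rw [integral_add (fsmooth_tr_nabla (vsmooth_contr hA hB)).integrable
    (hA.divForm.innerEnd hB).integrable, integral_tr_nabla (vsmooth_contr hA hB), zero_add, innerL2]

/-- The tensor field whose symmetric part is `v(h,h)`. -/
def vTensor (h : EndField n M) : EndField n M := fun y ↦
  divForm (fnBracket h h) y - divForm (skewField (sharp h (nablaEnd h))) y - sharpAdjoint h y +
    (h y ∘L divForm (skewField (nablaEnd h)) y + divForm (skewField (nablaEnd h)) y ∘L h y)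

theorem esmooth_vTensor {h : EndField n M} (hh : ESmooth h) : ESmooth (vTensor h) := by
  have hD : ESmooth (divForm (skewField (nablaEnd h))) :=
    (hh.nablaEnd.sub hh.nablaEnd.flipField).divForm
  have hP : ESmooth (divForm (skewField (sharp h (nablaEnd h)))) :=
    ((hh.sharp hh.nablaEnd).sub (hh.sharp hh.nablaEnd).flipField).divForm
  have hQ : ESmooth (sharpAdjoint h) := (esmooth_contrEnd hh.extD hh.nablaEnd).add
    (esmooth_contrEnd hh.extD.flipField hh.nablaEnd.flipField)
  exact (((bsmooth_fnBracket hh hh).divForm.sub hP).sub hQ).add ((hh.comp hD).add (hD.comp hh))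

theorem integral_sub_sub {α : Type*} [MeasurableSpace α] {μ : Measure α} {f g k : α → ℝ}
    (hf : Integrable f μ) (hg : Integrable g μ) (hk : Integrable k μ) :
    ∫ x, (f x - g x - k x) ∂μ = ∫ x, f x ∂μ - ∫ x, g x ∂μ - ∫ x, k x ∂μ := by
  rw [← integral_sub hf hg]
  exact integral_sub (hf.sub hg) hk

/-- The tensor `v(h,h)` exists. -/
theorem exists_isV {h : EndField n M} (hh : IsSym2 h) : ∃ w, IsV h h w := by
  have he := hh.esmooth
  have hw := (esmooth_vTensor he).symPart
  have hws : ∀ (y : M) (v w : TangentSpace (𝓡 n) y),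
      (inner ℝ (symPart (vTensor h y) v) w : ℝ) = inner ℝ v (symPart (vTensor h y) w) :=
    fun y v w ↦ by
      rw [inner_symPart, (real_inner_comm _ _).trans (inner_symPart w v), real_inner_comm v,
        real_inner_comm _ w, add_comm]
  refine ⟨_, isSym2_of_esmooth hw hws, fun k hk ↦ ?_⟩
  have ke := hk.esmooth
  -- By symmetry of the bracket the two mixed terms coincide; their divergence is traded for ∇h,
  -- leaving twice the product treated in `two_mul_innerBil_fnBracket`.
  rw [fnBracket_comm k h, add_assoc, ← two_mul,
    ← integral_innerBil_nablaEnd (bsmooth_fnBracket he ke) he, ← integral_const_mul]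
  simp only [two_mul_innerBil_fnBracket hh.symm]
  have hR : BSmooth (skewField (nablaEnd h)) := he.nablaEnd.sub he.nablaEnd.flipField
  have hP : BSmooth (skewField (sharp h (nablaEnd h))) :=
    (he.sharp he.nablaEnd).sub (he.sharp he.nablaEnd).flipField
  have hQ : ESmooth (sharpAdjoint h) := (esmooth_contrEnd he.extD he.nablaEnd).add
    (esmooth_contrEnd he.extD.flipField he.nablaEnd.flipField)
  have hs : ESmooth (fun y ↦ h y ∘L k y + k y ∘L h y) := (he.comp ke).add (ke.comp he)
  have i1 := (fsmooth_innerBil_nablaEnd hR hs).integrable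
  have i2 := (fsmooth_innerBil_nablaEnd hP ke).integrable
  have i3 := (hQ.innerEnd ke).integrable
  rw [integral_sub_sub i1 i2 i3, integral_innerBil_nablaEnd hR hs,
    integral_innerBil_nablaEnd hP ke]
  have j0 := ((bsmooth_fnBracket he he).divForm.innerEnd ke).integrable
  have j1 := (hR.divForm.innerEnd hs).integrable
  have j2 := (hP.divForm.innerEnd ke).integrable
  simp only [innerL2]
  rw [← integral_sub_sub j1 j2 i3]
  refine Eq.trans ?_ (integral_add j0 ((j1.sub j2).sub i3))
  refine integral_congr_ae (Eventually.of_forall fun y ↦ ?_)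
  change innerEnd (symPart (vTensor h y)) (k y) = _ + (_ - _ - _)
  -- Since k is symmetric, the symmetrization disappears. Since h is symmetric, ⟨D, hk + kh⟩ = ⟨hD +
  -- Dh, k⟩, which explains the last summand of `vTensor`.
  rw [innerEnd_symPart (hk.symm y), vTensor, innerEnd_add_left, innerEnd_sub_left,
    innerEnd_sub_left, innerEnd_add_left, innerEnd_add_right, innerEnd_comp_left (hh.symm y),
    innerEnd_comp_right (hh.symm y)]
  ring

end OperatorV

/-! ### The two trace formulas -/

section TraceFormula

variable {n : ℕ} {M : Type*} [TopologicalSpace M] [ChartedSpace (EuclideanSpace ℝ (Fin n)) M]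
  [IsManifold (𝓡 n) ∞ M] [RiemannianBundle (fun x : M ↦ TangentSpace (𝓡 n) x)]
  [IsContMDiffRiemannianBundle (𝓡 n) ∞ (EuclideanSpace ℝ (Fin n))
      (fun x : M ↦ TangentSpace (𝓡 n) x)] [CompactSpace M] [T2Space M]

theorem tr_nablaEnd_eq_zero {h : EndField n M} (hh : ESmooth h) (ht : ∀ x, tr (h x) = 0) (x : M)
    (u : TangentSpace (𝓡 n) x) : tr (nablaEnd h x u) = 0 := by
  rw [← mvfderiv_tr hh]
  simp only [ht]
  have h1 : mvfderiv (𝓡 n) (fun _ : M ↦ (0 : ℝ)) x = 0 := mvfderiv_const 0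
  rw [h1]
  rfl

theorem sum_frame_mvfderiv_mul (f : M → ℝ) {x : M} (v : TangentSpace (𝓡 n) x) :
    ∑ i, mvfderiv (𝓡 n) f x (frame x i) * (inner ℝ (frame x i) v : ℝ) = mvfderiv (𝓡 n) f x v := by
  conv_rhs => rw [← inner_frame_expand v]
  simp [mul_comm]

/-- The two Leibniz terms of ∇_u h² have the same trace because h and ∇_u h are symmetric. -/
theorem sum_inner_nablaEnd_comp {h : EndField n M} (hh : IsSym2 h) (x : M) (u : TangentSpace (𝓡 n) x) :
    ∑ j, (inner ℝ (h x (nablaEnd h x u (frame x j))) (frame x j) : ℝ) =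
      1 / 2 * inner ℝ (grad (n := n) (fun y ↦ tr (h y ∘L h y)) x) u := by
  have he := hh.esmooth
  rw [inner_grad, mvfderiv_tr (he.comp he), tr_eq_sum]
  simp only [nablaEnd_comp he he, inner_add_left, Finset.sum_add_distrib]
  have h1 : ∑ j, (inner ℝ (nablaEnd h x u (h x (frame x j))) (frame x j) : ℝ) =
      ∑ j, inner ℝ (h x (nablaEnd h x u (frame x j))) (frame x j) :=
    Finset.sum_congr rfl fun j _ ↦ by
      rw [inner_nablaEnd_symm he hh.symm, hh.symm, real_inner_comm, hh.symm]
  rw [h1]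
  ring

/-- In the Leibniz rule for δh², the term in which h acts last is h(δh) and vanishes. -/
theorem sum_nablaEnd_apply_self {h : EndField n M} (hh : IsSym2 h) (hd : ∀ x, div h x = 0) (x : M) :
    ∑ i, nablaEnd h x (frame x i) (h x (frame x i)) = -div (fun y ↦ h y ∘L h y) x := by
  have he := hh.esmooth
  have h0 : ∑ i, nablaEnd h x (frame x i) (frame x i) = 0 := neg_eq_zero.mp (hd x)
  rw [div, neg_neg]
  simp only [nablaEnd_comp he he, Finset.sum_add_distrib]
  rw [← map_sum, h0, map_zero, add_zero]

/-- After cancellation, [h,h](u,v) = h(∇_u h)v − (∇_{hu}h)v + (∇_{hv}h)u − h(∇_v h)u. Pairing with v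
and summing, the second term is a trace of ∇h and vanishes, while the last two cancel by the
symmetry of h. -/
theorem sum_inner_fnBracket_self {h : EndField n M} (hh : IsSym2 h) (ht : ∀ x, tr (h x) = 0) (x : M) (u : TangentSpace (𝓡 n) x) :
    ∑ j, (inner ℝ (fnBracket h h x u (frame x j)) (frame x j) : ℝ) =
      1 / 2 * inner ℝ (grad (n := n) (fun y ↦ tr (h y ∘L h y)) x) u := by
  have he := hh.esmooth
  rw [← sum_inner_nablaEnd_comp hh]
  have h1 : ∑ j, (inner ℝ (nablaEnd h x (h x u) (frame x j)) (frame x j) : ℝ) = 0 := by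
    rw [← tr_eq_sum, tr_nablaEnd_eq_zero he ht]
  have h2 : ∑ j, (inner ℝ (nablaEnd h x (h x (frame x j)) u) (frame x j) : ℝ) =
      ∑ j, inner ℝ (h x (nablaEnd h x (frame x j) u)) (frame x j) := by
    refine (sum_bilin_symm (hh.symm x) (LinearMap.mk₂ ℝ
      (fun p q ↦ (inner ℝ (nablaEnd h x p u) q : ℝ))
      (by intros; simp [inner_add_left]) (by intros; simp [inner_smul_left])
      (by intros; simp [inner_add_right]) (by intros; simp [inner_smul_right]))).trans ?_
    exact Finset.sum_congr rfl fun j _ ↦ (hh.symm x _ _).symm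
  have h3 : ∀ j, (inner ℝ (fnBracket h h x u (frame x j)) (frame x j) : ℝ) =
      inner ℝ (h x (nablaEnd h x u (frame x j))) (frame x j) -
      inner ℝ (nablaEnd h x (h x u) (frame x j)) (frame x j) +
      (inner ℝ (nablaEnd h x (h x (frame x j)) u) (frame x j) -
      inner ℝ (h x (nablaEnd h x (frame x j) u)) (frame x j)) := fun j ↦ by
    rw [fnBracket_apply, extD_apply, nablaEnd_add (he.comp he) (he.comp he),
      nablaEnd_add (he.comp he) (he.comp he), nablaEnd_comp he he, nablaEnd_comp he he,
      sharp_apply, extD_apply, extD_apply]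
    simp only [inner_smul_left, inner_add_left, inner_sub_left, inner_neg_left, RCLike.conj_to_real]
    ring
  simp only [h3, Finset.sum_add_distrib, Finset.sum_sub_distrib, h1, h2]
  ring

theorem innerBil_fnBracket_self_smul_id {h : EndField n M} (hh : IsSym2 h) (ht : ∀ x, tr (h x) = 0) {f : M → ℝ} (hf : FSmooth n f)
    (x : M) :
    innerBil (fnBracket h h x)
        (nablaEnd (fun y : M ↦ f y • ContinuousLinearMap.id ℝ (TangentSpace (𝓡 n) y)) x) =
      1 / 2 * mvfderiv (𝓡 n) f x (grad (n := n) (fun y ↦ tr (h y ∘L h y)) x) := by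
  rw [innerBil, ← sum_frame_mvfderiv_mul f, Finset.mul_sum]
  refine Finset.sum_congr rfl fun i _ ↦ ?_
  have h1 := sum_inner_fnBracket_self hh ht x (frame x i)
  rw [real_inner_comm] at h1
  simp only [innerEnd, nablaEnd_smul_id hf, inner_smul_right]
  rw [← Finset.mul_sum, h1]
  ring

/-- Here 2[h, f id](u,v) = df(u) hv − df(v) hu + df(hv) u − df(hu) v. Paired with ∇h, the first term
gives ½ df(grad tr h²) and the second df(δh²); the third vanishes because δh = 0, the fourth because
tr h = 0. -/
theorem two_mul_innerBil_fnBracket_smul_id {h : EndField n M} (hh : IsSym2 h) (ht : ∀ x, tr (h x) = 0) (hd : ∀ x, div h x = 0)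
    {f : M → ℝ} (hf : FSmooth n f) (x : M) :
    2 * innerBil (fnBracket h
        (fun y : M ↦ f y • ContinuousLinearMap.id ℝ (TangentSpace (𝓡 n) y)) x) (nablaEnd h x) =
      1 / 2 * mvfderiv (𝓡 n) f x (grad (n := n) (fun y ↦ tr (h y ∘L h y)) x) +
        mvfderiv (𝓡 n) f x (div (fun y ↦ h y ∘L h y) x) := by
  have he := hh.esmooth
  have hk := hf.smul_id
  have h1 : ∀ u v : TangentSpace (𝓡 n) x, (2 : ℝ) • fnBracket h
      (fun y : M ↦ f y • ContinuousLinearMap.id ℝ (TangentSpace (𝓡 n) y)) x u v =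
      mvfderiv (𝓡 n) f x u • h x v - mvfderiv (𝓡 n) f x v • h x u +
        mvfderiv (𝓡 n) f x (h x v) • u - mvfderiv (𝓡 n) f x (h x u) • v := fun u v ↦ by
    rw [fnBracket_apply, extD_apply, nablaEnd_add (he.comp hk) (hk.comp he),
      nablaEnd_add (he.comp hk) (hk.comp he), nablaEnd_comp he hk, nablaEnd_comp he hk,
      nablaEnd_comp hk he, nablaEnd_comp hk he, sharp_apply, sharp_apply, extD_apply, extD_apply,
      extD_apply, extD_apply]
    simp only [nablaEnd_smul_id hf, _root_.smul_apply, ContinuousLinearMap.id_apply, map_smul]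
    module
  have h2 : ∀ i, ∑ j, (inner ℝ (frame x j) (nablaEnd h x (frame x i) (frame x j)) : ℝ) = 0 :=
    fun i ↦ by
      rw [← tr_nablaEnd_eq_zero he ht x (frame x i), tr_eq_sum]
      exact Finset.sum_congr rfl fun j _ ↦ real_inner_comm _ _
  have h3 : ∀ j, ∑ i, (inner ℝ (frame x i) (nablaEnd h x (frame x i) (frame x j)) : ℝ) = 0 :=
    fun j ↦ by
      have h0 : ∑ i, nablaEnd h x (frame x i) (frame x i) = 0 := neg_eq_zero.mp (hd x)
      simp only [← inner_nablaEnd_symm he hh.symm]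
      rw [← sum_inner, h0, inner_zero_left]
  have h4 : ∀ i, ∑ j, (inner ℝ (h x (frame x j)) (nablaEnd h x (frame x i) (frame x j)) : ℝ) =
      1 / 2 * inner ℝ (frame x i) (grad (n := n) (fun y ↦ tr (h y ∘L h y)) x) := fun i ↦ by
    rw [real_inner_comm, ← sum_inner_nablaEnd_comp hh]
    exact Finset.sum_congr rfl fun j _ ↦ by rw [hh.symm, real_inner_comm]
  have h5 : ∀ j, ∑ i, (inner ℝ (h x (frame x i)) (nablaEnd h x (frame x i) (frame x j)) : ℝ) =
      -inner ℝ (frame x j) (div (fun y ↦ h y ∘L h y) x) := fun j ↦ by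
    simp only [← inner_nablaEnd_symm he hh.symm]
    rw [← sum_inner, sum_nablaEnd_apply_self hh hd, inner_neg_left, real_inner_comm]
  have h6 : 2 * innerBil (fnBracket h
        (fun y : M ↦ f y • ContinuousLinearMap.id ℝ (TangentSpace (𝓡 n) y)) x) (nablaEnd h x) =
      ∑ i, ∑ j, (inner ℝ ((2 : ℝ) • fnBracket h
        (fun y : M ↦ f y • ContinuousLinearMap.id ℝ (TangentSpace (𝓡 n) y)) x
          (frame x i) (frame x j)) (nablaEnd h x (frame x i) (frame x j)) : ℝ) := by
    simp only [innerBil, innerEnd, Finset.mul_sum, inner_smul_left, RCLike.conj_to_real]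
  rw [h6]
  simp only [h1, inner_add_left, inner_sub_left, inner_smul_left, RCLike.conj_to_real,
    Finset.sum_add_distrib, Finset.sum_sub_distrib]
  rw [Finset.sum_comm (f := fun i j ↦ mvfderiv (𝓡 n) f x (frame x j) * _),
    Finset.sum_comm (f := fun i j ↦ mvfderiv (𝓡 n) f x (h x (frame x j)) * _)]
  simp only [← Finset.mul_sum, h2, h3, h4, h5]
  rw [← sum_frame_mvfderiv_mul f (grad (n := n) _ x), ← sum_frame_mvfderiv_mul f (div _ x)]
  simp [Finset.mul_sum]
  exact Finset.sum_congr rfl fun i _ ↦ by ring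

variable [MeasurableSpace M] [BorelSpace M]

theorem integral_mvfderiv {f : M → ℝ} (hf : FSmooth n f) {Y : VecField n M} (hY : VSmooth Y) :
    ∫ x, mvfderiv (𝓡 n) f x (Y x) ∂(riemannianVolume n M) =
      -∫ x, f x * tr (nabla Y x) ∂(riemannianVolume n M) := by
  have h1 := integral_tr_nabla (hf.smul hY)
  have h2 : ∀ x, tr (nabla (fun y ↦ f y • Y y) x) =
      f x * tr (nabla Y x) + mvfderiv (𝓡 n) f x (Y x) := fun x ↦
    tr_nabla_smul (hf.mdiffAt x) (hY.vdiffAt x)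
  simp only [h2] at h1
  rw [integral_add (hf.mul (fsmooth_tr_nabla hY)).integrable (hf.mvfderiv hY).integrable] at h1
  linarith

/-- A continuous nonnegative function with zero integral vanishes identically, because open sets
have positive measure. -/
theorem fsmooth_eq_zero_of_integral {f : M → ℝ} (hf : FSmooth n f)
    (h0 : ∫ x, f x * f x ∂(riemannianVolume n M) = 0) (x : M) : f x = 0 := by
  rw [integral_eq_zero_iff_of_nonneg (fun x ↦ mul_self_nonneg _) (hf.mul hf).integrable] at h0
  have h1 := (Continuous.ae_eq_iff_eq (riemannianVolume n M) (hf.mul hf).continuous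
    continuous_const).mp h0
  exact mul_self_eq_zero.mp (congrFun h1 x)

/-- The trace of `v(h,h)` for a trace free and divergence free symmetric tensor `h`. -/
theorem tr_isV {h w : EndField n M} (hh : IsSym2 h) (ht : ∀ x, tr (h x) = 0)
    (hd : ∀ x, div h x = 0) (hw : IsV h h w) (x : M) :
    tr (w x) = -(tr (nabla (grad (n := n) fun y ↦ tr (h y ∘L h y)) x) +
      tr (nabla (div fun y ↦ h y ∘L h y) x)) := by
  have he := hh.esmooth
  have hG : VSmooth (grad (n := n) fun y ↦ tr (h y ∘L h y)) := vsmooth_grad (he.comp he).tr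
  have hD : VSmooth (div fun y ↦ h y ∘L h y) := (he.comp he).div
  -- Test against f·id: the left-hand side becomes ∫ f tr w, and on the right only first derivatives
  -- of f appear, which integration by parts removes.
  have key : ∀ f : M → ℝ, FSmooth n f → ∫ x, f x * tr (w x) ∂(riemannianVolume n M) =
      -(∫ x, f x * tr (nabla (grad (n := n) fun y ↦ tr (h y ∘L h y)) x) ∂(riemannianVolume n M) +
        ∫ x, f x * tr (nabla (div fun y ↦ h y ∘L h y) x) ∂(riemannianVolume n M)) := by
    intro f hf
    have hk := hf.smul_id
    have h1 := hw.innerL2_eq _ (isSym2_of_esmooth hk fun y v w ↦ by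
      simp [inner_smul_left, inner_smul_right])
    rw [fnBracket_comm (fun y : M ↦ f y • ContinuousLinearMap.id ℝ (TangentSpace (𝓡 n) y)) h,
      add_assoc, ← two_mul,
      ← integral_innerBil_nablaEnd (bsmooth_fnBracket he he) hk,
      ← integral_innerBil_nablaEnd (bsmooth_fnBracket he hk) he, ← integral_const_mul] at h1
    simp only [innerBil_fnBracket_self_smul_id hh ht hf,
      two_mul_innerBil_fnBracket_smul_id hh ht hd hf, innerL2, innerEnd_smul_right,
      innerEnd_id] at h1
    rw [integral_add ((hf.mvfderiv hG).integrable.const_mul _) (hf.mvfderiv hD).integrable,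
      integral_const_mul, integral_mvfderiv hf hG, integral_mvfderiv hf hD] at h1
    rw [h1]
    ring
  have hw1 := hw.isSym2.esmooth.tr
  -- The defect of the claimed identity is itself used as the test function, so the integral of its
  -- square is zero.
  have hs : FSmooth n (fun x ↦ tr (w x) + (tr (nabla (grad (n := n) fun y ↦ tr (h y ∘L h y)) x) +
      tr (nabla (div fun y ↦ h y ∘L h y) x))) :=
    hw1.add ((fsmooth_tr_nabla hG).add (fsmooth_tr_nabla hD))
  have h1 := key _ hs
  refine eq_neg_of_add_eq_zero_left (fsmooth_eq_zero_of_integral hs ?_ x)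
  have h2 : ∀ f a b c : M → ℝ, FSmooth n f → FSmooth n a → FSmooth n b → FSmooth n c →
      ∫ x, f x * (a x + (b x + c x)) ∂(riemannianVolume n M) =
        ∫ x, f x * a x ∂(riemannianVolume n M) + (∫ x, f x * b x ∂(riemannianVolume n M) +
          ∫ x, f x * c x ∂(riemannianVolume n M)) := fun f a b c hf ha hb hc ↦ by
    simp only [mul_add]
    rw [← integral_add (hf.mul hb).integrable (hf.mul hc).integrable]
    exact integral_add (hf.mul ha).integrable ((hf.mul hb).add (hf.mul hc)).integrable
  rw [h2 _ _ _ _ hs hw1 (fsmooth_tr_nabla hG) (fsmooth_tr_nabla hD), h1]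
  ring

/-- The factor 2 of the first term collects one div grad tr k from the rough Laplacian and one from
the summand ½ d tr of the gauge term; symmetrizing ∇X does not change its trace. -/
theorem tr_einsteinOpTilde {c : ℝ} (hc : IsEinstein n M c) {k : EndField n M} (hk : ESmooth k)
    (x : M) : tr (einsteinOpTilde k x) =
      -2 * tr (nabla (grad (n := n) fun y ↦ tr (k y)) x) - 2 * tr (nabla (div k) x) -
        2 * c * tr (k x) := by
  have hG : VSmooth (grad (n := n) fun y ↦ tr (k y)) := vsmooth_grad hk.tr
  have h1 : nabla (fun y ↦ div k y + (1 / 2 : ℝ) • grad (n := n) (fun z ↦ tr (k z)) y) x =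
      nabla (div k) x + (1 / 2 : ℝ) • nabla (grad (n := n) fun y ↦ tr (k y)) x := by
    have h2 := nabla_add (hk.div.vdiffAt x) ((vsmooth_const_smul (1 / 2) hG).vdiffAt x)
    refine Eq.trans h2 (congrArg _ ?_)
    ext1 u
    exact nabla_const_smul _ (hG.vdiffAt x) u
  rw [einsteinOpTilde, einsteinOp, tr_sub, tr_sub, tr_smul, tr_smul, tr_divStar, h1, tr_add,
    tr_smul, tr_roughLaplacian hk, tr_curvAct hc]
  ring

end TraceFormula

end EinsteinDeformation

end

theorem mainTheorem9 {n : ℕ} {M : Type*} [TopologicalSpace M] [T2Space M] [CompactSpace M]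
    [ChartedSpace (EuclideanSpace ℝ (Fin n)) M] [IsManifold (𝓡 n) ∞ M]
    [MeasurableSpace M] [BorelSpace M]
    [RiemannianBundle (fun x : M ↦ TangentSpace (𝓡 n) x)]
    [IsContMDiffRiemannianBundle (𝓡 n) ∞ (EuclideanSpace ℝ (Fin n))
      (fun x : M ↦ TangentSpace (𝓡 n) x)]
    (c : ℝ) (hc : EinsteinDeformation.IsEinstein n M c)
    (h : ∀ x : M, TangentSpace (𝓡 n) x →L[ℝ] TangentSpace (𝓡 n) x)
    (hh : EinsteinDeformation.IsInfEinsteinDef h) (x : M) :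
    EinsteinDeformation.tr
      (c • (h x ∘L h x) - EinsteinDeformation.vOp h h x
        + (1 / 2 : ℝ) • EinsteinDeformation.einsteinOpTilde (fun y ↦ h y ∘L h y) x) = 0 := by
  have hs := hh.isSym2
  have he := hs.esmooth
  -- Existence selects the first branch of `vOp`, so the default value 0 plays no role.
  have hex := EinsteinDeformation.exists_isV hs
  have hv : EinsteinDeformation.IsV h h (EinsteinDeformation.vOp h h) := by
    rw [EinsteinDeformation.vOp, dif_pos hex]
    exact hex.choose_spec
  -- In terms of h², −tr v(h,h) is the divergence of grad tr h² + δh², and ½ tr Δ̃_E h² is minus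
  -- that divergence minus c tr h²; everything cancels.
  rw [EinsteinDeformation.tr_add, EinsteinDeformation.tr_sub, EinsteinDeformation.tr_smul,
    EinsteinDeformation.tr_smul, EinsteinDeformation.tr_isV hs hh.tr_eq_zero hh.div_eq_zero hv,
    EinsteinDeformation.tr_einsteinOpTilde hc (he.comp he)]
  ring
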